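/- Let $\ell>0$, let $B_\ell=\{x\in\mathbb R^2:|x|<\ell\}$, let $\alpha,\beta,\gamma\in S^1\subset\mathbb R^2$ be the vertices of an equilateral triangle, let $T_{\alpha\beta\gamma}$ be that (filled) triangle and $L=|\beta-\alpha|$ its side length. Let $u_T:B_\ell\to\{\alpha,\beta,\gamma\}$ be a symmetric triple junction map, i.e. $u_T$ equals $\alpha,\beta,\gamma$ respectively on three non-overlapping open circular sectors of $B_\ell$ with common vertex $0$ and opening angle $2\pi/3$. Then $$\overline{\mathcal A}_{BV}(u_T;B_\ell)=|B_\ell|+L\,\mathcal H^1(J_{u_T})+|T_{\alpha\beta\gamma}|.$$ Here $|\cdot|$ of a set is Lebesgue measure, $\mathcal H^1$ is the one-dimensional Hausdorff measure, $J_{u_T}$ is the (approximate) jump set of $u_T$ in $B_\ell$, and for a bounded open set $\Omega\subset\mathbb R^2$ and $u\in BV(\Omega;\mathbb R^2)$, $$\overline{\mathcal A}_{BV}(u;\Omega)=\inf\Big\{\liminf_{k\to\infty}\int_\Omega\sqrt{1+|\nabla v_k|^2+(\det\nabla v_k)^2}\,dx\Big\},$$ where $|\nabla v_k|$ is the Frobenius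 norm and the infimum is over all sequences $(v_k)\subset C^1(\Omega;\mathbb R^2)\cap BV(\Omega;\mathbb R^2)$ converging to $u$ strictly in $BV$, i.e. $v_k\to u$ in $L^1(\Omega;\mathbb R^2)$ and $|Dv_k|(\Omega)\to|Du|(\Omega)$, with $|Du|(\Omega)$ the total variation of the distributional derivative $Du$ with respect to the Frobenius norm. -/

import Mathlib

open MeasureTheory Filter Topology Set

namespace TripleJunction

/-- The Euclidean plane, with the Euclidean norm and Lebesgue measure. -/
abbrev Plane : Type := EuclideanSpace ℝ (Fin 2)

/-- The Jacobian matrix `∇v(x)`, with entries `∂v_i/∂x_j (x)`. -/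
noncomputable def grad (v : Plane → Plane) (x : Plane) : Matrix (Fin 2) (Fin 2) ℝ :=
  Matrix.of fun i j => (fderiv ℝ v x (EuclideanSpace.single j 1)) i

/-- The area of the graph of a `C¹` map `v : Ω → ℝ²`, a number in `[0, ∞]`:
`𝓐(v; Ω) = ∫_Ω √(1 + |∇v₁|² + |∇v₂|² + (det ∇v)²) dx`. -/
noncomputable def area (v : Plane → Plane) (Ω : Set Plane) : ENNReal :=
  ∫⁻ x in Ω, ENNReal.ofReal
    (Real.sqrt (1 + (∑ i, ∑ j, (grad v x i j) ^ 2) + (grad v x).det ^ 2))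

/-- Divergence of a vector field on the plane. -/
noncomputable def divergence (φ : Plane → Plane) (x : Plane) : ℝ :=
  ∑ j, (fderiv ℝ φ x (EuclideanSpace.single j 1)) j

/-- Matrix-valued test fields `φ ∈ C¹_c(Ω; ℝ^{2×2})` (row `i` is the vector field `φ i`)
whose Frobenius norm is at most `1` at every point. -/
def IsTestField (Ω : Set Plane) (φ : Fin 2 → Plane → Plane) : Prop :=
  (∀ i, ContDiff ℝ 1 (φ i) ∧ HasCompactSupport (φ i) ∧ tsupport (φ i) ⊆ Ω) ∧
    ∀ x, ∑ i, ‖φ i x‖ ^ 2 ≤ 1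

/-- The total variation `|Du|(Ω)` (with respect to the Frobenius norm) of a map
`u ∈ L¹(Ω; ℝ²)`: the supremum of `∑ i, ∫_Ω u_i div φ_i dx` over all test fields `φ`.
The zero field is a test field, so truncating negative values at `0` changes nothing. -/
noncomputable def totalVariation (u : Plane → Plane) (Ω : Set Plane) : ENNReal :=
  ⨆ (φ : Fin 2 → Plane → Plane) (_ : IsTestField Ω φ),
    ENNReal.ofReal (∑ i, ∫ x in Ω, u x i * divergence (φ i) x)

/-- `u ∈ BV(Ω; ℝ²)`. -/
def MemBV (u : Plane → Plane) (Ω : Set Plane) : Prop :=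
  IntegrableOn u Ω ∧ totalVariation u Ω < ⊤

/-- Strict convergence in `BV(Ω; ℝ²)` of the sequence `v` to `u`. -/
def StrictBVConv (v : ℕ → Plane → Plane) (u : Plane → Plane) (Ω : Set Plane) : Prop :=
  MemBV u Ω ∧ (∀ k, MemBV (v k) Ω) ∧
    Tendsto (fun k => ∫⁻ x in Ω, ‖v k x - u x‖ₑ) atTop (𝓝 0) ∧
    Tendsto (fun k => totalVariation (v k) Ω) atTop (𝓝 (totalVariation u Ω))

/-- The relaxed area functional with respect to strict `BV` convergence: the infimum of
`liminf_k 𝓐(v_k; Ω)` over all sequences in `C¹(Ω; ℝ²) ∩ BV(Ω; ℝ²)` converging strictly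
to `u`. -/
noncomputable def relaxedArea (u : Plane → Plane) (Ω : Set Plane) : ENNReal :=
  ⨅ (v : ℕ → Plane → Plane) (_ : ∀ k, ContDiffOn ℝ 1 (v k) Ω) (_ : StrictBVConv v u Ω),
    liminf (fun k => area (v k) Ω) atTop

/-- The open half-disk `{y ∈ B_ρ(x) : (y - x) · ν > 0}`. -/
def halfDisk (x ν : Plane) (ρ : ℝ) : Set Plane :=
  {y | y ∈ Metric.ball x ρ ∧ 0 < inner ℝ (y - x) ν}

/-- The (approximate) jump set `J_u` of `u` in the open set `Ω`: the points `x ∈ Ω` at which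
`u` has two different one-sided `L¹`-approximate limits `p`, `q` on the two sides of the line
through `x` orthogonal to some unit vector `ν`
(`laverage` is the mean value over the half-disk). -/
def jumpSet (u : Plane → Plane) (Ω : Set Plane) : Set Plane :=
  {x | x ∈ Ω ∧ ∃ p q ν : Plane, p ≠ q ∧ ‖ν‖ = 1 ∧
    Tendsto (fun ρ : ℝ => laverage (volume.restrict (halfDisk x ν ρ)) fun y => ‖u y - p‖ₑ) (𝓝[>] 0) (𝓝 0) ∧
    Tendsto (fun ρ : ℝ => laverage (volume.restrict (halfDisk x (-ν) ρ)) fun y => ‖u y - q‖ₑ) (𝓝[>] 0) (𝓝 0)}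

/-- The open circular sector of radius `ℓ` centred at the origin between the angles
`θ₁` and `θ₂`. -/
def sector (ℓ θ₁ θ₂ : ℝ) : Set Plane :=
  {x | ∃ r ∈ Ioo 0 ℓ, ∃ θ ∈ Ioo θ₁ θ₂, x = !₂[r * Real.cos θ, r * Real.sin θ]}

/-- `α, β, γ` are the vertices of an equilateral triangle inscribed in the unit circle. -/
def IsInscribedEquilateral (α β γ : Plane) : Prop :=
  ‖α‖ = 1 ∧ ‖β‖ = 1 ∧ ‖γ‖ = 1 ∧ α ≠ β ∧ dist α β = dist β γ ∧ dist β γ = dist γ α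

/-- `u` is a symmetric triple junction map on the disk `B_ℓ(0)` with values `α, β, γ`: these
are the vertices of an equilateral triangle inscribed in the unit circle, and `u` takes them
on three non-overlapping sectors with vertex `0` and opening `2π/3`. The position `θ₀` of the
first sector is arbitrary, and so is the choice among `α, β, γ` on the interfaces. -/
def IsSymmetricTripleJunction (u : Plane → Plane) (ℓ : ℝ) (α β γ : Plane) : Prop :=
  IsInscribedEquilateral α β γ ∧
    (∀ x ∈ Metric.ball (0 : Plane) ℓ, u x = α ∨ u x = β ∨ u x = γ) ∧
    ∃ θ₀ : ℝ,
      (∀ x ∈ sector ℓ θ₀ (θ₀ + 2 * Real.pi / 3), u x = α) ∧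
      (∀ x ∈ sector ℓ (θ₀ + 2 * Real.pi / 3) (θ₀ + 4 * Real.pi / 3), u x = β) ∧
      (∀ x ∈ sector ℓ (θ₀ + 4 * Real.pi / 3) (θ₀ + 2 * Real.pi), u x = γ)

end TripleJunction

/-! The density √(1 + |∇v|² + det²) lies above each of 1, |∇v|, |det| and below their sum. The three
terms of the formula come from these three quantities on regions that separate in the limit: the
bulk, thin neighbourhoods of the interfaces, and a small disk around the junction.

Upper bound. The maps `recovery` have the form ψ(r)P(θ). The loop P (`smoothLoop`) runs once around
the boundary of the triangle, resting at the vertices except near the interface angles, and ψ rises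
from 0 to 1 between ε/2 and ε. The gradient integral is at most 3Lℓ + 2πε. Since r det = ψψ' ·
cross(P, P'), the determinant contributes at most 1/2 · 3|cross α β|, which is the area of the
triangle because its centre is the origin. The total variation of u is exactly 3Lℓ, bounded below by
the test field `calibration` and above by lower semicontinuity along the recovery maps; hence these
converge strictly.

Lower bound. Let v be C¹ and L¹-close to u, with total variation close to 3Lℓ. On a circle where v
is close to the step map, the image curve has length at least almost 3L. These lengths integrate in
r to at most the total variation (`lintegral_circleLength_le`), so little excess is available, and
some circle with radius in (δ, 2δ) carries a closed curve of length almost 3L passing near the three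
vertices (`IsJunctionAt.exists_good_circle`). Such a curve consists of three nearly straight arcs
and therefore encloses nearly the signed area of the triangle (`abs_integral_loop_sub_le`). By
Green's formula (`circulation_eq_integral`) the determinant inside the circle already accounts for
that area. Outside, every circle pays 3L near the interface angles and r times the remaining angle
(`ofReal_le_lintegral_slice`), which gives the jump term and the area of the disk. -/

namespace TripleJunction

/-! ### Polar coordinates, moving frames and the cross product. -/

/-- The point of the plane with polar coordinates `(r, θ)`. -/
noncomputable def pol (r θ : ℝ) : Plane := !₂[r * Real.cos θ, r * Real.sin θ]

/-- The unit vector in the direction of increasing angle. -/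
noncomputable def angDir (θ : ℝ) : Plane := !₂[-Real.sin θ, Real.cos θ]

/-- The two-dimensional cross product. -/
def cross (a b : Plane) : ℝ := a 0 * b 1 - a 1 * b 0

/-- The Frobenius norm of the Jacobian matrix. -/
noncomputable def gradNorm (v : Plane → Plane) (x : Plane) : ℝ :=
  Real.sqrt (∑ i, ∑ j, (grad v x i j) ^ 2)

@[simp] lemma pol_apply_zero (r θ : ℝ) : pol r θ 0 = r * Real.cos θ := rfl
@[simp] lemma pol_apply_one (r θ : ℝ) : pol r θ 1 = r * Real.sin θ := rfl
@[simp] lemma angDir_apply_zero (θ : ℝ) : angDir θ 0 = -Real.sin θ := rfl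
@[simp] lemma angDir_apply_one (θ : ℝ) : angDir θ 1 = Real.cos θ := rfl

lemma plane_ext {x y : Plane} (h0 : x 0 = y 0) (h1 : x 1 = y 1) : x = y := by
  ext i; fin_cases i <;> assumption

lemma norm_sq_eq (x : Plane) : ‖x‖ ^ 2 = x 0 ^ 2 + x 1 ^ 2 := by
  simp [EuclideanSpace.norm_sq_eq]

lemma inner_eq (x y : Plane) : inner ℝ x y = x 0 * y 0 + x 1 * y 1 := by
  simp [PiLp.inner_apply, mul_comm]

/-- Lagrange's identity. It bounds `cross`, and later splits a velocity into components along and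
across a chord. -/
lemma inner_sq_add_cross_sq (a b : Plane) :
    inner ℝ a b ^ 2 + cross a b ^ 2 = ‖a‖ ^ 2 * ‖b‖ ^ 2 := by
  rw [norm_sq_eq, norm_sq_eq, inner_eq, cross]; ring

lemma abs_cross_le (a b : Plane) : |cross a b| ≤ ‖a‖ * ‖b‖ := by
  apply abs_le_of_sq_le_sq _ (by positivity)
  rw [mul_pow, ← inner_sq_add_cross_sq]
  nlinarith [sq_nonneg (inner ℝ a b)]

@[fun_prop] lemma continuous_cross : Continuous fun p : Plane × Plane => cross p.1 p.2 := by
  unfold cross; fun_prop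

lemma cross_self (a : Plane) : cross a a = 0 := by unfold cross; ring
lemma cross_swap (a b : Plane) : cross a b = -cross b a := by unfold cross; ring
lemma cross_add_right (a b c : Plane) : cross a (b + c) = cross a b + cross a c := by
  simp [cross]; ring
lemma cross_sub_left (a b c : Plane) : cross (a - b) c = cross a c - cross b c := by
  simp [cross]; ring
lemma cross_sub_right (a b c : Plane) : cross a (b - c) = cross a b - cross a c := by
  simp [cross]; ring
lemma cross_smul_left (t : ℝ) (a b : Plane) : cross (t • a) b = t * cross a b := by
  simp [cross]; ring
lemma cross_smul_right (t : ℝ) (a b : Plane) : cross a (t • b) = t * cross a b := by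
  simp [cross]; ring

@[simp] lemma norm_pol (r θ : ℝ) : ‖pol r θ‖ = |r| := by
  rw [← abs_norm, ← sq_eq_sq_iff_abs_eq_abs, norm_sq_eq]
  simp only [pol_apply_zero, pol_apply_one]
  linear_combination r ^ 2 * Real.sin_sq_add_cos_sq θ

@[simp] lemma norm_angDir (θ : ℝ) : ‖angDir θ‖ = 1 := by
  rw [← abs_norm, ← abs_one, ← sq_eq_sq_iff_abs_eq_abs, norm_sq_eq]
  simp

lemma pol_add_two_pi (r θ : ℝ) : pol r (θ + 2 * Real.pi) = pol r θ := by
  apply plane_ext <;> simp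

lemma linearMap_apply_eq (A : Plane →L[ℝ] Plane) (w : Plane) (i : Fin 2) :
    A w i = w 0 * A (EuclideanSpace.single 0 1) i + w 1 * A (EuclideanSpace.single 1 1) i := by
  have h : w = w 0 • EuclideanSpace.single 0 (1 : ℝ) + w 1 • EuclideanSpace.single 1 (1 : ℝ) := by
    apply plane_ext <;> simp
  conv_lhs => rw [h, map_add, map_smul, map_smul]
  simp

/-- The vectors `pol 1 θ` and `angDir θ` form a positively oriented orthonormal frame, so neither
the Frobenius norm nor, below, the determinant changes when the Jacobian is expressed in it. -/
lemma sum_grad_sq_eq (v : Plane → Plane) (x : Plane) (θ : ℝ) :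
    ∑ i, ∑ j, (grad v x i j) ^ 2 =
      ‖fderiv ℝ v x (pol 1 θ)‖ ^ 2 + ‖fderiv ℝ v x (angDir θ)‖ ^ 2 := by
  simp only [norm_sq_eq, linearMap_apply_eq _ (pol 1 θ), linearMap_apply_eq _ (angDir θ)]
  simp only [grad, Fin.sum_univ_two, Matrix.of_apply, pol_apply_zero, pol_apply_one,
    angDir_apply_zero, angDir_apply_one]
  have h := Real.sin_sq_add_cos_sq θ
  generalize fderiv ℝ v x (EuclideanSpace.single 0 1) 0 = a
  generalize fderiv ℝ v x (EuclideanSpace.single 0 1) 1 = b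
  generalize fderiv ℝ v x (EuclideanSpace.single 1 1) 0 = c
  generalize fderiv ℝ v x (EuclideanSpace.single 1 1) 1 = d
  linear_combination (-(a ^ 2 + b ^ 2 + c ^ 2 + d ^ 2)) * h

lemma det_grad_eq (v : Plane → Plane) (x : Plane) (θ : ℝ) :
    (grad v x).det = cross (fderiv ℝ v x (pol 1 θ)) (fderiv ℝ v x (angDir θ)) := by
  rw [cross]
  simp only [linearMap_apply_eq _ (pol 1 θ), linearMap_apply_eq _ (angDir θ)]
  simp only [grad, Matrix.det_fin_two, Matrix.of_apply, pol_apply_zero, pol_apply_one,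
    angDir_apply_zero, angDir_apply_one]
  have h := Real.sin_sq_add_cos_sq θ
  generalize fderiv ℝ v x (EuclideanSpace.single 0 1) 0 = a
  generalize fderiv ℝ v x (EuclideanSpace.single 0 1) 1 = b
  generalize fderiv ℝ v x (EuclideanSpace.single 1 1) 0 = c
  generalize fderiv ℝ v x (EuclideanSpace.single 1 1) 1 = d
  linear_combination (-(a * d - c * b)) * h

lemma gradNorm_sq (v : Plane → Plane) (x : Plane) :
    gradNorm v x ^ 2 = ∑ i, ∑ j, (grad v x i j) ^ 2 :=
  Real.sq_sqrt (by positivity)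

lemma gradNorm_nonneg (v : Plane → Plane) (x : Plane) : 0 ≤ gradNorm v x := Real.sqrt_nonneg _

lemma norm_fderiv_angDir_le (v : Plane → Plane) (x : Plane) (θ : ℝ) :
    ‖fderiv ℝ v x (angDir θ)‖ ≤ gradNorm v x := by
  apply Real.le_sqrt_of_sq_le
  rw [sum_grad_sq_eq v x θ]
  nlinarith [sq_nonneg ‖fderiv ℝ v x (pol 1 θ)‖]

lemma gradNorm_le (v : Plane → Plane) (x : Plane) (θ : ℝ) :
    gradNorm v x ≤ ‖fderiv ℝ v x (pol 1 θ)‖ + ‖fderiv ℝ v x (angDir θ)‖ := by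
  rw [gradNorm, sum_grad_sq_eq v x θ]
  apply Real.sqrt_le_iff.2 ⟨by positivity, _⟩
  nlinarith [norm_nonneg (fderiv ℝ v x (pol 1 θ)), norm_nonneg (fderiv ℝ v x (angDir θ))]

@[fun_prop] lemma contDiff_pol {n : WithTop ℕ∞} :
    ContDiff ℝ n fun p : ℝ × ℝ => pol p.1 p.2 := by
  rw [contDiff_euclidean]
  intro i
  fin_cases i
  · exact contDiff_fst.mul (Real.contDiff_cos.comp contDiff_snd)
  · exact contDiff_fst.mul (Real.contDiff_sin.comp contDiff_snd)

lemma hasDerivAt_plane {f : ℝ → Plane} {f' : Plane} {t : ℝ}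
    (h0 : HasDerivAt (fun s => f s 0) (f' 0) t) (h1 : HasDerivAt (fun s => f s 1) (f' 1) t) :
    HasDerivAt f f' t := by
  rw [hasDerivAt_iff_hasFDerivAt, ← hasFDerivWithinAt_univ, hasFDerivWithinAt_euclidean]
  intro i
  have key : ∀ i, HasDerivAt (fun s => f s i) (f' i) t := by
    intro i; fin_cases i <;> assumption
  convert! (key i).hasFDerivAt.hasFDerivWithinAt using 1

lemma hasDerivAt_pol_left (r θ : ℝ) : HasDerivAt (fun r => pol r θ) (pol 1 θ) r := by
  apply hasDerivAt_plane
  · exact (hasDerivAt_id r).mul_const (Real.cos θ)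
  · exact (hasDerivAt_id r).mul_const (Real.sin θ)

lemma hasDerivAt_pol_right (r θ : ℝ) : HasDerivAt (fun θ => pol r θ) (r • angDir θ) θ := by
  apply hasDerivAt_plane
  · simpa using (Real.hasDerivAt_cos θ).const_mul r
  · simpa using (Real.hasDerivAt_sin θ).const_mul r

/-- The identification of `ℂ` with the plane, followed by the rotation by the angle `c`. -/
noncomputable def planeIso (c : ℝ) : ℂ ≃ₗᵢ[ℝ] Plane :=
  (rotation (Circle.exp c)).trans Complex.orthonormalBasisOneI.repr

lemma planeIso_polar (c r θ : ℝ) :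
    planeIso c (r * (Real.cos θ + Real.sin θ * Complex.I)) = pol r (θ + c) := by
  have h : planeIso c (r * (Real.cos θ + Real.sin θ * Complex.I)) =
      Complex.orthonormalBasisOneI.repr
        (Complex.exp (c * Complex.I) * (r * (Real.cos θ + Real.sin θ * Complex.I))) := by
    simp [planeIso, rotation_apply, Circle.coe_exp]
  rw [h, Complex.exp_mul_I]
  have e0 : ∀ z : ℂ, Complex.orthonormalBasisOneI.repr z 0 = z.re := by
    intro z; simp
  have e1 : ∀ z : ℂ, Complex.orthonormalBasisOneI.repr z 1 = z.im := by
    intro z; simp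
  rw [← Complex.ofReal_cos, ← Complex.ofReal_sin]
  apply plane_ext
  · rw [e0, pol_apply_zero, Real.cos_add]
    simp [-Complex.ofReal_cos, -Complex.ofReal_sin]; ring
  · rw [e1, pol_apply_one, Real.sin_add]
    simp [-Complex.ofReal_cos, -Complex.ofReal_sin]; ring

/-- The angular coordinate with values in `(c - π, c + π]`. -/
noncomputable def ang (c : ℝ) (x : Plane) : ℝ := Complex.arg ((planeIso c).symm x) + c

lemma planeIso_symm_pol (c r θ : ℝ) :
    (planeIso c).symm (pol r θ) =
      r * (Real.cos (θ - c) + Real.sin (θ - c) * Complex.I) := by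
  rw [LinearIsometryEquiv.symm_apply_eq, planeIso_polar, sub_add_cancel]

lemma ang_mem (c : ℝ) (x : Plane) : ang c x ∈ Ioc (c - Real.pi) (c + Real.pi) := by
  have := Complex.arg_mem_Ioc ((planeIso c).symm x)
  simp only [mem_Ioc, ang] at this ⊢
  constructor <;> linarith [this.1, this.2]

lemma ang_pol {c r θ : ℝ} (hr : 0 < r) (hθ : θ ∈ Ioc (c - Real.pi) (c + Real.pi)) :
    ang c (pol r θ) = θ := by
  rw [ang, planeIso_symm_pol]
  have := Complex.arg_mul_cos_add_sin_mul_I hr (θ := θ - c)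
    ⟨by linarith [hθ.1], by linarith [hθ.2]⟩
  push_cast at this ⊢
  rw [this]; ring

lemma pol_ang (c : ℝ) (x : Plane) : pol ‖x‖ (ang c x) = x := by
  rw [ang, ← planeIso_polar]
  have := Complex.norm_mul_cos_add_sin_mul_I ((planeIso c).symm x)
  rw [LinearIsometryEquiv.norm_map] at this
  push_cast at this ⊢
  rw [this, LinearIsometryEquiv.apply_symm_apply]

/-- Integration in polar coordinates over a disk, with an arbitrary branch of the angle. -/
lemma lintegral_ball_polar (c ℓ : ℝ) (f : Plane → ENNReal) :
    ∫⁻ x in Metric.ball 0 ℓ, f x =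
      ∫⁻ p in Ioo 0 ℓ ×ˢ Ioo (c - Real.pi) (c + Real.pi),
        ENNReal.ofReal p.1 * f (pol p.1 p.2) := by
  have hmp := (planeIso c).measurePreserving
  rw [← lintegral_indicator Metric.isOpen_ball.measurableSet,
    ← hmp.lintegral_comp_emb (planeIso c).toHomeomorph.measurableEmbedding,
    ← Complex.lintegral_comp_polarCoord_symm, polarCoord_target]
  -- Shifting the angle by `c` moves the standard branch `(-π, π)` to `(c - π, c + π)`. Only
  -- measurable embeddings are used, so `f` may be arbitrary.
  have hsh : MeasurePreserving (fun p : ℝ × ℝ => (p.1, p.2 - c)) :=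
    (MeasurePreserving.id volume).prod (measurePreserving_sub_right volume c)
  have hemb : MeasurableEmbedding (fun p : ℝ × ℝ => (p.1, p.2 - c)) :=
    ((Homeomorph.refl ℝ).prodCongr (Homeomorph.subRight c)).measurableEmbedding
  rw [← lintegral_indicator (measurableSet_Ioi.prod measurableSet_Ioo),
    ← lintegral_indicator (measurableSet_Ioo.prod measurableSet_Ioo),
    ← hsh.lintegral_comp_emb hemb]
  congr 1
  ext ⟨r, θ⟩
  by_cases h1 : 0 < r
  · by_cases h2 : θ ∈ Ioo (c - Real.pi) (c + Real.pi)
    · rw [indicator_of_mem (by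
        simp only [mem_prod, mem_Ioi, mem_Ioo] at h2 ⊢
        exact ⟨h1, by linarith [h2.1], by linarith [h2.2]⟩)]
      have e : planeIso c (Complex.polarCoord.symm (r, θ - c)) = pol r θ := by
        rw [Complex.polarCoord_symm_apply]
        simpa using planeIso_polar c r (θ - c)
      simp only [e]
      by_cases h3 : r < ℓ
      · rw [indicator_of_mem (by simpa [abs_of_pos h1] using h3),
          indicator_of_mem (by exact ⟨⟨h1, h3⟩, h2⟩), smul_eq_mul]
      · rw [indicator_of_notMem (by simpa [abs_of_pos h1] using h3),
          indicator_of_notMem (by intro h; exact h3 h.1.2), smul_zero]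
    · rw [indicator_of_notMem, indicator_of_notMem]
      · exact fun h => h2 h.2
      · intro h
        apply h2
        simp only [mem_prod, mem_Ioi, mem_Ioo] at h ⊢
        exact ⟨by linarith [h.2.1], by linarith [h.2.2]⟩
  · rw [indicator_of_notMem, indicator_of_notMem]
    · exact fun h => h1 h.1.1
    · exact fun h => h1 h.1

end TripleJunction

/-! ### The equilateral triangle and its area. -/

namespace TripleJunction

/-- Three plane vectors have a singular Gram matrix. With unit diagonal and a common off-diagonal
entry `t` its determinant is `(1 - t)² (1 + 2t)`. Distinctness gives `t < 1`, hence `t = -1/2`, and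
the squared norm of the sum is `3 + 6t = 0`. -/
lemma sum_eq_zero_of_equilateral_coords {a b c d e f : ℝ} (n1 : a ^ 2 + b ^ 2 = 1)
    (n2 : c ^ 2 + d ^ 2 = 1) (n3 : e ^ 2 + f ^ 2 = 1)
    (d1 : (a - c) ^ 2 + (b - d) ^ 2 = (c - e) ^ 2 + (d - f) ^ 2)
    (d2 : (c - e) ^ 2 + (d - f) ^ 2 = (e - a) ^ 2 + (f - b) ^ 2)
    (hpos : 0 < (a - c) ^ 2 + (b - d) ^ 2) : a + c + e = 0 ∧ b + d + f = 0 := by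
  obtain ⟨t, ht⟩ : ∃ t, t = a * c + b * d := ⟨_, rfl⟩
  have e1 : c * e + d * f = t := by linarith
  have e2 : e * a + f * b = t := by linarith
  have ht1 : t < 1 := by linarith
  have gram : (1 - t) ^ 2 * (1 + 2 * t) = 0 := by
    have : (a ^ 2 + b ^ 2) * (c ^ 2 + d ^ 2) * (e ^ 2 + f ^ 2)
        + 2 * (a * c + b * d) * (c * e + d * f) * (e * a + f * b)
        - (a ^ 2 + b ^ 2) * (c * e + d * f) ^ 2 - (c ^ 2 + d ^ 2) * (e * a + f * b) ^ 2
        - (e ^ 2 + f ^ 2) * (a * c + b * d) ^ 2 = 0 := by ring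
    rw [n1, n2, n3, e1, e2, ← ht] at this
    linarith
  have ht2 : 1 + 2 * t = 0 := by
    rcases mul_eq_zero.1 gram with h | h
    · have := pow_eq_zero_iff (two_ne_zero) |>.1 h
      linarith
    · exact h
  have hs : (a + c + e) ^ 2 + (b + d + f) ^ 2 = 0 := by linarith
  constructor
  · apply pow_eq_zero_iff (two_ne_zero) |>.1
    linarith [sq_nonneg (a + c + e), sq_nonneg (b + d + f)]
  · apply pow_eq_zero_iff (two_ne_zero) |>.1
    linarith [sq_nonneg (a + c + e), sq_nonneg (b + d + f)]

lemma IsInscribedEquilateral.sum_eq_zero {α β γ : Plane} (h : IsInscribedEquilateral α β γ) :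
    α + β + γ = 0 := by
  obtain ⟨h1, h2, h3, hne, h4, h5⟩ := h
  have n1 : α 0 ^ 2 + α 1 ^ 2 = 1 := by rw [← norm_sq_eq, h1]; norm_num
  have n2 : β 0 ^ 2 + β 1 ^ 2 = 1 := by rw [← norm_sq_eq, h2]; norm_num
  have n3 : γ 0 ^ 2 + γ 1 ^ 2 = 1 := by rw [← norm_sq_eq, h3]; norm_num
  have hd : ∀ x y : Plane, dist x y ^ 2 = (x 0 - y 0) ^ 2 + (x 1 - y 1) ^ 2 := by
    intro x y; rw [dist_eq_norm, norm_sq_eq]; rfl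
  have d1 : dist α β ^ 2 = dist β γ ^ 2 := by rw [h4]
  have d2 : dist β γ ^ 2 = dist γ α ^ 2 := by rw [h5]
  have hpos : 0 < dist α β ^ 2 := by
    have := dist_pos.2 hne
    positivity
  rw [hd] at d1 d2 hpos
  rw [hd] at d1 d2
  obtain ⟨s0, s1⟩ := sum_eq_zero_of_equilateral_coords n1 n2 n3 d1 d2 hpos
  exact plane_ext (by simpa using s0) (by simpa using s1)

lemma cross_eq_of_sum_eq_zero {α β γ : Plane} (h : α + β + γ = 0) :
    cross β γ = cross α β := by
  have : γ = -α - β := by rw [eq_comm, sub_eq_iff_eq_add, neg_eq_iff_add_eq_zero, ← h]; abel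
  rw [this]; simp [cross]; ring

lemma isometry_pol (θ : ℝ) : Isometry fun r => pol r θ := by
  apply Isometry.of_dist_eq
  intro r s
  have : pol r θ - pol s θ = pol (r - s) θ := by apply plane_ext <;> simp <;> ring
  rw [dist_eq_norm, this, norm_pol, Real.dist_eq]

lemma volume_unit_triangle :
    volume {x : Plane | 0 ≤ x 0 ∧ 0 ≤ x 1 ∧ x 0 + x 1 ≤ 1} = ENNReal.ofReal (1 / 2) := by
  have hS : MeasurableSet {p : ℝ × ℝ | 0 ≤ p.1 ∧ 0 ≤ p.2 ∧ p.1 + p.2 ≤ 1} := by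
    apply IsClosed.measurableSet
    exact (isClosed_le continuous_const continuous_fst).inter
      ((isClosed_le continuous_const continuous_snd).inter
        (isClosed_le (continuous_fst.add continuous_snd) continuous_const))
  have hmp : MeasurePreserving (fun x : Plane => (x 0, x 1)) :=
    (volume_preserving_finTwoArrow ℝ).comp (PiLp.volume_preserving_ofLp (Fin 2))
  have : {x : Plane | 0 ≤ x 0 ∧ 0 ≤ x 1 ∧ x 0 + x 1 ≤ 1} =
      (fun x : Plane => (x 0, x 1)) ⁻¹' {p : ℝ × ℝ | 0 ≤ p.1 ∧ 0 ≤ p.2 ∧ p.1 + p.2 ≤ 1} := rfl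
  rw [this, hmp.measure_preimage hS.nullMeasurableSet, Measure.volume_eq_prod,
    Measure.prod_apply hS]
  have hsl : ∀ x : ℝ, volume (Prod.mk x ⁻¹' {p : ℝ × ℝ | 0 ≤ p.1 ∧ 0 ≤ p.2 ∧ p.1 + p.2 ≤ 1}) =
      (Icc (0 : ℝ) 1).indicator (fun x => ENNReal.ofReal (1 - x)) x := by
    intro x
    by_cases hx : x ∈ Icc (0 : ℝ) 1
    · rw [indicator_of_mem hx]
      have : Prod.mk x ⁻¹' {p : ℝ × ℝ | 0 ≤ p.1 ∧ 0 ≤ p.2 ∧ p.1 + p.2 ≤ 1} = Icc 0 (1 - x) := by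
        ext y
        simp only [mem_preimage, mem_ofPred_eq, mem_Icc]
        constructor
        · rintro ⟨_, h2, h3⟩; exact ⟨h2, by linarith⟩
        · rintro ⟨h2, h3⟩; exact ⟨hx.1, h2, by linarith⟩
      rw [this, Real.volume_Icc, sub_zero]
    · rw [indicator_of_notMem hx]
      have : Prod.mk x ⁻¹' {p : ℝ × ℝ | 0 ≤ p.1 ∧ 0 ≤ p.2 ∧ p.1 + p.2 ≤ 1} = ∅ := by
        ext y
        simp only [mem_preimage, mem_ofPred_eq, mem_empty_iff_false, iff_false]
        rintro ⟨h1, h2, h3⟩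
        exact hx ⟨h1, by linarith⟩
      rw [this, measure_empty]
  simp_rw [hsl]
  rw [lintegral_indicator measurableSet_Icc, ← ofReal_integral_eq_lintegral_ofReal]
  · rw [integral_Icc_eq_integral_Ioc, ← intervalIntegral.integral_of_le zero_le_one]
    congr 1
    rw [intervalIntegral.integral_sub (by simp) (by simp)]
    norm_num
  · exact (Continuous.integrableOn_Icc (by fun_prop))
  · filter_upwards [ae_restrict_mem measurableSet_Icc] with x hx
    simp only [Pi.zero_apply]; linarith [hx.2]

/-- The linear map sending the standard basis to `b, c`. -/
noncomputable def twoColumns (b c : Plane) : Plane →ₗ[ℝ] Plane where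
  toFun x := x 0 • b + x 1 • c
  map_add' x y := by simp [add_smul]; abel
  map_smul' t x := by simp [smul_smul]

lemma twoColumns_apply (b c x : Plane) : twoColumns b c x = x 0 • b + x 1 • c := rfl

lemma det_twoColumns (b c : Plane) : LinearMap.det (twoColumns b c) = cross b c := by
  rw [← LinearMap.det_toMatrix (EuclideanSpace.basisFun (Fin 2) ℝ).toBasis, Matrix.det_fin_two]
  simp [LinearMap.toMatrix_apply, twoColumns_apply, cross]
  ring

/-- An affine map with linear part `twoColumns (b - a) (c - a)` carries the unit triangle onto this
one, and the cross product is its determinant. -/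
lemma volume_triangle (a b c : Plane) :
    volume (convexHull ℝ {a, b, c}) = ENNReal.ofReal (|cross (b - a) (c - a)| / 2) := by
  set S := {x : Plane | 0 ≤ x 0 ∧ 0 ≤ x 1 ∧ x 0 + x 1 ≤ 1} with hS
  have hconv : Convex ℝ S := by
    intro x hx y hy s t hs ht hst
    simp only [hS, mem_ofPred_eq, PiLp.add_apply, PiLp.smul_apply, smul_eq_mul] at hx hy ⊢
    refine ⟨?_, ?_, ?_⟩
    · nlinarith [mul_nonneg hs hx.1, mul_nonneg ht hy.1]
    · nlinarith [mul_nonneg hs hx.2.1, mul_nonneg ht hy.2.1]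
    · nlinarith [mul_nonneg hs (sub_nonneg.2 hx.2.2), mul_nonneg ht (sub_nonneg.2 hy.2.2)]
  have himg : convexHull ℝ {a, b, c} = (fun z => a + z) '' (twoColumns (b - a) (c - a) '' S) := by
    apply Subset.antisymm
    · apply convexHull_min _ ((hconv.linear_image _).translate a)
      rintro x (rfl | rfl | rfl)
      · exact ⟨0, ⟨0, by simp [hS], by simp⟩, by simp⟩
      · exact ⟨x - a, ⟨EuclideanSpace.single 0 1, by simp [hS], by simp [twoColumns_apply]⟩, by simp⟩
      · exact ⟨x - a, ⟨EuclideanSpace.single 1 1, by simp [hS], by simp [twoColumns_apply]⟩, by simp⟩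
    · rintro _ ⟨_, ⟨x, hx, rfl⟩, rfl⟩
      have e : a + twoColumns (b - a) (c - a) x = (1 - x 0 - x 1) • a + x 0 • b + x 1 • c := by
        apply plane_ext <;> simp [twoColumns_apply] <;> ring
      simp only [e]
      have hC := convex_convexHull ℝ ({a, b, c} : Set Plane)
      have m : ∀ y ∈ ({a, b, c} : Set Plane), y ∈ convexHull ℝ ({a, b, c} : Set Plane) :=
        fun y hy => subset_convexHull ℝ _ hy
      have := hC.sum_mem (t := Finset.univ) (w := ![1 - x 0 - x 1, x 0, x 1]) (z := ![a, b, c])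
        (by intro i _; fin_cases i <;> simp <;> linarith [hx.1, hx.2.1, hx.2.2])
        (by simp [Fin.sum_univ_three]; ring) (by intro i _; fin_cases i <;> simp <;> apply m <;> simp)
      simpa [Fin.sum_univ_three] using this
  rw [himg, image_add_left, measure_preimage_add, Measure.addHaar_image_linearMap,
    det_twoColumns, volume_unit_triangle, ← ENNReal.ofReal_mul (abs_nonneg _)]
  congr 1; ring

/-- The origin is the barycentre, so the triangle splits into three pieces of area `|cross α β| /
2`. -/
lemma volume_triangle_of_sum_eq_zero {α β γ : Plane} (h : α + β + γ = 0) :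
    volume (convexHull ℝ {α, β, γ}) = ENNReal.ofReal (3 / 2 * |cross α β|) := by
  have h1 := cross_eq_of_sum_eq_zero h
  have h2 : cross γ α = cross β γ := cross_eq_of_sum_eq_zero (by rw [← h]; abel)
  rw [volume_triangle]
  have : cross (β - α) (γ - α) = 3 * cross α β := by
    rw [cross_sub_left, cross_sub_right, cross_sub_right, cross_self, cross_swap β α,
      cross_swap α γ, h2, h1]
    ring
  rw [this, abs_mul]
  congr 1
  norm_num; ring

end TripleJunction

/-! ### The jump set of a triple junction map. -/

namespace TripleJunction

lemma pol_mem_sector {ℓ a b r θ : ℝ} (hr : r ∈ Ioo 0 ℓ) (hθ : θ ∈ Ioo a b) :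
    pol r θ ∈ sector ℓ a b := ⟨r, hr, θ, hθ, rfl⟩

lemma sector_mono {ℓ a b a' b' : ℝ} (ha : a' ≤ a) (hb : b ≤ b') :
    sector ℓ a b ⊆ sector ℓ a' b' := by
  rintro _ ⟨r, hr, θ, hθ, rfl⟩
  exact ⟨r, hr, θ, ⟨ha.trans_lt hθ.1, hθ.2.trans_le hb⟩, rfl⟩

lemma sector_add_two_pi (ℓ a b : ℝ) :
    sector ℓ (a + 2 * Real.pi) (b + 2 * Real.pi) = sector ℓ a b := by
  ext x
  constructor
  · rintro ⟨r, hr, θ, hθ, rfl⟩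
    refine ⟨r, hr, θ - 2 * Real.pi, ⟨by linarith [hθ.1], by linarith [hθ.2]⟩, ?_⟩
    have := pol_add_two_pi r (θ - 2 * Real.pi)
    rw [sub_add_cancel] at this
    exact this
  · rintro ⟨r, hr, θ, hθ, rfl⟩
    exact ⟨r, hr, θ + 2 * Real.pi, ⟨by linarith [hθ.1], by linarith [hθ.2]⟩,
      (pol_add_two_pi r θ).symm⟩

lemma inner_pol_angDir (s φ θ : ℝ) : inner ℝ (pol s φ) (angDir θ) = s * Real.sin (φ - θ) := by
  rw [inner_eq, Real.sin_sub]; simp; ring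

lemma inner_pol_pol (s φ θ : ℝ) : inner ℝ (pol s φ) (pol 1 θ) = s * Real.cos (φ - θ) := by
  rw [inner_eq, Real.cos_sub]; simp; ring

lemma halfDisk_subset_ball (x ν : Plane) (ρ : ℝ) : halfDisk x ν ρ ⊆ Metric.ball x ρ :=
  fun _ hy => hy.1

lemma isOpen_halfDisk (x ν : Plane) (ρ : ℝ) : IsOpen (halfDisk x ν ρ) :=
  have h : IsOpen {y : Plane | 0 < inner ℝ (y - x) ν} := isOpen_lt continuous_const
    ((continuous_id.sub continuous_const).inner continuous_const)
  Metric.isOpen_ball.inter h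

lemma halfDisk_nonempty {x ν : Plane} {ρ : ℝ} (hρ : 0 < ρ) (hν : ‖ν‖ = 1) :
    (halfDisk x ν ρ).Nonempty := by
  refine ⟨x + (ρ / 2) • ν, ?_, ?_⟩
  · simp [norm_smul, hν, abs_of_pos hρ]; linarith
  · simp only [add_sub_cancel_left, inner_smul_left, real_inner_self_eq_norm_sq, hν]
    simp; exact hρ

lemma volume_halfDisk_ne_zero {x ν : Plane} {ρ : ℝ} (hρ : 0 < ρ) (hν : ‖ν‖ = 1) :
    volume (halfDisk x ν ρ) ≠ 0 :=
  ((isOpen_halfDisk x ν ρ).measure_pos _ (halfDisk_nonempty hρ hν)).ne'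

lemma volume_halfDisk_ne_top (x ν : Plane) (ρ : ℝ) : volume (halfDisk x ν ρ) ≠ ⊤ :=
  measure_ne_top_of_subset (halfDisk_subset_ball x ν ρ) measure_ball_lt_top.ne

lemma laverage_halfDisk_of_eqOn {u : Plane → Plane} {x ν p q : Plane} {ρ : ℝ} (hρ : 0 < ρ)
    (hν : ‖ν‖ = 1) (hu : ∀ y ∈ halfDisk x ν ρ, u y = p) :
    laverage (volume.restrict (halfDisk x ν ρ)) (fun y => ‖u y - q‖ₑ) = ‖p - q‖ₑ := by
  rw [setLAverage_congr_fun (g := fun _ => ‖p - q‖ₑ) (isOpen_halfDisk x ν ρ).measurableSet]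
  · exact setLAverage_const (volume_halfDisk_ne_zero hρ hν) (volume_halfDisk_ne_top x ν ρ) _
  · intro y hy
    simp only [hu y hy]

/-- For `ρ ≤ r` every point of the disk has positive inner product with `pol 1 θ`, so its angle
differs from `θ` by less than `π / 2`; the sign of the product with `angDir θ` then decides the
side. -/
lemma halfDisk_subset_sector {ℓ r θ ρ : ℝ} (h0 : 0 < r) (h1 : ρ ≤ r) (h2 : ρ ≤ ℓ - r) :
    halfDisk (pol r θ) (angDir θ) ρ ⊆ sector ℓ θ (θ + Real.pi / 2) ∧
    halfDisk (pol r θ) (-angDir θ) ρ ⊆ sector ℓ (θ - Real.pi / 2) θ := by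
  have key : ∀ y ∈ Metric.ball (pol r θ) ρ, ‖y‖ ∈ Ioo 0 ℓ ∧
      0 < Real.cos (ang θ y - θ) := by
    intro y hy
    rw [Metric.mem_ball, dist_eq_norm] at hy
    have hin : 0 < inner ℝ y (pol 1 θ) := by
      have e : inner ℝ y (pol 1 θ) = r + inner ℝ (y - pol r θ) (pol 1 θ) := by
        rw [inner_sub_left, inner_pol_pol]; simp
      have := abs_real_inner_le_norm (y - pol r θ) (pol 1 θ)
      rw [norm_pol, abs_one, mul_one] at this
      rw [e]
      linarith [(abs_le.1 this).1]
    have hy0 : 0 < ‖y‖ := by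
      rw [norm_pos_iff]; rintro rfl; simp at hin
    refine ⟨⟨hy0, ?_⟩, ?_⟩
    · have := norm_sub_norm_le y (pol r θ)
      rw [norm_pol, abs_of_pos h0] at this
      linarith
    · rw [← pol_ang θ y, inner_pol_pol] at hin
      exact pos_of_mul_pos_right hin hy0.le
  have hin0 : inner ℝ (pol r θ) (angDir θ) = (0 : ℝ) := by rw [inner_pol_angDir]; simp
  constructor
  · rintro y ⟨hy, hin⟩
    obtain ⟨hn, hc⟩ := key y hy
    rw [inner_sub_left, hin0, sub_zero] at hin
    rw [← pol_ang θ y, inner_pol_angDir] at hin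
    have hs := pos_of_mul_pos_right hin hn.1.le
    have hm := ang_mem θ y
    rw [← pol_ang θ y]
    apply pol_mem_sector hn
    constructor
    · by_contra hcon
      have := Real.sin_nonpos_of_nonpos_of_neg_pi_le (x := ang θ y - θ) (by linarith)
        (by linarith [hm.1])
      linarith
    · by_contra hcon
      have := Real.cos_nonpos_of_pi_div_two_le_of_le (x := ang θ y - θ) (by linarith)
        (by linarith [hm.2, Real.pi_pos])
      linarith
  · rintro y ⟨hy, hin⟩
    obtain ⟨hn, hc⟩ := key y hy
    rw [inner_neg_right, inner_sub_left, hin0, sub_zero] at hin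
    rw [← pol_ang θ y, inner_pol_angDir] at hin
    have hs : Real.sin (ang θ y - θ) < 0 := by
      by_contra hcon
      nlinarith [hn.1]
    have hm := ang_mem θ y
    rw [← pol_ang θ y]
    apply pol_mem_sector hn
    constructor
    · by_contra hcon
      have := Real.cos_nonpos_of_pi_div_two_le_of_le (x := -(ang θ y - θ)) (by linarith)
        (by linarith [hm.1, Real.pi_pos])
      rw [Real.cos_neg] at this
      linarith
    · by_contra hcon
      have := Real.sin_nonneg_of_nonneg_of_le_pi (x := ang θ y - θ) (by linarith)
        (by linarith [hm.2])
      linarith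

lemma pol_mem_jumpSet {u : Plane → Plane} {ℓ r θ : ℝ} {p q : Plane} (hr : r ∈ Ioo 0 ℓ)
    (hpq : p ≠ q) (hp : ∀ x ∈ sector ℓ θ (θ + Real.pi / 2), u x = p)
    (hq : ∀ x ∈ sector ℓ (θ - Real.pi / 2) θ, u x = q) :
    pol r θ ∈ jumpSet u (Metric.ball 0 ℓ) := by
  refine ⟨by simpa [abs_of_pos hr.1] using hr.2, p, q, angDir θ, hpq, norm_angDir θ, ?_, ?_⟩
  all_goals
    apply tendsto_const_nhds.congr'
    have hpos : 0 < min r (ℓ - r) := lt_min hr.1 (sub_pos.2 hr.2)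
    filter_upwards [Ioc_mem_nhdsGT hpos] with ρ hρ
    have hs := halfDisk_subset_sector (θ := θ) hr.1 (hρ.2.trans (min_le_left _ _))
      (hρ.2.trans (min_le_right _ _))
  · rw [laverage_halfDisk_of_eqOn hρ.1 (norm_angDir θ) fun y hy => hp y (hs.1 hy)]
    simp
  · rw [laverage_halfDisk_of_eqOn hρ.1 (by simp) fun y hy => hq y (hs.2 hy)]
    simp

lemma notMem_jumpSet_of_eventually_eq {u : Plane → Plane} {Ω : Set Plane} {x p : Plane}
    (h : ∀ᶠ y in 𝓝 x, u y = p) : x ∉ jumpSet u Ω := by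
  rintro ⟨_, a, b, ν, hab, hν, ha, hb⟩
  obtain ⟨ρ₀, hρ₀, hball⟩ := Metric.eventually_nhds_iff_ball.1 h
  have key : ∀ a' ν' : Plane, ‖ν'‖ = 1 → Tendsto (fun ρ : ℝ =>
      laverage (volume.restrict (halfDisk x ν' ρ)) fun y => ‖u y - a'‖ₑ) (𝓝[>] 0) (𝓝 0) →
      p = a' := by
    intro a' ν' hν' ht
    have hc : Tendsto (fun _ : ℝ => ‖p - a'‖ₑ) (𝓝[>] (0 : ℝ)) (𝓝 0) := by
      apply ht.congr'
      filter_upwards [Ioc_mem_nhdsGT hρ₀] with ρ hρ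
      exact laverage_halfDisk_of_eqOn hρ.1 hν' fun y hy =>
        hball y (Metric.ball_subset_ball hρ.2 hy.1)
    have := tendsto_nhds_unique hc tendsto_const_nhds
    rwa [eq_comm, enorm_eq_zero, sub_eq_zero] at this
  exact hab ((key a ν hν ha).symm.trans (key b (-ν) (by simpa using hν) hb))

/-- With the branch of the angle centred at `φ` itself, the point corresponds to a positive real
number, away from the cut, and `ang φ` is continuous there. -/
lemma eventually_mem_sector {ℓ a b r φ : ℝ} (hr : r ∈ Ioo 0 ℓ) (hφ : φ ∈ Ioo a b) :
    ∀ᶠ y in 𝓝 (pol r φ), y ∈ sector ℓ a b := by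
  have hcont : ContinuousAt (ang φ) (pol r φ) := by
    have : ContinuousAt Complex.arg ((planeIso φ).symm (pol r φ)) := by
      apply Complex.continuousAt_arg
      rw [planeIso_symm_pol]
      left
      simpa using hr.1
    exact (ContinuousAt.comp this (planeIso φ).symm.continuous.continuousAt).add
      continuousAt_const
  have hval : ang φ (pol r φ) = φ := ang_pol hr.1 ⟨by linarith [Real.pi_pos],
    by linarith [Real.pi_pos]⟩
  have h1 : ∀ᶠ y in 𝓝 (pol r φ), ang φ y ∈ Ioo a b := by
    apply hcont.eventually
    rw [hval]
    exact Ioo_mem_nhds hφ.1 hφ.2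
  have h2 : ∀ᶠ y in 𝓝 (pol r φ), ‖y‖ ∈ Ioo 0 ℓ := by
    apply continuous_norm.continuousAt.eventually
    show Ioo 0 ℓ ∈ 𝓝 ‖pol r φ‖
    rw [norm_pol, abs_of_pos hr.1]
    exact Ioo_mem_nhds hr.1 hr.2
  filter_upwards [h1, h2] with y hy1 hy2
  rw [← pol_ang φ y]
  exact pol_mem_sector hy2 hy1

/-- The values of a triple junction map on the circle of directions, on the branch
`(θ₀ - π/3, θ₀ + 5π/3)` of the angle. -/
noncomputable def stepMap (θ₀ : ℝ) (α β γ : Plane) (θ : ℝ) : Plane :=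
  if θ < θ₀ then γ else if θ < θ₀ + 2 * Real.pi / 3 then α
    else if θ < θ₀ + 4 * Real.pi / 3 then β else γ

/-- The map `u` takes the values `α, β, γ` on the three sectors starting at the angle `θ₀`. -/
def IsJunctionAt (u : Plane → Plane) (ℓ θ₀ : ℝ) (α β γ : Plane) : Prop :=
  (∀ x ∈ sector ℓ θ₀ (θ₀ + 2 * Real.pi / 3), u x = α) ∧
  (∀ x ∈ sector ℓ (θ₀ + 2 * Real.pi / 3) (θ₀ + 4 * Real.pi / 3), u x = β) ∧
  (∀ x ∈ sector ℓ (θ₀ + 4 * Real.pi / 3) (θ₀ + 2 * Real.pi), u x = γ)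

/-- The three interface angles. -/
noncomputable def interfaceAngles (θ₀ : ℝ) : Finset ℝ :=
  {θ₀, θ₀ + 2 * Real.pi / 3, θ₀ + 4 * Real.pi / 3}

variable {u : Plane → Plane} {ℓ θ₀ : ℝ} {α β γ : Plane}

/-- The branch of the angle used throughout starts at `θ₀ - π/3`, so the sector of `γ` is met a
second time, just below `θ₀`. -/
lemma IsJunctionAt.eq_on_left (h : IsJunctionAt u ℓ θ₀ α β γ) :
    ∀ x ∈ sector ℓ (θ₀ - 2 * Real.pi / 3) θ₀, u x = γ := by
  intro x hx
  apply h.2.2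
  rw [← sector_add_two_pi] at hx
  exact sector_mono (by linarith [Real.pi_pos]) le_rfl hx

lemma IsJunctionAt.eventually_eq (h : IsJunctionAt u ℓ θ₀ α β γ) {r θ : ℝ} (hr : r ∈ Ioo 0 ℓ)
    (hθ : θ ∈ Ioc (θ₀ + 2 * Real.pi / 3 - Real.pi) (θ₀ + 2 * Real.pi / 3 + Real.pi))
    (hn : θ ∉ interfaceAngles θ₀) :
    ∀ᶠ y in 𝓝 (pol r θ), u y = stepMap θ₀ α β γ θ := by
  have hpi := Real.pi_pos
  simp only [interfaceAngles, Finset.mem_insert, Finset.mem_singleton, not_or] at hn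
  obtain ⟨n1, n2, n3⟩ := hn
  unfold stepMap
  split_ifs with h1 h2 h3
  · filter_upwards [eventually_mem_sector hr (a := θ₀ - 2 * Real.pi / 3) (b := θ₀)
      ⟨by linarith [hθ.1], h1⟩] with y hy using h.eq_on_left y hy
  · filter_upwards [eventually_mem_sector hr
      ⟨lt_of_le_of_ne (not_lt.1 h1) (Ne.symm n1), h2⟩] with y hy using h.1 y hy
  · filter_upwards [eventually_mem_sector hr
      ⟨lt_of_le_of_ne (not_lt.1 h2) (Ne.symm n2), h3⟩] with y hy using h.2.1 y hy
  · filter_upwards [eventually_mem_sector hr (b := θ₀ + 2 * Real.pi)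
      ⟨lt_of_le_of_ne (not_lt.1 h3) (Ne.symm n3), by linarith [hθ.2]⟩] with y hy using h.2.2 y hy

lemma IsJunctionAt.eq_stepMap (h : IsJunctionAt u ℓ θ₀ α β γ) {r θ : ℝ} (hr : r ∈ Ioo 0 ℓ)
    (hθ : θ ∈ Ioc (θ₀ + 2 * Real.pi / 3 - Real.pi) (θ₀ + 2 * Real.pi / 3 + Real.pi))
    (hn : θ ∉ interfaceAngles θ₀) : u (pol r θ) = stepMap θ₀ α β γ θ :=
  (h.eventually_eq hr hθ hn).self_of_nhds

/-- The union of the three open interfaces. -/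
noncomputable def interfaces (ℓ θ₀ : ℝ) : Set Plane :=
  ⋃ θ ∈ interfaceAngles θ₀, (fun r => pol r θ) '' Ioo 0 ℓ

lemma mem_Ioc_of_mem_interfaceAngles {θ : ℝ} (hθ : θ ∈ interfaceAngles θ₀) :
    θ ∈ Ioc (θ₀ + 2 * Real.pi / 3 - Real.pi) (θ₀ + 2 * Real.pi / 3 + Real.pi) := by
  have hpi := Real.pi_pos
  simp only [interfaceAngles, Finset.mem_insert, Finset.mem_singleton] at hθ
  rcases hθ with rfl | rfl | rfl <;> constructor <;> linarith

lemma IsJunctionAt.eventually_eq_of_notMem (h : IsJunctionAt u ℓ θ₀ α β γ) {x : Plane}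
    (hx : x ∈ Metric.ball 0 ℓ) (h0 : x ≠ 0) (hn : x ∉ interfaces ℓ θ₀) :
    ∀ᶠ y in 𝓝 x, u y = stepMap θ₀ α β γ (ang (θ₀ + 2 * Real.pi / 3) x) := by
  have hr : ‖x‖ ∈ Ioo 0 ℓ := ⟨norm_pos_iff.2 h0, by simpa using hx⟩
  have := h.eventually_eq hr (ang_mem (θ₀ + 2 * Real.pi / 3) x) (by
    intro hcon
    apply hn
    simp only [interfaces, mem_iUnion]
    exact ⟨_, hcon, ‖x‖, hr, pol_ang _ x⟩)
  rwa [pol_ang] at this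

/-- Whether the origin is a jump point can be left open, since a point has no one-dimensional
measure. -/
lemma IsJunctionAt.jumpSet_subset (h : IsJunctionAt u ℓ θ₀ α β γ) :
    jumpSet u (Metric.ball 0 ℓ) ⊆ insert 0 (interfaces ℓ θ₀) := by
  intro x hx
  by_contra hcon
  simp only [mem_insert_iff, not_or] at hcon
  exact notMem_jumpSet_of_eventually_eq (h.eventually_eq_of_notMem hx.1 hcon.1 hcon.2) hx

lemma IsJunctionAt.interfaces_subset (h : IsJunctionAt u ℓ θ₀ α β γ) (hαβ : α ≠ β)
    (hβγ : β ≠ γ) (hγα : γ ≠ α) : interfaces ℓ θ₀ ⊆ jumpSet u (Metric.ball 0 ℓ) := by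
  have hpi := Real.pi_pos
  intro x hx
  simp only [interfaces, mem_iUnion] at hx
  obtain ⟨θ, hθ, r, hr, rfl⟩ := hx
  simp only [interfaceAngles, Finset.mem_insert, Finset.mem_singleton] at hθ
  rcases hθ with rfl | rfl | rfl
  · exact pol_mem_jumpSet hr hγα.symm
      (fun x hx => h.1 x (sector_mono le_rfl (by linarith) hx))
      (fun x hx => h.eq_on_left x (sector_mono (by linarith) le_rfl hx))
  · exact pol_mem_jumpSet hr hαβ.symm
      (fun x hx => h.2.1 x (sector_mono le_rfl (by linarith) hx))
      (fun x hx => h.1 x (sector_mono (by linarith) le_rfl hx))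
  · exact pol_mem_jumpSet hr hβγ.symm
      (fun x hx => h.2.2 x (sector_mono le_rfl (by linarith) hx))
      (fun x hx => h.2.1 x (sector_mono (by linarith) le_rfl hx))

lemma card_interfaceAngles (θ₀ : ℝ) : (interfaceAngles θ₀).card = 3 := by
  have hpi := Real.pi_pos
  rw [interfaceAngles, Finset.card_eq_three]
  exact ⟨_, _, _, by intro h; linarith, by intro h; linarith, by intro h; linarith, rfl⟩

lemma hausdorffMeasure_interfaces (ℓ θ₀ : ℝ) :
    Measure.hausdorffMeasure 1 (interfaces ℓ θ₀) = ENNReal.ofReal (3 * ℓ) := by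
  rw [interfaces, measure_biUnion_finset]
  · have : ∀ θ ∈ interfaceAngles θ₀,
        Measure.hausdorffMeasure 1 ((fun r => pol r θ) '' Ioo 0 ℓ) = ENNReal.ofReal ℓ := by
      intro θ _
      rw [(isometry_pol θ).hausdorffMeasure_image (Or.inl zero_le_one), hausdorffMeasure_real,
        Real.volume_Ioo, sub_zero]
    rw [Finset.sum_congr rfl this, Finset.sum_const, card_interfaceAngles, ENNReal.ofReal_mul
      (by norm_num), nsmul_eq_mul]
    simp
  · intro θ hθ φ hφ hne
    rw [Function.onFun, Set.disjoint_left]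
    rintro _ ⟨r, hr, rfl⟩ ⟨s, hs, hsr⟩
    apply hne
    rw [← ang_pol hr.1 (mem_Ioc_of_mem_interfaceAngles hθ),
      ← ang_pol hs.1 (mem_Ioc_of_mem_interfaceAngles hφ)]
    simp only at hsr
    rw [hsr]
  · intro θ _
    exact (isometry_pol θ).isClosedEmbedding.measurableEmbedding.measurableSet_image.2
      measurableSet_Ioo

lemma IsJunctionAt.hausdorffMeasure_jumpSet (h : IsJunctionAt u ℓ θ₀ α β γ)
    (hαβ : α ≠ β) (hβγ : β ≠ γ) (hγα : γ ≠ α) :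
    Measure.hausdorffMeasure 1 (jumpSet u (Metric.ball 0 ℓ)) = ENNReal.ofReal (3 * ℓ) := by
  rw [← hausdorffMeasure_interfaces ℓ θ₀]
  apply le_antisymm _ (measure_mono (h.interfaces_subset hαβ hβγ hγα))
  refine (measure_mono h.jumpSet_subset).trans ?_
  have : NullSingletonClass (Measure.hausdorffMeasure 1 : Measure Plane) :=
    Measure.nullSingletonClass_hausdorff Plane one_pos
  rw [insert_eq]
  refine (measure_union_le _ _).trans ?_
  rw [measure_singleton, zero_add]

lemma volume_interfaces (ℓ θ₀ : ℝ) : volume (insert 0 (interfaces ℓ θ₀)) = 0 := by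
  rw [insert_eq, measure_union_null_iff, interfaces]
  refine ⟨measure_singleton _, (measure_biUnion_null_iff
    (interfaceAngles θ₀).countable_toSet).2 ?_⟩
  intro θ _
  have hsub : (fun r => pol r θ) '' Ioo 0 ℓ ⊆ (Submodule.span ℝ {pol 1 θ} : Submodule ℝ Plane) := by
    rintro _ ⟨r, _, rfl⟩
    exact Submodule.mem_span_singleton.2 ⟨r, by apply plane_ext <;> simp⟩
  apply measure_mono_null hsub
  apply Measure.addHaar_submodule
  intro htop
  have h1 := finrank_span_singleton (K := ℝ) (v := pol 1 θ) (by
    rw [← norm_pos_iff, norm_pol]; simp)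
  rw [htop, finrank_top] at h1
  simp at h1

end TripleJunction

/-! ### Integration by parts: total variation is at most the gradient integral. -/

namespace TripleJunction

section IntegrationByParts

variable {Ω : Set Plane} {v : Plane → Plane} {φ : Fin 2 → Plane → Plane}

lemma continuousOn_fderiv_apply (hΩ : IsOpen Ω) (hv : ContDiffOn ℝ 1 v Ω) (w : Plane) :
    ContinuousOn (fun x => fderiv ℝ v x w) Ω :=
  (hv.continuousOn_fderiv_of_isOpen hΩ le_rfl).clm_apply continuousOn_const

lemma continuousOn_grad (hΩ : IsOpen Ω) (hv : ContDiffOn ℝ 1 v Ω) (i j : Fin 2) :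
    ContinuousOn (fun x => grad v x i j) Ω := by
  have := continuousOn_fderiv_apply hΩ hv (EuclideanSpace.single j 1)
  exact (EuclideanSpace.proj i : Plane →L[ℝ] ℝ).continuous.comp_continuousOn this

lemma continuousOn_gradNorm (hΩ : IsOpen Ω) (hv : ContDiffOn ℝ 1 v Ω) :
    ContinuousOn (gradNorm v) Ω := by
  unfold gradNorm
  exact (continuousOn_finsetSum _ fun i _ => continuousOn_finsetSum _ fun j _ =>
    (continuousOn_grad hΩ hv i j).pow 2).sqrt

/-- Although `f` is controlled only in `Ω`, the product is continuous on the whole plane, because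
`g` vanishes near every point outside its support. -/
lemma integrable_mul_of_tsupport_subset {f g : Plane → ℝ} (hΩ : IsOpen Ω) (hf : ContinuousOn f Ω)
    (hg : Continuous g) (hc : HasCompactSupport g) (hs : tsupport g ⊆ Ω) :
    Integrable (fun x => f x * g x) := by
  apply Continuous.integrable_of_hasCompactSupport _ hc.mul_left
  apply continuous_of_tsupport
  intro x hx
  have hx' : x ∈ Ω := hs (tsupport_mul_subset_right (f := f) hx)
  exact (hf.continuousAt (hΩ.mem_nhds hx')).mul hg.continuousAt

lemma setIntegral_mul_fderiv_eq_neg {f g : Plane → ℝ} (hΩ : IsOpen Ω) (hf : ContDiffOn ℝ 1 f Ω)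
    (hg : ContDiff ℝ 1 g) (hc : HasCompactSupport g) (hs : tsupport g ⊆ Ω) (w : Plane) :
    ∫ x in Ω, f x * fderiv ℝ g x w = -∫ x in Ω, fderiv ℝ f x w * g x := by
  have hsupp : ∀ x ∉ Ω, g x = 0 := fun x hx => image_eq_zero_of_notMem_tsupport fun h => hx (hs h)
  have hsupp' : ∀ x ∉ Ω, fderiv ℝ g x w = 0 := by
    intro x hx
    rw [fderiv_of_notMem_tsupport (𝕜 := ℝ) fun h => hx (hs h)]; rfl
  rw [setIntegral_eq_integral_of_forall_compl_eq_zero fun x hx => by rw [hsupp' x hx, mul_zero],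
    setIntegral_eq_integral_of_forall_compl_eq_zero fun x hx => by rw [hsupp x hx, mul_zero]]
  have hfd : ContinuousOn (fun x => fderiv ℝ f x w) Ω :=
    (hf.continuousOn_fderiv_of_isOpen hΩ le_rfl).clm_apply continuousOn_const
  have hgd : Continuous (fun x => fderiv ℝ g x w) :=
    (hg.continuous_fderiv one_ne_zero).clm_apply continuous_const
  apply integral_mul_fderiv_eq_neg_fderiv_mul_of_integrable
  · exact integrable_mul_of_tsupport_subset hΩ hfd hg.continuous hc hs
  · exact integrable_mul_of_tsupport_subset hΩ hf.continuousOn hgd (hc.fderiv_apply ℝ w)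
      ((tsupport_fderiv_apply_subset ℝ w).trans hs)
  · exact integrable_mul_of_tsupport_subset hΩ hf.continuousOn hg.continuous hc hs
  · intro x hx
    exact (hf.contDiffAt (hΩ.mem_nhds (hs hx))).differentiableAt one_ne_zero
  · intro x _
    exact hg.differentiable one_ne_zero x

lemma fderiv_coord {f : Plane → Plane} {x : Plane} (hf : DifferentiableAt ℝ f x) (i : Fin 2)
    (w : Plane) : fderiv ℝ (fun y => f y i) x w = fderiv ℝ f x w i := by
  have h := ((EuclideanSpace.proj i : Plane →L[ℝ] ℝ).hasFDerivAt (x := f x)).comp x hf.hasFDerivAt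
  have h2 := h.fderiv
  change fderiv ℝ (fun y => f y i) x = _ at h2
  rw [h2]; rfl

lemma contDiff_coord {f : Plane → Plane} (hf : ContDiff ℝ 1 f) (i : Fin 2) :
    ContDiff ℝ 1 fun y => f y i := contDiff_euclidean.1 hf i

lemma tsupport_coord_subset (f : Plane → Plane) (i : Fin 2) :
    tsupport (fun y => f y i) ⊆ tsupport f := by
  apply closure_mono
  intro x hx h0
  apply hx
  simp [h0]

lemma hasCompactSupport_coord {f : Plane → Plane} (hf : HasCompactSupport f) (i : Fin 2) :
    HasCompactSupport fun y => f y i :=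
  hf.of_isClosed_subset (isClosed_tsupport _) (tsupport_coord_subset f i)

lemma sum_setIntegral_mul_divergence (hΩ : IsOpen Ω) (hv : ContDiffOn ℝ 1 v Ω)
    (hφ : IsTestField Ω φ) :
    ∑ i, ∫ x in Ω, v x i * divergence (φ i) x =
      -∫ x in Ω, ∑ i, ∑ j, φ i x j * grad v x i j := by
  have hvi : ∀ i, ContDiffOn ℝ 1 (fun x => v x i) Ω := fun i => contDiffOn_euclidean.1 hv i
  have hphi : ∀ i j, ContDiff ℝ 1 (fun x => φ i x j) := fun i j => contDiff_coord (hφ.1 i).1 j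
  have hcs : ∀ i j, HasCompactSupport (fun x => φ i x j) := fun i j =>
    hasCompactSupport_coord (hφ.1 i).2.1 j
  have hts : ∀ i j, tsupport (fun x => φ i x j) ⊆ Ω := fun i j =>
    (tsupport_coord_subset _ j).trans (hφ.1 i).2.2
  have hterm : ∀ i j, ∫ x in Ω, v x i * fderiv ℝ (fun y => φ i y j) x (EuclideanSpace.single j 1) =
      -∫ x in Ω, φ i x j * grad v x i j := by
    intro i j
    rw [setIntegral_mul_fderiv_eq_neg hΩ (hvi i) (hphi i j) (hcs i j) (hts i j)]
    congr 1
    apply setIntegral_congr_fun hΩ.measurableSet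
    intro x hx
    simp only
    rw [fderiv_coord ((hv.contDiffAt (hΩ.mem_nhds hx)).differentiableAt one_ne_zero), mul_comm]
    rfl
  have hdiv : ∀ i x, divergence (φ i) x =
      ∑ j, fderiv ℝ (fun y => φ i y j) x (EuclideanSpace.single j 1) := by
    intro i x
    unfold divergence
    refine Finset.sum_congr rfl fun j _ => ?_
    rw [fderiv_coord ((hφ.1 i).1.differentiable one_ne_zero x)]
  have hint1 : ∀ i j, Integrable (fun x => v x i *
      fderiv ℝ (fun y => φ i y j) x (EuclideanSpace.single j 1)) (volume.restrict Ω) := by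
    intro i j
    apply Integrable.restrict
    exact integrable_mul_of_tsupport_subset hΩ (hvi i).continuousOn
      (((hphi i j).continuous_fderiv one_ne_zero).clm_apply continuous_const)
      ((hcs i j).fderiv_apply ℝ _) ((tsupport_fderiv_apply_subset ℝ _).trans (hts i j))
  have hint2 : ∀ i j, Integrable (fun x => φ i x j * grad v x i j) (volume.restrict Ω) := by
    intro i j
    simp_rw [mul_comm (φ i _ j)]
    apply Integrable.restrict
    exact integrable_mul_of_tsupport_subset hΩ (continuousOn_grad hΩ hv i j)
      (hphi i j).continuous (hcs i j) (hts i j)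
  simp_rw [hdiv, Finset.mul_sum]
  rw [integral_finsetSum _ fun i _ => integrable_finsetSum _ fun j _ => hint2 i j,
    ← Finset.sum_neg_distrib]
  refine Finset.sum_congr rfl fun i _ => ?_
  rw [integral_finsetSum _ fun j _ => hint1 i j, integral_finsetSum _ fun j _ => hint2 i j,
    ← Finset.sum_neg_distrib]
  exact Finset.sum_congr rfl fun j _ => hterm i j

lemma abs_sum_mul_grad_le (v : Plane → Plane) (x : Plane) {m : Fin 2 → Plane}
    (hm : ∑ i, ‖m i‖ ^ 2 ≤ 1) : |∑ i, ∑ j, m i j * grad v x i j| ≤ gradNorm v x := by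
  apply abs_le_of_sq_le_sq _ (gradNorm_nonneg v x)
  rw [gradNorm_sq]
  simp only [← Fintype.sum_prod_type']
  refine (Finset.sum_mul_sq_le_sq_mul_sq _ _ _).trans ?_
  refine mul_le_of_le_one_left (by positivity) ?_
  rw [Fintype.sum_prod_type]
  simpa [EuclideanSpace.norm_sq_eq] using hm

lemma totalVariation_le_lintegral_gradNorm (hΩ : IsOpen Ω) (hv : ContDiffOn ℝ 1 v Ω) :
    totalVariation v Ω ≤ ∫⁻ x in Ω, ENNReal.ofReal (gradNorm v x) := by
  refine iSup₂_le fun φ hφ => ?_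
  rw [sum_setIntegral_mul_divergence hΩ hv hφ, ← integral_neg]
  refine (ENNReal.ofReal_le_ofReal (le_abs_self _)).trans ?_
  rw [← Real.enorm_eq_ofReal_abs]
  refine (enorm_integral_le_lintegral_enorm _).trans (lintegral_mono fun x => ?_)
  rw [Real.enorm_eq_ofReal_abs, abs_neg]
  exact ENNReal.ofReal_le_ofReal (abs_sum_mul_grad_le v x (hφ.2 x))

end IntegrationByParts

end TripleJunction

/-! ### The reverse inequality: the gradient integral is at most the total variation. -/

namespace TripleJunction

/-- The Jacobian matrix as a vector of a Euclidean space, whose norm is the Frobenius norm. -/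
noncomputable def gradVec (v : Plane → Plane) (x : Plane) : EuclideanSpace ℝ (Fin 2 × Fin 2) :=
  WithLp.toLp 2 fun p => grad v x p.1 p.2

lemma norm_gradVec (v : Plane → Plane) (x : Plane) : ‖gradVec v x‖ = gradNorm v x := by
  rw [EuclideanSpace.norm_eq, gradNorm, Fintype.sum_prod_type]
  simp [gradVec]

lemma inner_gradVec (v : Plane → Plane) (x : Plane) (y : EuclideanSpace ℝ (Fin 2 × Fin 2)) :
    inner ℝ y (gradVec v x) = ∑ i, ∑ j, y (i, j) * grad v x i j := by
  rw [PiLp.inner_apply, Fintype.sum_prod_type]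
  simp [gradVec, mul_comm]

variable {Ω K : Set Plane} {v : Plane → Plane}

lemma continuousOn_gradVec (hΩ : IsOpen Ω) (hv : ContDiffOn ℝ 1 v Ω) :
    ContinuousOn (gradVec v) Ω := by
  unfold gradVec
  apply (PiLp.continuous_toLp 2 _).comp_continuousOn
  exact continuousOn_pi.2 fun p => continuousOn_grad hΩ hv p.1 p.2

/-- A cutoff of the direction of the gradient, approximated by a test field. -/
lemma exists_testField_approx (hΩ : IsOpen Ω) (hv : ContDiffOn ℝ 1 v Ω) {S : Set Plane}
    (hS : IsCompact S) (hSΩ : S ⊆ Ω) {χ : Plane → ℝ} (hχc : Continuous χ)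
    (hχ : ∀ x, χ x ∈ Icc (0 : ℝ) 1) (hχS : Function.support χ ⊆ S) {ε : ℝ} (hε : 0 < ε) :
    ∃ φ, IsTestField Ω φ ∧ (∀ x ∉ S, ∀ i, φ i x = 0) ∧
      ∀ x, χ x * (gradNorm v x - ε) - ε * gradNorm v x ≤
        (1 + ε) * -∑ i, ∑ j, φ i x j * grad v x i j := by
  -- The optimal direction is `-∇v / |∇v|`; the `ε` in the denominator keeps it continuous where the
  -- gradient vanishes, and the minus sign cancels that of the integration by parts.
  set N : Plane → EuclideanSpace ℝ (Fin 2 × Fin 2) :=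
    fun x => (-χ x / (ε + ‖gradVec v x‖)) • gradVec v x with hN
  have hts : tsupport χ ⊆ S := closure_minimal hχS hS.isClosed
  have hNsupp : Function.support N ⊆ S := by
    intro x hx
    apply hχS
    intro h0
    apply hx
    simp only [hN, h0]
    simp
  have hNcont : Continuous N := by
    apply continuous_of_tsupport
    intro x hx
    have hx' : x ∈ Ω := hSΩ (closure_minimal hNsupp hS.isClosed hx)
    have hD := (continuousOn_gradVec hΩ hv).continuousAt (hΩ.mem_nhds hx')
    refine ((hχc.continuousAt.neg).div (continuousAt_const.add hD.norm) ?_).smul hD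
    exact (by positivity : 0 < ε + ‖gradVec v x‖).ne'
  have hNnorm : ∀ x, ‖N x‖ ≤ 1 := by
    intro x
    rw [hN, norm_smul, norm_div, norm_neg, Real.norm_of_nonneg (hχ x).1,
      Real.norm_of_nonneg (by positivity : (0 : ℝ) ≤ ε + ‖gradVec v x‖), div_mul_eq_mul_div,
      div_le_one (by positivity)]
    nlinarith [(hχ x).2, norm_nonneg (gradVec v x)]
  obtain ⟨g, hgs, hgd, hgsupp⟩ := hNcont.exists_contDiff_approx 1 (ε := fun _ => ε)
    continuous_const fun _ => hε
  have hgz : ∀ x ∉ S, g x = 0 := by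
    intro x hx
    by_contra h
    exact hx (hNsupp (hgsupp h))
  -- The smooth approximation `g` of `N` has norm at most `1 + ε`; dividing by this restores the
  -- constraint on test fields.
  set φ : Fin 2 → Plane → Plane := fun i x => (1 + ε)⁻¹ • !₂[g x (i, 0), g x (i, 1)] with hφ
  have hφz : ∀ x ∉ S, ∀ i, φ i x = 0 := by
    intro x hx i
    simp only [hφ, hgz x hx]
    apply plane_ext <;> simp
  have hφsupp : ∀ i, tsupport (φ i) ⊆ S := by
    intro i
    apply closure_minimal _ hS.isClosed
    intro x hx
    by_contra h
    exact hx (hφz x h i)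
  have h1ε : 0 < 1 + ε := by linarith
  refine ⟨φ, ⟨fun i => ⟨?_, hS.of_isClosed_subset (isClosed_tsupport _) (hφsupp i),
    (hφsupp i).trans hSΩ⟩, ?_⟩, hφz, ?_⟩
  · apply ContDiff.const_smul
    rw [contDiff_euclidean]
    intro j
    fin_cases j
    · exact contDiff_euclidean.1 hgs (i, 0)
    · exact contDiff_euclidean.1 hgs (i, 1)
  · intro x
    have e : ∑ i, ‖φ i x‖ ^ 2 = ((1 + ε)⁻¹ * ‖g x‖) ^ 2 := by
      rw [mul_pow, EuclideanSpace.norm_sq_eq (g x), Fintype.sum_prod_type, Finset.mul_sum]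
      refine Finset.sum_congr rfl fun i _ => ?_
      rw [hφ, norm_smul, mul_pow, norm_sq_eq]
      simp
    rw [e, sq_le_one_iff₀ (by positivity), inv_mul_le_iff₀ h1ε]
    have := norm_le_norm_add_norm_sub' (g x) (N x)
    rw [← dist_eq_norm] at this
    linarith [hNnorm x, hgd x]
  · intro x
    have e : (1 + ε) * -∑ i, ∑ j, φ i x j * grad v x i j = -inner ℝ (g x) (gradVec v x) := by
      rw [inner_gradVec, mul_neg, Finset.mul_sum]
      congr 1
      refine Finset.sum_congr rfl fun i _ => ?_
      simp only [Fin.sum_univ_two, hφ]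
      simp
      field_simp
    have e2 : inner ℝ (N x) (gradVec v x) = -(χ x * (‖gradVec v x‖ ^ 2 / (ε + ‖gradVec v x‖))) := by
      rw [hN, inner_smul_left, real_inner_self_eq_norm_sq]
      simp; ring
    have h3 : ‖gradVec v x‖ - ε ≤ ‖gradVec v x‖ ^ 2 / (ε + ‖gradVec v x‖) := by
      rw [le_div_iff₀ (by positivity)]
      nlinarith
    have h4 : inner ℝ (g x - N x) (gradVec v x) ≤ ε * ‖gradVec v x‖ := by
      refine (real_inner_le_norm _ _).trans ?_
      rw [← dist_eq_norm]
      exact mul_le_mul_of_nonneg_right (hgd x).le (norm_nonneg _)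
    rw [inner_sub_left] at h4
    rw [e, ← norm_gradVec]
    nlinarith [mul_le_mul_of_nonneg_left h3 (hχ x).1]

/-- The normalized gradient, cut off around `K`, nearly attains the supremum. The errors live on a
compact `S ⊆ Ω`, where the gradient is bounded by `M`, and vanish with `ε`; near the boundary of `Ω`
the gradient may be unbounded. -/
lemma lintegral_gradNorm_compact_le_totalVariation (hΩ : IsOpen Ω) (hv : ContDiffOn ℝ 1 v Ω)
    (hK : IsCompact K) (hKΩ : K ⊆ Ω) :
    ∫⁻ x in K, ENNReal.ofReal (gradNorm v x) ≤ totalVariation v Ω := by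
  by_cases htop : totalVariation v Ω = ⊤
  · rw [htop]; exact le_top
  obtain ⟨S, hS, hKS, hSΩ⟩ := exists_compact_between hK hΩ hKΩ
  obtain ⟨χ, hχ1, hχ0, -, hχ⟩ := exists_continuous_one_zero_of_isCompact hK
    isOpen_interior.isClosed_compl (disjoint_compl_right_iff_subset.mpr hKS)
  have hχS : Function.support χ ⊆ S := by
    intro x hx
    by_contra h
    exact hx (hχ0 fun h' => h (interior_subset h'))
  have hcont := continuousOn_gradNorm hΩ hv
  obtain ⟨M, hM⟩ := hS.exists_bound_of_continuousOn (hcont.mono hSΩ)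
  have hKS' : K ⊆ S := hKS.trans interior_subset
  have hintK : IntegrableOn (gradNorm v) K := (hcont.mono hKΩ).integrableOn_compact hK
  have key : ∀ ε > 0, (∫ x in K, gradNorm v x) - ε * ((1 + M) * volume.real S) ≤
      (1 + ε) * (totalVariation v Ω).toReal := by
    intro ε hε
    obtain ⟨φ, hφ, hφz, hφle⟩ := exists_testField_approx hΩ hv hS hSΩ χ.continuous hχ hχS hε
    have h1 : -∫ x in Ω, ∑ i, ∑ j, φ i x j * grad v x i j ≤ (totalVariation v Ω).toReal := by
      rw [← sum_setIntegral_mul_divergence hΩ hv hφ, ← ENNReal.ofReal_le_iff_le_toReal htop]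
      exact le_iSup₂_of_le φ hφ le_rfl
    have hcontS : ContinuousOn (fun x => ∑ i, ∑ j, φ i x j * grad v x i j) S := by
      refine continuousOn_finsetSum _ fun i _ => continuousOn_finsetSum _ fun j _ => ?_
      exact ((contDiff_coord (hφ.1 i).1 j).continuous.continuousOn).mul
        ((continuousOn_grad hΩ hv i j).mono hSΩ)
    have h2 : ∫ x in Ω, ∑ i, ∑ j, φ i x j * grad v x i j =
        ∫ x in S, ∑ i, ∑ j, φ i x j * grad v x i j := by
      apply setIntegral_eq_of_subset_of_forall_sdiff_eq_zero hΩ.measurableSet hSΩ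
      intro x hx
      simp [hφz x hx.2]
    have h3 : ∫ x in S, (K.indicator (gradNorm v) x - ε * (1 + M)) ≤
        ∫ x in S, (1 + ε) * -∑ i, ∑ j, φ i x j * grad v x i j := by
      have hfin : volume S ≠ ⊤ := hS.measure_ne_top
      have hI1 : IntegrableOn (K.indicator (gradNorm v)) S :=
        (hintK.integrable_indicator hK.measurableSet).integrableOn
      apply setIntegral_mono_on (hI1.sub (integrableOn_const hfin))
        ((hcontS.neg.const_smul (1 + ε)).integrableOn_compact hS) hS.measurableSet
      intro x hx
      refine le_trans ?_ (hφle x)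
      change K.indicator (gradNorm v) x - ε * (1 + M) ≤ _
      have hMx := (le_abs_self _).trans (hM x hx)
      have hg0 := gradNorm_nonneg v x
      by_cases hxK : x ∈ K
      · have : χ x = 1 := hχ1 hxK
        rw [indicator_of_mem hxK, this]
        nlinarith
      · rw [indicator_of_notMem hxK]
        nlinarith [mul_nonneg (hχ x).1 hg0, (hχ x).1, (hχ x).2]
    rw [integral_sub (hintK.integrable_indicator hK.measurableSet).integrableOn
      (integrableOn_const hS.measure_ne_top), setIntegral_indicator hK.measurableSet,
      inter_eq_self_of_subset_right hKS', setIntegral_const, integral_const_mul, integral_neg,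
      ← h2, smul_eq_mul] at h3
    have := mul_le_mul_of_nonneg_left h1 (by linarith : 0 ≤ 1 + ε)
    linarith
  have hlim : ∫ x in K, gradNorm v x ≤ (totalVariation v Ω).toReal := by
    have t1 : Tendsto (fun ε : ℝ => (∫ x in K, gradNorm v x) - ε * ((1 + M) * volume.real S))
        (𝓝[>] 0) (𝓝 ((∫ x in K, gradNorm v x) - 0 * ((1 + M) * volume.real S))) :=
      ((by fun_prop : Continuous fun ε : ℝ =>
        (∫ x in K, gradNorm v x) - ε * ((1 + M) * volume.real S)).tendsto 0).mono_left inf_le_left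
    have t2 : Tendsto (fun ε : ℝ => (1 + ε) * (totalVariation v Ω).toReal)
        (𝓝[>] 0) (𝓝 ((1 + 0) * (totalVariation v Ω).toReal)) :=
      ((by fun_prop : Continuous fun ε : ℝ =>
        (1 + ε) * (totalVariation v Ω).toReal).tendsto 0).mono_left inf_le_left
    have := le_of_tendsto_of_tendsto t1 t2 (eventually_mem_nhdsWithin.mono key)
    simpa using this
  rw [← ofReal_integral_eq_lintegral_ofReal hintK (ae_of_all _ (gradNorm_nonneg v))]
  exact (ENNReal.ofReal_le_iff_le_toReal htop).2 hlim

/-- Exhaustion by balls of radius `ℓ - 1/(n+1)`. This is what lets a bound on the total variation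
control lengths of circles. -/
lemma lintegral_gradNorm_ball_le_totalVariation {ℓ : ℝ}
    (hv : ContDiffOn ℝ 1 v (Metric.ball 0 ℓ)) :
    ∫⁻ x in Metric.ball 0 ℓ, ENNReal.ofReal (gradNorm v x) ≤
      totalVariation v (Metric.ball 0 ℓ) := by
  have hU : Metric.ball (0 : Plane) ℓ =
      ⋃ n : ℕ, Metric.ball (0 : Plane) (ℓ - 1 / (n + 1 : ℝ)) := by
    ext x
    simp only [mem_iUnion, mem_ball_zero_iff]
    constructor
    · intro hx
      obtain ⟨n, hn⟩ := exists_nat_one_div_lt (sub_pos.2 hx)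
      exact ⟨n, by linarith⟩
    · rintro ⟨n, hn⟩
      have : (0 : ℝ) < 1 / (n + 1) := by positivity
      linarith
  have hmono : Monotone fun n : ℕ => Metric.ball (0 : Plane) (ℓ - 1 / (n + 1 : ℝ)) := by
    intro m n hmn
    apply Metric.ball_subset_ball
    have := one_div_le_one_div_of_le (by positivity : (0 : ℝ) < m + 1)
      (by exact_mod_cast Nat.succ_le_succ hmn : (m + 1 : ℝ) ≤ n + 1)
    linarith
  conv_lhs => rw [hU]
  rw [setLIntegral_iUnion_of_directed _ hmono.directed_le]
  refine iSup_le fun n => ?_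
  have hpos : (0 : ℝ) < 1 / (n + 1) := by positivity
  refine (lintegral_mono_set Metric.ball_subset_closedBall).trans ?_
  exact lintegral_gradNorm_compact_le_totalVariation Metric.isOpen_ball hv
    (isCompact_closedBall _ _) (Metric.closedBall_subset_ball (by linarith))

end TripleJunction

/-! ### Maps with separated polar variables, and smooth transitions. -/

namespace TripleJunction

section PolarMap

variable {F : Type*} [NormedAddCommGroup F] [NormedSpace ℝ F]

/-- The map with separated variables `ψ(r) P(θ)` in polar coordinates. -/
noncomputable def polarMap (c : ℝ) (ψ : ℝ → ℝ) (P : ℝ → F) (x : Plane) : F :=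
  ψ ‖x‖ • P (ang c x)

lemma polarMap_pol {c r θ : ℝ} (ψ : ℝ → ℝ) (P : ℝ → F) (hr : 0 < r)
    (hθ : θ ∈ Ioc (c - Real.pi) (c + Real.pi)) : polarMap c ψ P (pol r θ) = ψ r • P θ := by
  rw [polarMap, norm_pol, abs_of_pos hr, ang_pol hr hθ]

lemma contDiffAt_ang {c : ℝ} {x : Plane} (hx : (planeIso c).symm x ∈ Complex.slitPlane) :
    ContDiffAt ℝ 1 (ang c) x := by
  have h1 : ContDiffAt ℝ 1 Complex.arg ((planeIso c).symm x) := by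
    have := (Complex.contDiffAt_log (n := 1) hx).restrict_scalars ℝ
    have e : Complex.arg = Complex.imCLM ∘ Complex.log := by ext z; simp [Complex.log_im]
    rw [e]
    exact Complex.imCLM.contDiff.contDiffAt.comp _ this
  exact (h1.comp x (planeIso c).symm.contDiff.contDiffAt).add contDiffAt_const

lemma abs_arg_eq_arccos {z : ℂ} (hz : z ≠ 0) : |z.arg| = Real.arccos (z.re / ‖z‖) := by
  rw [← Complex.cos_arg hz, ← Real.cos_abs,
    Real.arccos_cos (abs_nonneg _) (Complex.abs_arg_le_pi z)]

/-- Unlike `arg`, its absolute value is continuous across the cut, so it can describe a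
neighbourhood of the cut. -/
lemma continuousAt_abs_arg {z : ℂ} (hz : z ≠ 0) : ContinuousAt (fun w : ℂ => |w.arg|) z := by
  have h : (fun w : ℂ => Real.arccos (w.re / ‖w‖)) =ᶠ[𝓝 z] fun w => |w.arg| := by
    filter_upwards [isOpen_ne.mem_nhds hz] with w hw
    exact (abs_arg_eq_arccos hw).symm
  refine ContinuousAt.congr ?_ h
  exact Real.continuous_arccos.continuousAt.comp
    (Complex.continuous_re.continuousAt.div continuous_norm.continuousAt (norm_ne_zero_iff.2 hz))

/-- Near the origin `ψ` vanishes; off the cut `ang c` is `C¹`; near the cut `P` equals the same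
constant `p` on both sides, so the map reduces to `ψ(|x|) p`. -/
lemma contDiff_polarMap {c a κ : ℝ} {ψ : ℝ → ℝ} {P : ℝ → F} {p : F} (ha : 0 < a) (hκ : 0 < κ)
    (hψ : ContDiff ℝ 1 ψ) (hψ0 : ∀ r < a, ψ r = 0) (hP : ContDiff ℝ 1 P)
    (hPl : ∀ θ ≤ c - Real.pi + κ, P θ = p) (hPr : ∀ θ ≥ c + Real.pi - κ, P θ = p) :
    ContDiff ℝ 1 (polarMap c ψ P) := by
  rw [contDiff_iff_contDiffAt]
  intro x
  by_cases hx : x = 0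
  · have : polarMap c ψ P =ᶠ[𝓝 x] fun _ => 0 := by
      filter_upwards [Metric.ball_mem_nhds x ha] with y hy
      rw [hx, mem_ball_zero_iff] at hy
      rw [polarMap, hψ0 _ hy, zero_smul]
    exact contDiffAt_const.congr_of_eventuallyEq this
  have hψx : ContDiffAt ℝ 1 (fun y : Plane => ψ ‖y‖) x :=
    hψ.contDiffAt.comp x (contDiffAt_norm ℝ hx)
  by_cases hs : (planeIso c).symm x ∈ Complex.slitPlane
  · exact hψx.smul (hP.contDiffAt.comp x (contDiffAt_ang hs))
  · have hx' : (planeIso c).symm x ≠ 0 := by simpa using hx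
    have harg : ((planeIso c).symm x).arg = Real.pi := by
      by_contra h
      exact hs (Complex.mem_slitPlane_iff_arg.2 ⟨h, hx'⟩)
    have hcont : ContinuousAt (fun y => |((planeIso c).symm y).arg|) x :=
      ContinuousAt.comp (f := (planeIso c).symm) (continuousAt_abs_arg hx')
        (planeIso c).symm.continuous.continuousAt
    have hev : ∀ᶠ y in 𝓝 x, Real.pi - κ < |((planeIso c).symm y).arg| := by
      apply hcont.eventually (lt_mem_nhds _)
      show _ < |((planeIso c).symm x).arg|
      rw [harg, abs_of_pos Real.pi_pos]
      linarith
    have : polarMap c ψ P =ᶠ[𝓝 x] fun y => ψ ‖y‖ • p := by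
      filter_upwards [hev] with y hy
      rw [polarMap]
      congr 1
      rcases lt_abs.1 hy with h | h
      · apply hPr; rw [ang]; linarith
      · apply hPl; rw [ang]; linarith
    exact (hψx.smul contDiffAt_const).congr_of_eventuallyEq this

lemma hasDerivAt_comp_pol_left {f : Plane → F} {r θ : ℝ} (hf : DifferentiableAt ℝ f (pol r θ)) :
    HasDerivAt (fun s => f (pol s θ)) (fderiv ℝ f (pol r θ) (pol 1 θ)) r :=
  hf.hasFDerivAt.comp_hasDerivAt r (hasDerivAt_pol_left r θ)

lemma hasDerivAt_comp_pol_right {f : Plane → F} {r θ : ℝ} (hf : DifferentiableAt ℝ f (pol r θ)) :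
    HasDerivAt (fun t => f (pol r t)) (r • fderiv ℝ f (pol r θ) (angDir θ)) θ := by
  have := hf.hasFDerivAt.comp_hasDerivAt θ (hasDerivAt_pol_right r θ)
  rwa [map_smul] at this

lemma fderiv_polarMap_left {c r θ : ℝ} {ψ : ℝ → ℝ} {P : ℝ → F}
    (hd : DifferentiableAt ℝ (polarMap c ψ P) (pol r θ)) (hψ : DifferentiableAt ℝ ψ r)
    (hr : 0 < r) (hθ : θ ∈ Ioo (c - Real.pi) (c + Real.pi)) :
    fderiv ℝ (polarMap c ψ P) (pol r θ) (pol 1 θ) = deriv ψ r • P θ := by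
  refine (hasDerivAt_comp_pol_left hd).unique ?_
  refine (hψ.hasDerivAt.smul_const (P θ)).congr_of_eventuallyEq ?_
  filter_upwards [lt_mem_nhds hr] with s hs
  exact polarMap_pol ψ P hs ⟨hθ.1, hθ.2.le⟩

lemma fderiv_polarMap_right {c r θ : ℝ} {ψ : ℝ → ℝ} {P : ℝ → F}
    (hd : DifferentiableAt ℝ (polarMap c ψ P) (pol r θ)) (hP : DifferentiableAt ℝ P θ)
    (hr : 0 < r) (hθ : θ ∈ Ioo (c - Real.pi) (c + Real.pi)) :
    r • fderiv ℝ (polarMap c ψ P) (pol r θ) (angDir θ) = ψ r • deriv P θ := by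
  refine (hasDerivAt_comp_pol_right hd).unique ?_
  refine (hP.hasDerivAt.const_smul (ψ r)).congr_of_eventuallyEq ?_
  filter_upwards [Ioo_mem_nhds hθ.1 hθ.2] with t ht
  exact polarMap_pol ψ P hr ⟨ht.1, ht.2.le⟩

end PolarMap

section Transition

/-- A smooth monotone transition from `0` to `1` on the interval `[-ε, ε]`. -/
noncomputable def transition (ε t : ℝ) : ℝ := Real.smoothTransition ((t / ε + 1) / 2)

variable {ε t : ℝ}

@[fun_prop] lemma contDiff_transition (ε : ℝ) : ContDiff ℝ 1 (transition ε) := by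
  unfold transition
  exact Real.smoothTransition.contDiff.comp (by fun_prop)

lemma transition_of_le (hε : 0 < ε) (ht : t ≤ -ε) : transition ε t = 0 := by
  apply Real.smoothTransition.zero_of_nonpos
  have : t / ε ≤ -1 := by rw [div_le_iff₀ hε]; linarith
  linarith

lemma transition_of_ge (hε : 0 < ε) (ht : ε ≤ t) : transition ε t = 1 := by
  apply Real.smoothTransition.one_of_one_le
  have : 1 ≤ t / ε := by rw [le_div_iff₀ hε]; linarith
  linarith

lemma transition_nonneg (ε t : ℝ) : 0 ≤ transition ε t := Real.smoothTransition.nonneg _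

lemma transition_le_one (ε t : ℝ) : transition ε t ≤ 1 := Real.smoothTransition.le_one _

lemma monotone_transition (hε : 0 < ε) : Monotone (transition ε) := by
  intro s t hst
  apply Real.smoothTransition.monotone
  gcongr

lemma deriv_transition_nonneg (hε : 0 < ε) (t : ℝ) : 0 ≤ deriv (transition ε) t :=
  (monotone_transition hε).deriv_nonneg

lemma deriv_transition_of_lt (hε : 0 < ε) (ht : t < -ε) : deriv (transition ε) t = 0 := by
  have : transition ε =ᶠ[𝓝 t] fun _ => 0 := by
    filter_upwards [gt_mem_nhds ht] with s hs using transition_of_le hε hs.le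
  rw [this.deriv_eq, deriv_const]

lemma deriv_transition_of_gt (hε : 0 < ε) (ht : ε < t) : deriv (transition ε) t = 0 := by
  have : transition ε =ᶠ[𝓝 t] fun _ => 1 := by
    filter_upwards [lt_mem_nhds ht] with s hs using transition_of_ge hε hs.le
  rw [this.deriv_eq, deriv_const]

lemma lintegral_ofReal_deriv {f f' : ℝ → ℝ} {a b : ℝ} (hab : a ≤ b)
    (hf : ∀ x, HasDerivAt f (f' x) x) (hc : Continuous f') (h0 : ∀ x ∈ Ioo a b, 0 ≤ f' x) :
    ∫⁻ x in Ioo a b, ENNReal.ofReal (f' x) = ENNReal.ofReal (f b - f a) := by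
  rw [← ofReal_integral_eq_lintegral_ofReal
    ((hc.integrableOn_Icc (a := a) (b := b)).mono_set Ioo_subset_Icc_self)
    (by filter_upwards [ae_restrict_mem measurableSet_Ioo] with x hx using h0 x hx),
    ← integral_Ioc_eq_integral_Ioo, ← intervalIntegral.integral_of_le hab,
    intervalIntegral.integral_eq_sub_of_hasDerivAt (fun x _ => hf x) (hc.intervalIntegrable _ _)]

end Transition

end TripleJunction

/-! ### The recovery maps: pointwise formulas and one-dimensional integrals. -/

namespace TripleJunction

variable {ε ℓ θ₀ θ r : ℝ} {α β γ : Plane} {u : Plane → Plane}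

/-- The sum of the three transition profiles. -/
noncomputable def transitionSum (ε θ₀ θ : ℝ) : ℝ :=
  transition ε (θ - θ₀) + transition ε (θ - (θ₀ + 2 * Real.pi / 3)) +
    transition ε (θ - (θ₀ + 4 * Real.pi / 3))

/-- A smooth parametrization of the boundary of the triangle, which rests at the vertices outside
`ε`-neighbourhoods of the interface angles. -/
noncomputable def smoothLoop (ε θ₀ : ℝ) (α β γ : Plane) (θ : ℝ) : Plane :=
  γ + transition ε (θ - θ₀) • (α - γ) + transition ε (θ - (θ₀ + 2 * Real.pi / 3)) • (β - α) +
    transition ε (θ - (θ₀ + 4 * Real.pi / 3)) • (γ - β)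

/-- The recovery sequence: a cone over the smoothed boundary of the triangle near the origin. -/
noncomputable def recovery (ε θ₀ : ℝ) (α β γ : Plane) : Plane → Plane :=
  polarMap (θ₀ + 2 * Real.pi / 3) (fun r => transition (ε / 4) (r - 3 * ε / 4))
    (smoothLoop ε θ₀ α β γ)

lemma contDiff_smoothLoop (ε θ₀ : ℝ) (α β γ : Plane) : ContDiff ℝ 1 (smoothLoop ε θ₀ α β γ) := by
  unfold smoothLoop; fun_prop

/-- This profile vanishes for `r ≤ ε/2` and equals `1` for `r ≥ ε`. -/
lemma contDiff_radialProfile (ε : ℝ) :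
    ContDiff ℝ 1 (fun r => transition (ε / 4) (r - 3 * ε / 4)) := by fun_prop

lemma contDiff_transitionSum (ε θ₀ : ℝ) : ContDiff ℝ 1 (transitionSum ε θ₀) := by
  unfold transitionSum; fun_prop

lemma hasDerivAt_transition_sub (ε θ θ₁ : ℝ) :
    HasDerivAt (fun t => transition ε (t - θ₁)) (deriv (transition ε) (θ - θ₁)) θ :=
  HasDerivAt.comp_sub_const θ θ₁
    ((contDiff_transition ε).differentiable one_ne_zero (θ - θ₁)).hasDerivAt

lemma hasDerivAt_smoothLoop (ε θ₀ : ℝ) (α β γ : Plane) (θ : ℝ) :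
    HasDerivAt (smoothLoop ε θ₀ α β γ)
      (deriv (transition ε) (θ - θ₀) • (α - γ) +
        deriv (transition ε) (θ - (θ₀ + 2 * Real.pi / 3)) • (β - α) +
        deriv (transition ε) (θ - (θ₀ + 4 * Real.pi / 3)) • (γ - β)) θ := by
  have h := (((hasDerivAt_transition_sub ε θ θ₀).smul_const (α - γ)).const_add γ).add
    ((hasDerivAt_transition_sub ε θ (θ₀ + 2 * Real.pi / 3)).smul_const (β - α)) |>.add
    ((hasDerivAt_transition_sub ε θ (θ₀ + 4 * Real.pi / 3)).smul_const (γ - β))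
  exact h

lemma hasDerivAt_transitionSum (ε θ₀ θ : ℝ) :
    HasDerivAt (transitionSum ε θ₀)
      (deriv (transition ε) (θ - θ₀) +
        deriv (transition ε) (θ - (θ₀ + 2 * Real.pi / 3)) +
        deriv (transition ε) (θ - (θ₀ + 4 * Real.pi / 3))) θ :=
  ((hasDerivAt_transition_sub ε θ θ₀).add
    (hasDerivAt_transition_sub ε θ (θ₀ + 2 * Real.pi / 3))).add
    (hasDerivAt_transition_sub ε θ (θ₀ + 4 * Real.pi / 3))

lemma deriv_transitionSum_nonneg (hε : 0 < ε) (θ₀ θ : ℝ) : 0 ≤ deriv (transitionSum ε θ₀) θ := by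
  rw [(hasDerivAt_transitionSum ε θ₀ θ).deriv]
  have := deriv_transition_nonneg hε
  linarith [this (θ - θ₀), this (θ - (θ₀ + 2 * Real.pi / 3)), this (θ - (θ₀ + 4 * Real.pi / 3))]

lemma smoothLoop_eq_stepMap (hε : 0 < ε) (hε' : ε ≤ 1 / 2)
    (h0 : ε ≤ |θ - θ₀|) (h1 : ε ≤ |θ - (θ₀ + 2 * Real.pi / 3)|)
    (h2 : ε ≤ |θ - (θ₀ + 4 * Real.pi / 3)|) :
    smoothLoop ε θ₀ α β γ θ = stepMap θ₀ α β γ θ := by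
  have hpi := Real.pi_gt_three
  unfold smoothLoop stepMap
  split_ifs with i0 i1 i2
  · rw [abs_of_neg (by linarith)] at h0
    rw [transition_of_le hε (by linarith), transition_of_le hε (by linarith),
      transition_of_le hε (by linarith)]
    simp
  · rw [abs_of_nonneg (by linarith)] at h0
    rw [abs_of_neg (by linarith)] at h1
    rw [transition_of_ge hε (by linarith), transition_of_le hε (by linarith),
      transition_of_le hε (by linarith)]
    simp
  · rw [abs_of_nonneg (by linarith)] at h1
    rw [abs_of_neg (by linarith)] at h2
    rw [transition_of_ge hε (by linarith), transition_of_ge hε (by linarith),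
      transition_of_le hε (by linarith)]
    simp
  · rw [abs_of_nonneg (by linarith)] at h2
    rw [transition_of_ge hε (by linarith), transition_of_ge hε (by linarith),
      transition_of_ge hε (by linarith)]
    simp

/-- The three transitions are ordered, `1 ≥ a ≥ b ≥ d ≥ 0`, so the loop is a convex combination of
unit vectors with weights `1 - a + d`, `a - b`, `b - d`. -/
lemma norm_smoothLoop_le (hε : 0 < ε) (hα : ‖α‖ = 1) (hβ : ‖β‖ = 1) (hγ : ‖γ‖ = 1) (θ₀ θ : ℝ) :
    ‖smoothLoop ε θ₀ α β γ θ‖ ≤ 1 := by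
  have hpi := Real.pi_pos
  unfold smoothLoop
  have m1 := monotone_transition hε (by linarith : θ - (θ₀ + 2 * Real.pi / 3) ≤ θ - θ₀)
  have m2 := monotone_transition hε
    (by linarith : θ - (θ₀ + 4 * Real.pi / 3) ≤ θ - (θ₀ + 2 * Real.pi / 3))
  have a1 := transition_le_one ε (θ - θ₀)
  have c0 := transition_nonneg ε (θ - (θ₀ + 4 * Real.pi / 3))
  generalize transition ε (θ - θ₀) = a at *
  generalize transition ε (θ - (θ₀ + 2 * Real.pi / 3)) = b at *
  generalize transition ε (θ - (θ₀ + 4 * Real.pi / 3)) = d at *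
  have e : γ + a • (α - γ) + b • (β - α) + d • (γ - β) =
      (1 - a + d) • γ + (a - b) • α + (b - d) • β := by module
  rw [e]
  refine (norm_add₃_le).trans ?_
  rw [norm_smul, norm_smul, norm_smul, hα, hβ, hγ, Real.norm_of_nonneg (by linarith),
    Real.norm_of_nonneg (by linarith), Real.norm_of_nonneg (by linarith)]
  linarith

lemma norm_deriv_smoothLoop_le (hε : 0 < ε) {D : ℝ} (h1 : ‖α - γ‖ = D) (h2 : ‖β - α‖ = D)
    (h3 : ‖γ - β‖ = D) (θ₀ θ : ℝ) :
    ‖deriv (smoothLoop ε θ₀ α β γ) θ‖ ≤ deriv (transitionSum ε θ₀) θ * D := by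
  rw [(hasDerivAt_smoothLoop ε θ₀ α β γ θ).deriv, (hasDerivAt_transitionSum ε θ₀ θ).deriv]
  refine norm_add₃_le.trans ?_
  have := deriv_transition_nonneg hε
  rw [norm_smul, norm_smul, norm_smul, h1, h2, h3, Real.norm_of_nonneg (this _),
    Real.norm_of_nonneg (this _), Real.norm_of_nonneg (this _)]
  linarith

/-- Since `ε ≤ 1/2` at most one transition is active at a time, and the loop then moves along a
single edge from `A` to `B`. There `cross (A + t(B - A)) (B - A) = cross A B`, and this equals
`cross α β` for all three oriented edges because the vertices sum to zero. -/
lemma cross_smoothLoop_deriv (hε : 0 < ε) (hε' : ε ≤ 1 / 2) (hsum : α + β + γ = 0) (θ₀ θ : ℝ) :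
    cross (smoothLoop ε θ₀ α β γ θ) (deriv (smoothLoop ε θ₀ α β γ) θ) =
      deriv (transitionSum ε θ₀) θ * cross α β := by
  have hpi := Real.pi_gt_three
  rw [(hasDerivAt_smoothLoop ε θ₀ α β γ θ).deriv, (hasDerivAt_transitionSum ε θ₀ θ).deriv]
  have hγ : γ = -α - β := by rw [eq_comm, sub_eq_iff_eq_add, neg_eq_iff_add_eq_zero, ← hsum]; abel
  have key0 : deriv (transition ε) (θ - θ₀) = 0 ∨
      (transition ε (θ - (θ₀ + 2 * Real.pi / 3)) = 0 ∧
        transition ε (θ - (θ₀ + 4 * Real.pi / 3)) = 0) := by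
    by_cases h : ε < θ - θ₀
    · exact Or.inl (deriv_transition_of_gt hε h)
    · exact Or.inr ⟨transition_of_le hε (by linarith), transition_of_le hε (by linarith)⟩
  have key1 : deriv (transition ε) (θ - (θ₀ + 2 * Real.pi / 3)) = 0 ∨
      (transition ε (θ - θ₀) = 1 ∧ transition ε (θ - (θ₀ + 4 * Real.pi / 3)) = 0) := by
    by_cases h : ε < θ - (θ₀ + 2 * Real.pi / 3)
    · exact Or.inl (deriv_transition_of_gt hε h)
    by_cases h' : θ - (θ₀ + 2 * Real.pi / 3) < -ε
    · exact Or.inl (deriv_transition_of_lt hε h')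
    · exact Or.inr ⟨transition_of_ge hε (by linarith), transition_of_le hε (by linarith)⟩
  have key2 : deriv (transition ε) (θ - (θ₀ + 4 * Real.pi / 3)) = 0 ∨
      (transition ε (θ - θ₀) = 1 ∧ transition ε (θ - (θ₀ + 2 * Real.pi / 3)) = 1) := by
    by_cases h' : θ - (θ₀ + 4 * Real.pi / 3) < -ε
    · exact Or.inl (deriv_transition_of_lt hε h')
    · exact Or.inr ⟨transition_of_ge hε (by linarith), transition_of_ge hε (by linarith)⟩
  unfold smoothLoop
  generalize transition ε (θ - θ₀) = a at *
  generalize transition ε (θ - (θ₀ + 2 * Real.pi / 3)) = b at *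
  generalize transition ε (θ - (θ₀ + 4 * Real.pi / 3)) = d at *
  generalize deriv (transition ε) (θ - θ₀) = a' at *
  generalize deriv (transition ε) (θ - (θ₀ + 2 * Real.pi / 3)) = b' at *
  generalize deriv (transition ε) (θ - (θ₀ + 4 * Real.pi / 3)) = d' at *
  have e : cross (γ + a • (α - γ) + b • (β - α) + d • (γ - β))
      (a' • (α - γ) + b' • (β - α) + d' • (γ - β)) =
      (a' * (1 - 3 * b + 3 * d) + b' * (3 * a - 3 * d - 2) + d' * (1 - 3 * a + 3 * b)) *
        cross α β := by
    rw [hγ]; simp only [cross, PiLp.add_apply, PiLp.smul_apply, PiLp.sub_apply, PiLp.neg_apply,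
      smul_eq_mul]; ring
  rw [e]
  congr 1
  have e0 : a' * (1 - 3 * b + 3 * d) = a' := by
    rcases key0 with h | ⟨h, h'⟩
    · rw [h, zero_mul]
    · rw [h, h']; ring
  have e1 : b' * (3 * a - 3 * d - 2) = b' := by
    rcases key1 with h | ⟨h, h'⟩
    · rw [h, zero_mul]
    · rw [h, h']; ring
  have e2 : d' * (1 - 3 * a + 3 * b) = d' := by
    rcases key2 with h | ⟨h, h'⟩
    · rw [h, zero_mul]
    · rw [h, h']; ring
  rw [e0, e1, e2]

lemma contDiff_recovery (hε : 0 < ε) (hε' : ε ≤ 1 / 2) (θ₀ : ℝ) (α β γ : Plane) :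
    ContDiff ℝ 1 (recovery ε θ₀ α β γ) := by
  have hpi := Real.pi_gt_three
  apply contDiff_polarMap (a := ε / 2) (κ := 1 / 2) (p := γ) (by linarith) (by norm_num)
    (contDiff_radialProfile ε) _ (contDiff_smoothLoop ε θ₀ α β γ)
  · intro θ hθ
    unfold smoothLoop
    rw [transition_of_le hε (by linarith), transition_of_le hε (by linarith),
      transition_of_le hε (by linarith)]
    simp
  · intro θ hθ
    unfold smoothLoop
    rw [transition_of_ge hε (by linarith), transition_of_ge hε (by linarith),
      transition_of_ge hε (by linarith)]
    simp
  · intro r hr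
    exact transition_of_le (by linarith) (by linarith)

lemma norm_recovery_le (hε : 0 < ε) (hα : ‖α‖ = 1) (hβ : ‖β‖ = 1) (hγ : ‖γ‖ = 1) (θ₀ : ℝ)
    (x : Plane) : ‖recovery ε θ₀ α β γ x‖ ≤ 1 := by
  rw [recovery, polarMap, norm_smul, Real.norm_of_nonneg (transition_nonneg _ _)]
  exact mul_le_one₀ (transition_le_one _ _) (norm_nonneg _) (norm_smoothLoop_le hε hα hβ hγ θ₀ _)

lemma lintegral_deriv_transitionSum_le (hε : 0 < ε) (θ₀ : ℝ) :
    ∫⁻ θ in Ioo (θ₀ + 2 * Real.pi / 3 - Real.pi) (θ₀ + 2 * Real.pi / 3 + Real.pi),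
      ENNReal.ofReal (deriv (transitionSum ε θ₀) θ) ≤ ENNReal.ofReal 3 := by
  rw [lintegral_ofReal_deriv (f := transitionSum ε θ₀) (by linarith [Real.pi_pos])
    (fun x => ((contDiff_transitionSum ε θ₀).differentiable one_ne_zero x).hasDerivAt)
    ((contDiff_transitionSum ε θ₀).continuous_deriv le_rfl)
    (fun x _ => deriv_transitionSum_nonneg hε θ₀ x)]
  apply ENNReal.ofReal_le_ofReal
  have h1 := transition_le_one ε
  have h0 := transition_nonneg ε
  unfold transitionSum
  generalize θ₀ + 2 * Real.pi / 3 + Real.pi = x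
  generalize θ₀ + 2 * Real.pi / 3 - Real.pi = y
  linarith [h1 (x - θ₀), h1 (x - (θ₀ + 2 * Real.pi / 3)), h1 (x - (θ₀ + 4 * Real.pi / 3)),
    h0 (y - θ₀), h0 (y - (θ₀ + 2 * Real.pi / 3)), h0 (y - (θ₀ + 4 * Real.pi / 3))]

lemma deriv_radialProfile_nonneg (hε : 0 < ε) (r : ℝ) :
    0 ≤ deriv (fun r => transition (ε / 4) (r - 3 * ε / 4)) r := by
  rw [(hasDerivAt_transition_sub _ _ _).deriv]
  exact deriv_transition_nonneg (by linarith) _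

/-- The derivative of the profile vanishes beyond `r = ε`, so the polar weight `r` is at most `ε`
where it matters: the radial part of the gradient disappears in the limit. -/
lemma lintegral_mul_deriv_radialProfile_le (hε : 0 < ε) (hℓ : 0 < ℓ) :
    ∫⁻ r in Ioo 0 ℓ, ENNReal.ofReal
      (r * deriv (fun r => transition (ε / 4) (r - 3 * ε / 4)) r) ≤ ENNReal.ofReal ε := by
  have hle : ∀ r ∈ Ioo 0 ℓ, ENNReal.ofReal
      (r * deriv (fun r => transition (ε / 4) (r - 3 * ε / 4)) r) ≤
      ENNReal.ofReal ε * ENNReal.ofReal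
        (deriv (fun r => transition (ε / 4) (r - 3 * ε / 4)) r) := by
    intro r hr
    rw [← ENNReal.ofReal_mul hε.le]
    apply ENNReal.ofReal_le_ofReal
    by_cases h : r ≤ ε
    · exact mul_le_mul_of_nonneg_right h (deriv_radialProfile_nonneg hε r)
    · rw [(hasDerivAt_transition_sub _ _ _).deriv,
        deriv_transition_of_gt (by linarith) (by linarith), mul_zero, mul_zero]
  refine (setLIntegral_mono' measurableSet_Ioo hle).trans ?_
  rw [lintegral_const_mul' _ _ ENNReal.ofReal_ne_top,
    lintegral_ofReal_deriv (f := fun r => transition (ε / 4) (r - 3 * ε / 4)) hℓ.le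
    (fun x => ((contDiff_radialProfile ε).differentiable one_ne_zero x).hasDerivAt)
    ((contDiff_radialProfile ε).continuous_deriv le_rfl)
    (fun x _ => deriv_radialProfile_nonneg hε x)]
  refine mul_le_of_le_one_right zero_le ?_
  rw [ENNReal.ofReal_le_one]
  linarith [transition_le_one (ε / 4) (ℓ - 3 * ε / 4), transition_nonneg (ε / 4) (0 - 3 * ε / 4)]

/-- The integrand is the derivative of `ψ² / 2`. This `1/2` meets the angular factor `3 |cross α β|`
to give the area of the triangle. -/
lemma lintegral_radialProfile_mul_deriv_le (hε : 0 < ε) (hℓ : 0 < ℓ) :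
    ∫⁻ r in Ioo 0 ℓ, ENNReal.ofReal (transition (ε / 4) (r - 3 * ε / 4) *
      deriv (fun r => transition (ε / 4) (r - 3 * ε / 4)) r) ≤ ENNReal.ofReal (1 / 2) := by
  rw [lintegral_ofReal_deriv (f := fun r => transition (ε / 4) (r - 3 * ε / 4) ^ 2 / 2) hℓ.le]
  · apply ENNReal.ofReal_le_ofReal
    have h1 := transition_le_one (ε / 4) (ℓ - 3 * ε / 4)
    have h0 := transition_nonneg (ε / 4) (ℓ - 3 * ε / 4)
    nlinarith [sq_nonneg (transition (ε / 4) (0 - 3 * ε / 4))]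
  · intro x
    have := ((contDiff_radialProfile ε).differentiable one_ne_zero x).hasDerivAt
    convert! (this.pow 2).div_const 2 using 1
    simp; ring
  · exact (contDiff_radialProfile ε).continuous.mul
      ((contDiff_radialProfile ε).continuous_deriv le_rfl)
  · exact fun x _ => mul_nonneg (transition_nonneg _ _) (deriv_radialProfile_nonneg hε x)

lemma ofReal_mul_gradNorm_recovery_le (hε : 0 < ε) (hε' : ε ≤ 1 / 2) (hα : ‖α‖ = 1) (hβ : ‖β‖ = 1)
    (hγ : ‖γ‖ = 1) {D : ℝ} (h1 : ‖α - γ‖ = D) (h2 : ‖β - α‖ = D) (h3 : ‖γ - β‖ = D)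
    (hr : 0 < r)
    (hθ : θ ∈ Ioo (θ₀ + 2 * Real.pi / 3 - Real.pi) (θ₀ + 2 * Real.pi / 3 + Real.pi)) :
    r * gradNorm (recovery ε θ₀ α β γ) (pol r θ) ≤
      r * deriv (fun r => transition (ε / 4) (r - 3 * ε / 4)) r +
        D * deriv (transitionSum ε θ₀) θ := by
  have hd := (contDiff_recovery hε hε' θ₀ α β γ).differentiable one_ne_zero (pol r θ)
  have e1 := fderiv_polarMap_left hd ((contDiff_radialProfile ε).differentiable one_ne_zero r) hr hθ
  have e2 := fderiv_polarMap_right hd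
    ((contDiff_smoothLoop ε θ₀ α β γ).differentiable one_ne_zero θ) hr hθ
  have hb := gradNorm_le (recovery ε θ₀ α β γ) (pol r θ) θ
  have e2' := congrArg norm e2
  have e1' := congrArg norm e1
  rw [norm_smul, norm_smul, Real.norm_of_nonneg hr.le,
    Real.norm_of_nonneg (transition_nonneg _ _)] at e2'
  rw [norm_smul, Real.norm_of_nonneg (deriv_radialProfile_nonneg hε r)] at e1'
  change ‖fderiv ℝ (recovery ε θ₀ α β γ) (pol r θ) (pol 1 θ)‖ = _ at e1'
  change r * ‖fderiv ℝ (recovery ε θ₀ α β γ) (pol r θ) (angDir θ)‖ = _ at e2'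
  have b1 := mul_le_of_le_one_right (deriv_radialProfile_nonneg hε r)
    (norm_smoothLoop_le hε hα hβ hγ θ₀ θ)
  have b2 := mul_le_of_le_one_left (norm_nonneg (deriv (smoothLoop ε θ₀ α β γ) θ))
    (transition_le_one (ε / 4) (r - 3 * ε / 4))
  have b3 := norm_deriv_smoothLoop_le hε h1 h2 h3 θ₀ θ
  calc r * gradNorm (recovery ε θ₀ α β γ) (pol r θ) ≤ _ := mul_le_mul_of_nonneg_left hb hr.le
    _ = r * ‖fderiv ℝ (recovery ε θ₀ α β γ) (pol r θ) (pol 1 θ)‖ +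
      r * ‖fderiv ℝ (recovery ε θ₀ α β γ) (pol r θ) (angDir θ)‖ := by ring
    _ ≤ _ := by
      rw [e2']
      apply add_le_add
      · apply mul_le_mul_of_nonneg_left _ hr.le
        rw [e1']; exact b1
      · linarith

/-- In polar coordinates `r det ∇v = cross (∂_r v) (∂_θ v)`, here with `∂_r v = ψ' P` and `∂_θ v = ψ
P'`. -/
lemma mul_abs_det_recovery_eq (hε : 0 < ε) (hε' : ε ≤ 1 / 2) (hsum : α + β + γ = 0) (hr : 0 < r)
    (hθ : θ ∈ Ioo (θ₀ + 2 * Real.pi / 3 - Real.pi) (θ₀ + 2 * Real.pi / 3 + Real.pi)) :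
    r * |(grad (recovery ε θ₀ α β γ) (pol r θ)).det| =
      (transition (ε / 4) (r - 3 * ε / 4) *
        deriv (fun r => transition (ε / 4) (r - 3 * ε / 4)) r) *
        (|cross α β| * deriv (transitionSum ε θ₀) θ) := by
  have hd := (contDiff_recovery hε hε' θ₀ α β γ).differentiable one_ne_zero (pol r θ)
  have e1 := fderiv_polarMap_left hd ((contDiff_radialProfile ε).differentiable one_ne_zero r) hr hθ
  have e2 := fderiv_polarMap_right hd
    ((contDiff_smoothLoop ε θ₀ α β γ).differentiable one_ne_zero θ) hr hθ
  change fderiv ℝ (recovery ε θ₀ α β γ) (pol r θ) (pol 1 θ) = _ at e1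
  change r • fderiv ℝ (recovery ε θ₀ α β γ) (pol r θ) (angDir θ) = _ at e2
  have e : r * (grad (recovery ε θ₀ α β γ) (pol r θ)).det =
      (transition (ε / 4) (r - 3 * ε / 4) *
        deriv (fun r => transition (ε / 4) (r - 3 * ε / 4)) r) *
        (deriv (transitionSum ε θ₀) θ * cross α β) := by
    rw [det_grad_eq _ _ θ, ← cross_smul_right, e1, e2, cross_smul_left, cross_smul_right,
      cross_smoothLoop_deriv hε hε' hsum]
    ring
  rw [← abs_of_pos hr, ← abs_mul, abs_of_pos hr, e, abs_mul, abs_mul, abs_mul,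
    abs_of_nonneg (transition_nonneg _ _), abs_of_nonneg (deriv_radialProfile_nonneg hε r),
    abs_of_nonneg (deriv_transitionSum_nonneg hε θ₀ θ)]
  ring

end TripleJunction

/-! ### Integral estimates and `L¹` convergence of the recovery maps. -/

namespace TripleJunction

variable {ε ℓ θ₀ : ℝ} {α β γ : Plane} {u : Plane → Plane}

lemma lintegral_prod_restrict_mul {s t : Set ℝ} {f g : ℝ → ENNReal} (hf : Measurable f)
    (hg : Measurable g) :
    ∫⁻ p in s ×ˢ t, f p.1 * g p.2 = (∫⁻ x in s, f x) * ∫⁻ y in t, g y := by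
  rw [Measure.volume_eq_prod, ← Measure.prod_restrict,
    lintegral_prod_mul hf.aemeasurable hg.aemeasurable]

/-- The term `D * (3 * ℓ)` is the angular part, three jumps of size `D` on each circle; `2πε` bounds
the radial part. -/
lemma lintegral_gradNorm_recovery_le (hε : 0 < ε) (hε' : ε ≤ 1 / 2) (hℓ : 0 < ℓ) (hα : ‖α‖ = 1)
    (hβ : ‖β‖ = 1) (hγ : ‖γ‖ = 1) {D : ℝ} (h1 : ‖α - γ‖ = D) (h2 : ‖β - α‖ = D)
    (h3 : ‖γ - β‖ = D) :
    ∫⁻ x in Metric.ball 0 ℓ, ENNReal.ofReal (gradNorm (recovery ε θ₀ α β γ) x) ≤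
      ENNReal.ofReal (D * (3 * ℓ) + 2 * Real.pi * ε) := by
  have hD : 0 ≤ D := h1 ▸ norm_nonneg _
  have hpi := Real.pi_pos
  set c := θ₀ + 2 * Real.pi / 3 with hc
  have hm1 : Measurable fun r : ℝ => ENNReal.ofReal
      (r * deriv (fun r => transition (ε / 4) (r - 3 * ε / 4)) r) :=
    (measurable_id.mul (measurable_deriv _)).ennreal_ofReal
  have hm2 : Measurable fun θ : ℝ => ENNReal.ofReal (deriv (transitionSum ε θ₀) θ) :=
    (measurable_deriv _).ennreal_ofReal
  rw [lintegral_ball_polar c]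
  calc ∫⁻ p in Ioo 0 ℓ ×ˢ Ioo (c - Real.pi) (c + Real.pi), ENNReal.ofReal p.1 *
        ENNReal.ofReal (gradNorm (recovery ε θ₀ α β γ) (pol p.1 p.2))
      ≤ ∫⁻ p in Ioo 0 ℓ ×ˢ Ioo (c - Real.pi) (c + Real.pi),
        (ENNReal.ofReal (p.1 * deriv (fun r => transition (ε / 4) (r - 3 * ε / 4)) p.1) *
          (fun _ => 1) p.2 + (fun _ => ENNReal.ofReal D) p.1 *
          ENNReal.ofReal (deriv (transitionSum ε θ₀) p.2)) := by
        apply setLIntegral_mono' (measurableSet_Ioo.prod measurableSet_Ioo)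
        rintro ⟨r, θ⟩ ⟨hr, hθ⟩
        simp only at hr hθ ⊢
        rw [mul_one, ← ENNReal.ofReal_mul hr.1.le, ← ENNReal.ofReal_mul hD, ← ENNReal.ofReal_add
          (mul_nonneg hr.1.le (deriv_radialProfile_nonneg hε r))
          (mul_nonneg hD (deriv_transitionSum_nonneg hε θ₀ θ))]
        exact ENNReal.ofReal_le_ofReal
          (ofReal_mul_gradNorm_recovery_le hε hε' hα hβ hγ h1 h2 h3 hr.1 hθ)
    _ = (∫⁻ r in Ioo 0 ℓ, ENNReal.ofReal
          (r * deriv (fun r => transition (ε / 4) (r - 3 * ε / 4)) r)) *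
          ENNReal.ofReal (2 * Real.pi) + (ENNReal.ofReal D * ENNReal.ofReal ℓ) *
          ∫⁻ θ in Ioo (c - Real.pi) (c + Real.pi),
            ENNReal.ofReal (deriv (transitionSum ε θ₀) θ) := by
        rw [lintegral_add_left (by
            exact (hm1.comp measurable_fst).mul measurable_const),
          lintegral_prod_restrict_mul hm1 measurable_const,
          lintegral_prod_restrict_mul measurable_const hm2]
        congr 2
        · rw [setLIntegral_const, one_mul, Real.volume_Ioo]; congr 1; ring
        · rw [setLIntegral_const, Real.volume_Ioo, sub_zero]
    _ ≤ ENNReal.ofReal ε * ENNReal.ofReal (2 * Real.pi) +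
        (ENNReal.ofReal D * ENNReal.ofReal ℓ) * ENNReal.ofReal 3 := by
        gcongr
        · exact lintegral_mul_deriv_radialProfile_le hε hℓ
        · exact lintegral_deriv_transitionSum_le hε θ₀
    _ = _ := by
        rw [← ENNReal.ofReal_mul hε.le, ← ENNReal.ofReal_mul hD,
          ← ENNReal.ofReal_mul (by positivity), ← ENNReal.ofReal_add (by positivity)
          (by positivity)]
        congr 1; ring

lemma lintegral_abs_det_recovery_le (hε : 0 < ε) (hε' : ε ≤ 1 / 2) (hℓ : 0 < ℓ)
    (hsum : α + β + γ = 0) :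
    ∫⁻ x in Metric.ball 0 ℓ, ENNReal.ofReal |(grad (recovery ε θ₀ α β γ) x).det| ≤
      ENNReal.ofReal (3 / 2 * |cross α β|) := by
  set c := θ₀ + 2 * Real.pi / 3 with hc
  have hm1 : Measurable fun r : ℝ => ENNReal.ofReal (transition (ε / 4) (r - 3 * ε / 4) *
      deriv (fun r => transition (ε / 4) (r - 3 * ε / 4)) r) :=
    ((contDiff_radialProfile ε).continuous.measurable.mul (measurable_deriv _)).ennreal_ofReal
  have hm2 : Measurable fun θ : ℝ => ENNReal.ofReal (|cross α β| * deriv (transitionSum ε θ₀) θ) :=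
    (measurable_const.mul (measurable_deriv _)).ennreal_ofReal
  rw [lintegral_ball_polar c]
  calc ∫⁻ p in Ioo 0 ℓ ×ˢ Ioo (c - Real.pi) (c + Real.pi), ENNReal.ofReal p.1 *
        ENNReal.ofReal |(grad (recovery ε θ₀ α β γ) (pol p.1 p.2)).det|
      = ∫⁻ p in Ioo 0 ℓ ×ˢ Ioo (c - Real.pi) (c + Real.pi),
        ENNReal.ofReal (transition (ε / 4) (p.1 - 3 * ε / 4) *
          deriv (fun r => transition (ε / 4) (r - 3 * ε / 4)) p.1) *
        ENNReal.ofReal (|cross α β| * deriv (transitionSum ε θ₀) p.2) := by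
        apply setLIntegral_congr_fun (measurableSet_Ioo.prod measurableSet_Ioo)
        rintro ⟨r, θ⟩ ⟨hr, hθ⟩
        simp only at hr hθ ⊢
        rw [← ENNReal.ofReal_mul hr.1.le, mul_abs_det_recovery_eq hε hε' hsum hr.1 hθ,
          ENNReal.ofReal_mul (mul_nonneg (transition_nonneg _ _) (deriv_radialProfile_nonneg hε r))]
    _ ≤ ENNReal.ofReal (1 / 2) * (ENNReal.ofReal |cross α β| * ENNReal.ofReal 3) := by
        rw [lintegral_prod_restrict_mul hm1 hm2]
        gcongr
        · exact lintegral_radialProfile_mul_deriv_le hε hℓ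
        · simp_rw [ENNReal.ofReal_mul (abs_nonneg (cross α β))]
          rw [lintegral_const_mul' _ _ ENNReal.ofReal_ne_top]
          gcongr
          exact lintegral_deriv_transitionSum_le hε θ₀
    _ = _ := by
        rw [← ENNReal.ofReal_mul (abs_nonneg _), ← ENNReal.ofReal_mul (by norm_num)]
        congr 1; ring

lemma measurable_grad (v : Plane → Plane) (i j : Fin 2) : Measurable fun x => grad v x i j :=
  (EuclideanSpace.proj i : Plane →L[ℝ] ℝ).measurable.comp
    (measurable_fderiv_apply_const ℝ v (EuclideanSpace.single j 1))

lemma measurable_gradNorm (v : Plane → Plane) : Measurable (gradNorm v) := by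
  unfold gradNorm
  exact (Finset.measurable_fun_sum _ fun i _ => Finset.measurable_fun_sum _ fun j _ =>
    (measurable_grad v i j).pow_const 2).sqrt

lemma measurable_det_grad (v : Plane → Plane) : Measurable fun x => (grad v x).det := by
  simp_rw [Matrix.det_fin_two]
  exact ((measurable_grad v 0 0).mul (measurable_grad v 1 1)).sub
    ((measurable_grad v 0 1).mul (measurable_grad v 1 0))

/-- `√(1 + a² + b²) ≤ 1 + a + b`. Nothing is lost in the limit, as the three terms concentrate on
different regions for the recovery maps. -/
lemma area_le (v : Plane → Plane) (Ω : Set Plane) :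
    area v Ω ≤ volume Ω + (∫⁻ x in Ω, ENNReal.ofReal (gradNorm v x)) +
      ∫⁻ x in Ω, ENNReal.ofReal |(grad v x).det| := by
  have h1 : volume Ω = ∫⁻ _ in Ω, ENNReal.ofReal 1 := by simp
  rw [h1, ← lintegral_add_left measurable_const,
    ← lintegral_add_left (by
      exact measurable_const.add (measurable_gradNorm v).ennreal_ofReal)]
  refine lintegral_mono fun x => ?_
  have hg := gradNorm_nonneg v x
  rw [← ENNReal.ofReal_add zero_le_one hg, ← ENNReal.ofReal_add (by linarith) (abs_nonneg _)]
  apply ENNReal.ofReal_le_ofReal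
  apply Real.sqrt_le_iff.2 ⟨by positivity, _⟩
  rw [← gradNorm_sq, ← sq_abs (grad v x).det]
  nlinarith [abs_nonneg (grad v x).det, mul_nonneg hg (abs_nonneg (grad v x).det)]

/-- A point off the interfaces eventually lies outside the transition windows and outside the core
where the radial profile is below `1`; from then on the values agree exactly. -/
lemma IsJunctionAt.ae_eventually_recovery_eq (h : IsJunctionAt u ℓ θ₀ α β γ) {s : ℕ → ℝ}
    (hs : ∀ k, s k ∈ Ioc (0 : ℝ) (1 / 2)) (hs0 : Tendsto s atTop (𝓝 0)) :
    ∀ᵐ x ∂volume.restrict (Metric.ball 0 ℓ), ∀ᶠ k in atTop, recovery (s k) θ₀ α β γ x = u x := by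
  have hnull : ∀ᵐ x : Plane, x ∉ insert 0 (interfaces ℓ θ₀) :=
    measure_eq_zero_iff_ae_notMem.1 (volume_interfaces ℓ θ₀)
  filter_upwards [ae_restrict_of_ae hnull, ae_restrict_mem Metric.isOpen_ball.measurableSet]
    with x hx hxb
  simp only [mem_insert_iff, not_or] at hx
  have hu := (h.eventually_eq_of_notMem hxb hx.1 hx.2).self_of_nhds
  have hr : ‖x‖ ∈ Ioo 0 ℓ := ⟨norm_pos_iff.2 hx.1, by simpa using hxb⟩
  have hne : ∀ θ ∈ interfaceAngles θ₀, 0 < |ang (θ₀ + 2 * Real.pi / 3) x - θ| := by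
    intro θ hθ
    rw [abs_pos, sub_ne_zero]
    rintro rfl
    apply hx.2
    simp only [interfaces, mem_iUnion]
    exact ⟨_, hθ, ‖x‖, hr, pol_ang _ x⟩
  have hev : ∀ b > 0, ∀ᶠ k in atTop, s k ≤ b := fun b hb =>
    (hs0.eventually (gt_mem_nhds hb)).mono fun k hk => hk.le
  filter_upwards [hev _ hr.1, hev _ (hne θ₀ (by simp [interfaceAngles])),
    hev _ (hne (θ₀ + 2 * Real.pi / 3) (by simp [interfaceAngles])),
    hev _ (hne (θ₀ + 4 * Real.pi / 3) (by simp [interfaceAngles]))] with k k0 k1 k2 k3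
  rw [hu, recovery, polarMap, smoothLoop_eq_stepMap (hs k).1 (hs k).2 k1 k2 k3,
    transition_of_ge (by linarith [(hs k).1]) (by linarith), one_smul]

/-- A sequence of parameters for the recovery maps. -/
noncomputable def recoveryScale (k : ℕ) : ℝ := 1 / ((k : ℝ) + 2)

lemma recoveryScale_mem (k : ℕ) : recoveryScale k ∈ Ioc (0 : ℝ) (1 / 2) :=
  ⟨by unfold recoveryScale; positivity,
    one_div_le_one_div_of_le (by norm_num) (by linarith [k.cast_nonneg (α := ℝ)])⟩

lemma tendsto_recoveryScale : Tendsto recoveryScale atTop (𝓝 0) := by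
  unfold recoveryScale
  simp_rw [one_div]
  exact tendsto_inv_atTop_zero.comp
    (tendsto_atTop_add_const_right _ _ tendsto_natCast_atTop_atTop)

/-- On the interfaces `u` is arbitrary, so measurability is obtained only almost everywhere, as that
of a limit of continuous maps. -/
lemma IsJunctionAt.aestronglyMeasurable (h : IsJunctionAt u ℓ θ₀ α β γ) :
    AEStronglyMeasurable u (volume.restrict (Metric.ball 0 ℓ)) := by
  have hs := recoveryScale_mem
  refine aestronglyMeasurable_of_tendsto_ae atTop
    (f := fun k => recovery (recoveryScale k) θ₀ α β γ) (fun k => ?_) ?_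
  · exact (contDiff_recovery (hs k).1 (hs k).2 θ₀ α β γ).continuous.aestronglyMeasurable
  · filter_upwards [h.ae_eventually_recovery_eq hs tendsto_recoveryScale] with x hx
    exact tendsto_const_nhds.congr' (hx.mono fun k hk => hk.symm)

lemma IsJunctionAt.tendsto_lintegral_recovery_sub (h : IsJunctionAt u ℓ θ₀ α β γ) {s : ℕ → ℝ}
    (hα : ‖α‖ = 1) (hβ : ‖β‖ = 1) (hγ : ‖γ‖ = 1)
    (hval : ∀ x ∈ Metric.ball (0 : Plane) ℓ, u x = α ∨ u x = β ∨ u x = γ)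
    (hs : ∀ k, s k ∈ Ioc (0 : ℝ) (1 / 2)) (hs0 : Tendsto s atTop (𝓝 0)) :
    Tendsto (fun k => ∫⁻ x in Metric.ball 0 ℓ, ‖recovery (s k) θ₀ α β γ x - u x‖ₑ)
      atTop (𝓝 0) := by
  have hlim := tendsto_lintegral_of_dominated_convergence'
    (μ := volume.restrict (Metric.ball (0 : Plane) ℓ))
    (F := fun k x => ‖recovery (s k) θ₀ α β γ x - u x‖ₑ) (f := fun _ => 0) (fun _ => 2)
    (fun k => ?_) (fun k => ?_) ?_ ?_
  · simpa using hlim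
  · exact ((contDiff_recovery (hs k).1 (hs k).2 θ₀ α β γ).continuous.aestronglyMeasurable.sub
      h.aestronglyMeasurable).enorm
  · filter_upwards [ae_restrict_mem Metric.isOpen_ball.measurableSet] with x hx
    have hux : ‖u x‖ ≤ 1 := by rcases hval x hx with e | e | e <;> rw [e] <;> linarith
    have := norm_sub_le (recovery (s k) θ₀ α β γ x) (u x)
    have h1 := norm_recovery_le (hs k).1 hα hβ hγ θ₀ x
    rw [← ofReal_norm]
    refine (ENNReal.ofReal_le_ofReal (by linarith : _ ≤ (2 : ℝ))).trans ?_
    simp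
  · rw [setLIntegral_const]
    exact ENNReal.mul_ne_top (by simp) measure_ball_lt_top.ne
  · filter_upwards [h.ae_eventually_recovery_eq hs hs0] with x hx
    exact tendsto_const_nhds.congr' (hx.mono fun k hk => by simp [hk])

end TripleJunction

/-! ### Lower semicontinuity of the total variation, and pairing the step map with derivatives. -/

namespace TripleJunction

variable {ε ℓ θ₀ : ℝ} {α β γ : Plane} {u : Plane → Plane}

lemma continuous_divergence {φ : Plane → Plane} (hφ : ContDiff ℝ 1 φ) :
    Continuous (divergence φ) := by
  unfold divergence
  refine continuous_finsetSum _ fun j _ => ?_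
  exact (EuclideanSpace.proj j : Plane →L[ℝ] ℝ).continuous.comp
    ((hφ.continuous_fderiv one_ne_zero).clm_apply continuous_const)

lemma exists_bound_divergence {φ : Plane → Plane} (hφ : ContDiff ℝ 1 φ)
    (hc : HasCompactSupport φ) : ∃ C, ∀ x, ‖divergence φ x‖ ≤ C := by
  apply (continuous_divergence hφ).bounded_above_of_compact_support
  apply hc.mono'
  intro x hx
  by_contra h
  apply hx
  simp [divergence, fderiv_of_notMem_tsupport (𝕜 := ℝ) h]

lemma integrable_coord_mul_divergence {Ω : Set Plane} (hu : IntegrableOn u Ω)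
    {φ : Plane → Plane} (hφ : ContDiff ℝ 1 φ) (hc : HasCompactSupport φ) (i : Fin 2) :
    Integrable (fun x => u x i * divergence φ x) (volume.restrict Ω) := by
  obtain ⟨C, hC⟩ := exists_bound_divergence hφ hc
  have hi : Integrable (fun x => u x i) (volume.restrict Ω) :=
    (EuclideanSpace.proj i : Plane →L[ℝ] ℝ).integrable_comp hu
  exact hi.mul_bdd (c := C) (continuous_divergence hφ).aestronglyMeasurable (ae_of_all _ hC)

lemma tendsto_sum_integral_divergence {Ω : Set Plane} {w : ℕ → Plane → Plane}
    (hu : IntegrableOn u Ω) (hw : ∀ k, IntegrableOn (w k) Ω)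
    (hlim : Tendsto (fun k => ∫⁻ x in Ω, ‖w k x - u x‖ₑ) atTop (𝓝 0)) {φ : Fin 2 → Plane → Plane}
    (hφ : IsTestField Ω φ) :
    Tendsto (fun k => ∑ i, ∫ x in Ω, w k x i * divergence (φ i) x) atTop
      (𝓝 (∑ i, ∫ x in Ω, u x i * divergence (φ i) x)) := by
  refine tendsto_finsetSum _ fun i _ => ?_
  obtain ⟨C, hC⟩ := exists_bound_divergence (hφ.1 i).1 (hφ.1 i).2.1
  have hC0 : 0 ≤ C := (norm_nonneg _).trans (hC 0)
  apply tendsto_integral_of_L1 _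
    (integrable_coord_mul_divergence hu (hφ.1 i).1 (hφ.1 i).2.1 i).aestronglyMeasurable
    (Eventually.of_forall fun k =>
      integrable_coord_mul_divergence (hw k) (hφ.1 i).1 (hφ.1 i).2.1 i)
  have hlim' : Tendsto (fun k => ENNReal.ofReal C * ∫⁻ x in Ω, ‖w k x - u x‖ₑ) atTop (𝓝 0) := by
    simpa using ENNReal.Tendsto.const_mul hlim (Or.inr ENNReal.ofReal_ne_top)
  refine tendsto_of_tendsto_of_tendsto_of_le_of_le tendsto_const_nhds hlim'
    (fun _ => zero_le) fun k => ?_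
  rw [← lintegral_const_mul' _ _ ENNReal.ofReal_ne_top]
  refine lintegral_mono fun x => ?_
  rw [← sub_mul, enorm_mul, mul_comm]
  gcongr
  · rw [← ofReal_norm]; exact ENNReal.ofReal_le_ofReal (hC x)
  · rw [← ofReal_norm, ← ofReal_norm]
    exact ENNReal.ofReal_le_ofReal (PiLp.norm_apply_le (w k x - u x) i)

/-- Lower semicontinuity of the total variation. -/
lemma totalVariation_le_of_tendsto {Ω : Set Plane} {w : ℕ → Plane → Plane}
    (hu : IntegrableOn u Ω) (hw : ∀ k, IntegrableOn (w k) Ω)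
    (hlim : Tendsto (fun k => ∫⁻ x in Ω, ‖w k x - u x‖ₑ) atTop (𝓝 0)) :
    totalVariation u Ω ≤ liminf (fun k => totalVariation (w k) Ω) atTop := by
  refine iSup₂_le fun φ hφ => ?_
  have h := (ENNReal.continuous_ofReal.tendsto _).comp
    (tendsto_sum_integral_divergence hu hw hlim hφ)
  rw [← h.liminf_eq]
  exact liminf_le_liminf (Eventually.of_forall fun k =>
    le_iSup₂_of_le (f := fun (φ : Fin 2 → Plane → Plane) (_ : IsTestField Ω φ) =>
      ENNReal.ofReal (∑ i, ∫ x in Ω, w k x i * divergence (φ i) x)) φ hφ le_rfl)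

lemma measurable_pol : Measurable fun p : ℝ × ℝ => pol p.1 p.2 :=
  (contDiff_pol (n := 0)).continuous.measurable

lemma integral_ball_polar (c ℓ : ℝ) {f : Plane → ℝ}
    (hf : AEStronglyMeasurable f (volume.restrict (Metric.ball 0 ℓ))) :
    ∫ x in Metric.ball 0 ℓ, f x =
      ∫ p in Ioo 0 ℓ ×ˢ Ioo (c - Real.pi) (c + Real.pi), p.1 * f (pol p.1 p.2) := by
  set μ := (volume.restrict (Ioo 0 ℓ ×ˢ Ioo (c - Real.pi) (c + Real.pi))).withDensity
    (fun p : ℝ × ℝ => ENNReal.ofReal p.1) with hμ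
  -- Tested on indicators, the formula for `lintegral` identifies Lebesgue measure on the disk as
  -- the image of `r dr dθ`; signed integrands follow.
  have hmap : volume.restrict (Metric.ball (0 : Plane) ℓ) =
      μ.map (fun p : ℝ × ℝ => pol p.1 p.2) := by
    ext s hs
    have h := lintegral_ball_polar c ℓ (s.indicator 1)
    rw [lintegral_indicator_one hs] at h
    rw [h, Measure.map_apply measurable_pol hs, hμ, withDensity_apply _ (measurable_pol hs),
      ← lintegral_indicator (measurable_pol hs)]
    refine lintegral_congr fun p => ?_
    by_cases hp : pol p.1 p.2 ∈ s
    · rw [indicator_of_mem hp, indicator_of_mem (by exact hp)]; simp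
    · rw [indicator_of_notMem hp, indicator_of_notMem (by exact hp)]; simp
  rw [hmap] at hf ⊢
  rw [integral_map measurable_pol.aemeasurable hf, hμ,
    integral_withDensity_eq_integral_toReal_smul (by fun_prop)
    (ae_of_all _ fun _ => ENNReal.ofReal_lt_top)]
  apply setIntegral_congr_fun (measurableSet_Ioo.prod measurableSet_Ioo)
  rintro ⟨r, θ⟩ ⟨hr, -⟩
  simp only at hr ⊢
  rw [ENNReal.toReal_ofReal hr.1.le, smul_eq_mul]

lemma intervalIntegral_piecewise {U g g' : ℝ → ℝ} {a b q : ℝ} (hab : a ≤ b)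
    (hU : ∀ t ∈ Ioo a b, U t = q) (hg : ∀ t, HasDerivAt g (g' t) t) (hc : Continuous g') :
    IntervalIntegrable (fun t => U t * g' t) volume a b ∧
      ∫ t in a..b, U t * g' t = q * (g b - g a) := by
  have hae : (fun t => q * g' t) =ᵐ[volume.restrict (uIoc a b)] fun t => U t * g' t := by
    rw [uIoc_of_le hab, ← Measure.restrict_congr_set Ioo_ae_eq_Ioc]
    filter_upwards [ae_restrict_mem measurableSet_Ioo] with t ht
    rw [hU t ht]
  have hi : IntervalIntegrable (fun t => q * g' t) volume a b :=
    (continuous_const.mul hc).intervalIntegrable _ _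
  refine ⟨hi.congr_ae hae, ?_⟩
  rw [← intervalIntegral.integral_congr_ae_restrict hae, intervalIntegral.integral_const_mul,
    intervalIntegral.integral_eq_sub_of_hasDerivAt (fun x _ => hg x) (hc.intervalIntegrable _ _)]

/-- The distributional derivative of the step map is the sum of its jumps at the interface angles.
The vanishing of `g` at both ends removes the boundary terms. -/
lemma integral_stepMap_mul_deriv {g g' : ℝ → ℝ} (hg : ∀ t, HasDerivAt g (g' t) t)
    (hc : Continuous g') (hl : g (θ₀ + 2 * Real.pi / 3 - Real.pi) = 0)
    (hr : g (θ₀ + 2 * Real.pi / 3 + Real.pi) = 0) (i : Fin 2) :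
    ∫ θ in Ioo (θ₀ + 2 * Real.pi / 3 - Real.pi) (θ₀ + 2 * Real.pi / 3 + Real.pi),
      stepMap θ₀ α β γ θ i * g' θ =
    -((α - γ) i * g θ₀ + (β - α) i * g (θ₀ + 2 * Real.pi / 3) +
      (γ - β) i * g (θ₀ + 4 * Real.pi / 3)) := by
  have hpi := Real.pi_pos
  rw [← integral_Ioc_eq_integral_Ioo, ← intervalIntegral.integral_of_le (by linarith)]
  obtain ⟨i1, e1⟩ := intervalIntegral_piecewise (U := fun θ => stepMap θ₀ α β γ θ i)
    (a := θ₀ + 2 * Real.pi / 3 - Real.pi) (b := θ₀) (q := γ i) (by linarith)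
    (by intro t ht; simp only [stepMap]; rw [if_pos ht.2]) hg hc
  obtain ⟨i2, e2⟩ := intervalIntegral_piecewise (U := fun θ => stepMap θ₀ α β γ θ i)
    (a := θ₀) (b := θ₀ + 2 * Real.pi / 3) (q := α i) (by linarith)
    (by intro t ht; simp only [stepMap]; rw [if_neg (by linarith [ht.1]), if_pos ht.2]) hg hc
  obtain ⟨i3, e3⟩ := intervalIntegral_piecewise (U := fun θ => stepMap θ₀ α β γ θ i)
    (a := θ₀ + 2 * Real.pi / 3) (b := θ₀ + 4 * Real.pi / 3) (q := β i) (by linarith)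
    (by intro t ht; simp only [stepMap]
        rw [if_neg (by linarith [ht.1]), if_neg (by linarith [ht.1]), if_pos ht.2]) hg hc
  obtain ⟨i4, e4⟩ := intervalIntegral_piecewise (U := fun θ => stepMap θ₀ α β γ θ i)
    (a := θ₀ + 4 * Real.pi / 3) (b := θ₀ + 2 * Real.pi / 3 + Real.pi) (q := γ i) (by linarith)
    (by intro t ht; simp only [stepMap]
        rw [if_neg (by linarith [ht.1]), if_neg (by linarith [ht.1]),
          if_neg (by linarith [ht.1])]) hg hc
  rw [← intervalIntegral.integral_add_adjacent_intervals ((i1.trans i2).trans i3) i4,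
    ← intervalIntegral.integral_add_adjacent_intervals (i1.trans i2) i3,
    ← intervalIntegral.integral_add_adjacent_intervals i1 i2, e1, e2, e3, e4, hl, hr]
  simp only [PiLp.sub_apply]
  ring

end TripleJunction

/-! ### Ingredients of the calibrating test field. -/

namespace TripleJunction

variable {ε ℓ θ₀ η : ℝ} {α β γ : Plane} {u : Plane → Plane}

/-- Rotation by a right angle. -/
noncomputable def perp : Plane →L[ℝ] Plane :=
  LinearMap.toContinuousLinearMap
    { toFun := fun x => !₂[-x 1, x 0]
      map_add' := fun x y => by apply plane_ext <;> simp; ring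
      map_smul' := fun t x => by apply plane_ext <;> simp }

@[simp] lemma perp_apply_zero (x : Plane) : perp x 0 = -x 1 := rfl
@[simp] lemma perp_apply_one (x : Plane) : perp x 1 = x 0 := rfl

lemma perp_pol (r θ : ℝ) : perp (pol r θ) = r • angDir θ := by
  apply plane_ext <;> simp

lemma norm_perp (x : Plane) : ‖perp x‖ = ‖x‖ := by
  rw [← abs_norm, ← abs_norm x, ← sq_eq_sq_iff_abs_eq_abs, norm_sq_eq, norm_sq_eq]
  simp; ring

/-- The rotation field `perp` is divergence free, so only the derivative of the scalar factor along
it survives. -/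
lemma divergence_smul_perp {K : Plane → ℝ} {x : Plane} (hK : DifferentiableAt ℝ K x) :
    divergence (fun y => K y • perp y) x = fderiv ℝ K x (perp x) := by
  have hd : ∀ w, fderiv ℝ (fun y => K y • perp y) x w = K x • perp w + fderiv ℝ K x w • perp x := by
    intro w
    rw [fderiv_fun_smul hK perp.differentiableAt]
    simp
  have hx : perp x = (-x 1) • EuclideanSpace.single 0 (1 : ℝ) +
      x 0 • EuclideanSpace.single 1 (1 : ℝ) := by
    apply plane_ext <;> simp
  rw [divergence, Fin.sum_univ_two, hd, hd]
  conv_rhs => rw [hx, map_add, map_smul, map_smul]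
  simp
  ring

/-- A radial cutoff supported in `[η, ℓ - η]`, equal to `1` on `[3η, ℓ - 3η]`. -/
noncomputable def radialCutoff (η ℓ r : ℝ) : ℝ :=
  transition η (r - 2 * η) * transition η (ℓ - 2 * η - r)

lemma radialCutoff_nonneg (η ℓ r : ℝ) : 0 ≤ radialCutoff η ℓ r :=
  mul_nonneg (transition_nonneg _ _) (transition_nonneg _ _)

lemma radialCutoff_le_one (η ℓ r : ℝ) : radialCutoff η ℓ r ≤ 1 :=
  mul_le_one₀ (transition_le_one _ _) (transition_nonneg _ _) (transition_le_one _ _)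

lemma contDiff_radialCutoff (η ℓ : ℝ) : ContDiff ℝ 1 (radialCutoff η ℓ) := by
  unfold radialCutoff; fun_prop

lemma radialCutoff_eq_zero_of_le {r : ℝ} (hη : 0 < η) (hr : r ≤ η) : radialCutoff η ℓ r = 0 := by
  rw [radialCutoff, transition_of_le hη (by linarith), zero_mul]

lemma radialCutoff_eq_zero_of_ge {r : ℝ} (hη : 0 < η) (hr : ℓ - η ≤ r) :
    radialCutoff η ℓ r = 0 := by
  rw [radialCutoff, transition_of_le hη (by linarith : ℓ - 2 * η - r ≤ -η), mul_zero]

lemma radialCutoff_eq_one {r : ℝ} (hη : 0 < η) (h1 : 3 * η ≤ r) (h2 : r ≤ ℓ - 3 * η) :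
    radialCutoff η ℓ r = 1 := by
  rw [radialCutoff, transition_of_ge hη (by linarith), transition_of_ge hη (by linarith), mul_one]

lemma contDiff_radialCutoff_div (hη : 0 < η) (ℓ : ℝ) :
    ContDiff ℝ 1 fun r => radialCutoff η ℓ r / r := by
  rw [contDiff_iff_contDiffAt]
  intro r
  by_cases hr : r = 0
  · have : (fun r => radialCutoff η ℓ r / r) =ᶠ[𝓝 r] fun _ => 0 := by
      filter_upwards [gt_mem_nhds (show r < η by rw [hr]; exact hη)] with s hs
      rw [radialCutoff_eq_zero_of_le hη hs.le, zero_div]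
    exact contDiffAt_const.congr_of_eventuallyEq this
  · exact (contDiff_radialCutoff η ℓ).contDiffAt.div contDiffAt_id hr

/-- A smooth bump supported in `[-3/4, 3/4]` with value `1` at the origin. -/
noncomputable def angularBump (t : ℝ) : ℝ :=
  transition (1 / 4) (t + 1 / 2) * transition (1 / 4) (1 / 2 - t)

@[fun_prop] lemma contDiff_angularBump : ContDiff ℝ 1 angularBump := by
  unfold angularBump; fun_prop

lemma angularBump_zero : angularBump 0 = 1 := by
  rw [angularBump, transition_of_ge (by norm_num) (by norm_num),
    transition_of_ge (by norm_num) (by norm_num), mul_one]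

lemma angularBump_nonneg (t : ℝ) : 0 ≤ angularBump t :=
  mul_nonneg (transition_nonneg _ _) (transition_nonneg _ _)

lemma angularBump_le_one (t : ℝ) : angularBump t ≤ 1 :=
  mul_le_one₀ (transition_le_one _ _) (transition_nonneg _ _) (transition_le_one _ _)

lemma angularBump_eq_zero {t : ℝ} (ht : 3 / 4 ≤ |t|) : angularBump t = 0 := by
  rcases le_abs.1 ht with h | h
  · rw [angularBump, transition_of_le (by norm_num) (by linarith : 1 / 2 - t ≤ -(1 / 4)), mul_zero]
  · rw [angularBump, transition_of_le (by norm_num) (by linarith), zero_mul]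

/-- The angular profile of the calibrating test field, which equals the normalized jump on each
interface. -/
noncomputable def jumpProfile (θ₀ D : ℝ) (α β γ : Plane) (θ : ℝ) : Plane :=
  D⁻¹ • (angularBump (θ - θ₀) • (α - γ) + angularBump (θ - (θ₀ + 2 * Real.pi / 3)) • (β - α) +
    angularBump (θ - (θ₀ + 4 * Real.pi / 3)) • (γ - β))

lemma contDiff_jumpProfile (θ₀ D : ℝ) (α β γ : Plane) :
    ContDiff ℝ 1 (jumpProfile θ₀ D α β γ) := by
  unfold jumpProfile; fun_prop

lemma jumpProfile_left (D : ℝ) {θ : ℝ} (hθ : θ ≤ θ₀ - 3 / 4) : jumpProfile θ₀ D α β γ θ = 0 := by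
  have hpi := Real.pi_pos
  rw [jumpProfile, angularBump_eq_zero (le_abs.2 (Or.inr (by linarith))),
    angularBump_eq_zero (le_abs.2 (Or.inr (by linarith))),
    angularBump_eq_zero (le_abs.2 (Or.inr (by linarith)))]
  simp

lemma jumpProfile_right (D : ℝ) {θ : ℝ} (hθ : θ₀ + 4 * Real.pi / 3 + 3 / 4 ≤ θ) :
    jumpProfile θ₀ D α β γ θ = 0 := by
  have hpi := Real.pi_pos
  rw [jumpProfile, angularBump_eq_zero (le_abs.2 (Or.inl (by linarith))),
    angularBump_eq_zero (le_abs.2 (Or.inl (by linarith))),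
    angularBump_eq_zero (le_abs.2 (Or.inl (by linarith)))]
  simp

/-- The bumps vanish beyond distance `3/4`, while consecutive interface angles are `2π/3 > 2` apart,
so at most one is nonzero. -/
lemma angularBump_sum_le_one (θ₀ θ : ℝ) :
    angularBump (θ - θ₀) + angularBump (θ - (θ₀ + 2 * Real.pi / 3)) +
      angularBump (θ - (θ₀ + 4 * Real.pi / 3)) ≤ 1 := by
  have hpi := Real.pi_gt_three
  have b := angularBump_le_one
  by_cases h1 : θ ≤ θ₀ + 1
  · rw [angularBump_eq_zero (t := θ - (θ₀ + 2 * Real.pi / 3)) (le_abs.2 (Or.inr (by linarith))),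
      angularBump_eq_zero (t := θ - (θ₀ + 4 * Real.pi / 3)) (le_abs.2 (Or.inr (by linarith)))]
    linarith [b (θ - θ₀)]
  rw [angularBump_eq_zero (t := θ - θ₀) (le_abs.2 (Or.inl (by linarith)))]
  by_cases h2 : θ ≤ θ₀ + 2 * Real.pi / 3 + 1
  · rw [angularBump_eq_zero (t := θ - (θ₀ + 4 * Real.pi / 3)) (le_abs.2 (Or.inr (by linarith)))]
    linarith [b (θ - (θ₀ + 2 * Real.pi / 3))]
  · rw [angularBump_eq_zero (t := θ - (θ₀ + 2 * Real.pi / 3)) (le_abs.2 (Or.inl (by linarith)))]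
    linarith [b (θ - (θ₀ + 4 * Real.pi / 3))]

lemma norm_jumpProfile_le {D : ℝ} (hD : 0 < D) (h1 : ‖α - γ‖ = D) (h2 : ‖β - α‖ = D)
    (h3 : ‖γ - β‖ = D) (θ₀ θ : ℝ) : ‖jumpProfile θ₀ D α β γ θ‖ ≤ 1 := by
  rw [jumpProfile, norm_smul, norm_inv, Real.norm_of_nonneg hD.le, inv_mul_le_iff₀ hD, mul_one]
  refine norm_add₃_le.trans ?_
  rw [norm_smul, norm_smul, norm_smul, h1, h2, h3, Real.norm_of_nonneg (angularBump_nonneg _),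
    Real.norm_of_nonneg (angularBump_nonneg _), Real.norm_of_nonneg (angularBump_nonneg _)]
  nlinarith [angularBump_sum_le_one θ₀ θ]

lemma jumpProfile_interfaces (θ₀ D : ℝ) (α β γ : Plane) :
    jumpProfile θ₀ D α β γ θ₀ = D⁻¹ • (α - γ) ∧
    jumpProfile θ₀ D α β γ (θ₀ + 2 * Real.pi / 3) = D⁻¹ • (β - α) ∧
    jumpProfile θ₀ D α β γ (θ₀ + 4 * Real.pi / 3) = D⁻¹ • (γ - β) := by
  have hpi := Real.pi_gt_three
  refine ⟨?_, ?_, ?_⟩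
  · rw [jumpProfile, sub_self, angularBump_zero,
      angularBump_eq_zero (le_abs.2 (Or.inr (by linarith))),
      angularBump_eq_zero (le_abs.2 (Or.inr (by linarith)))]
    simp
  · rw [jumpProfile, sub_self, angularBump_zero,
      angularBump_eq_zero (le_abs.2 (Or.inl (by linarith))),
      angularBump_eq_zero (le_abs.2 (Or.inr (by linarith)))]
    simp
  · rw [jumpProfile, sub_self, angularBump_zero,
      angularBump_eq_zero (le_abs.2 (Or.inl (by linarith))),
      angularBump_eq_zero (le_abs.2 (Or.inl (by linarith)))]
    simp

/-- The scalar factor of the calibrating test field. -/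
noncomputable def calibrationFactor (η ℓ θ₀ D : ℝ) (α β γ : Plane) (i : Fin 2) : Plane → ℝ :=
  polarMap (θ₀ + 2 * Real.pi / 3) (fun r => radialCutoff η ℓ r / r)
    (fun θ => -jumpProfile θ₀ D α β γ θ i)

lemma contDiff_calibrationFactor (hη : 0 < η) (ℓ θ₀ D : ℝ) (α β γ : Plane) (i : Fin 2) :
    ContDiff ℝ 1 (calibrationFactor η ℓ θ₀ D α β γ i) := by
  have hpi := Real.pi_gt_three
  apply contDiff_polarMap (a := η) (κ := 1 / 4) (p := 0) hη (by norm_num)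
    (contDiff_radialCutoff_div hη ℓ) _ (contDiff_euclidean.1 (contDiff_jumpProfile θ₀ D α β γ) i).neg
  · intro θ hθ
    simp [jumpProfile_left D (show θ ≤ θ₀ - 3 / 4 by linarith)]
  · intro θ hθ
    simp [jumpProfile_right D (show θ₀ + 4 * Real.pi / 3 + 3 / 4 ≤ θ by linarith)]
  · intro r hr
    rw [radialCutoff_eq_zero_of_le hη hr.le, zero_div]

end TripleJunction

/-! ### The total variation of the junction map from below, by calibration. -/

namespace TripleJunction

variable {ε ℓ θ₀ η D : ℝ} {α β γ : Plane} {u : Plane → Plane}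

/-- The calibrating test field. -/
noncomputable def calibration (η ℓ θ₀ D : ℝ) (α β γ : Plane) (i : Fin 2) (x : Plane) : Plane :=
  calibrationFactor η ℓ θ₀ D α β γ i x • perp x

/-- The division by `r` in the scalar factor is offset by `|perp x| = |x|`, leaving the Frobenius
norm `radialCutoff * ‖jumpProfile‖ ≤ 1`. -/
lemma isTestField_calibration (hη : 0 < η) (hD : 0 < D) (h1 : ‖α - γ‖ = D) (h2 : ‖β - α‖ = D)
    (h3 : ‖γ - β‖ = D) : IsTestField (Metric.ball 0 ℓ) (calibration η ℓ θ₀ D α β γ) := by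
  have hsupp : ∀ i, tsupport (calibration η ℓ θ₀ D α β γ i) ⊆ Metric.closedBall 0 (ℓ - η) := by
    intro i
    apply closure_minimal _ Metric.isClosed_closedBall
    intro x hx
    by_contra h
    rw [mem_closedBall_zero_iff, not_le] at h
    apply hx
    simp [calibration, calibrationFactor, polarMap, radialCutoff_eq_zero_of_ge hη h.le]
  refine ⟨fun i => ⟨?_, ?_, (hsupp i).trans (Metric.closedBall_subset_ball (by linarith))⟩, ?_⟩
  · exact (contDiff_calibrationFactor hη ℓ θ₀ D α β γ i).smul perp.contDiff
  · exact (isCompact_closedBall _ _).of_isClosed_subset (isClosed_tsupport _) (hsupp i)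
  · intro x
    have e : ∀ i, ‖calibration η ℓ θ₀ D α β γ i x‖ ^ 2 = (radialCutoff η ℓ ‖x‖ / ‖x‖ * ‖x‖) ^ 2 *
        (jumpProfile θ₀ D α β γ (ang (θ₀ + 2 * Real.pi / 3) x) i) ^ 2 := by
      intro i
      rw [calibration, calibrationFactor, polarMap, norm_smul, norm_perp, smul_eq_mul, mul_pow,
        Real.norm_eq_abs, sq_abs]
      ring
    simp_rw [e, ← Finset.mul_sum, Fin.sum_univ_two, ← norm_sq_eq]
    have hr : radialCutoff η ℓ ‖x‖ / ‖x‖ * ‖x‖ = radialCutoff η ℓ ‖x‖ := by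
      by_cases h : ‖x‖ = 0
      · rw [h, mul_zero, radialCutoff_eq_zero_of_le hη hη.le]
      · rw [div_mul_cancel₀ _ h]
    rw [hr]
    have a1 := radialCutoff_nonneg η ℓ ‖x‖
    have a2 := radialCutoff_le_one η ℓ ‖x‖
    have a3 := norm_jumpProfile_le hD h1 h2 h3 θ₀ (ang (θ₀ + 2 * Real.pi / 3) x)
    exact mul_le_one₀ (pow_le_one₀ a1 a2) (by positivity) (pow_le_one₀ (norm_nonneg _) a3)

lemma divergence_calibration (hη : 0 < η) {r θ : ℝ} (hr : 0 < r)
    (hθ : θ ∈ Ioo (θ₀ + 2 * Real.pi / 3 - Real.pi) (θ₀ + 2 * Real.pi / 3 + Real.pi)) (i : Fin 2) :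
    r * divergence (calibration η ℓ θ₀ D α β γ i) (pol r θ) =
      -radialCutoff η ℓ r * deriv (fun θ => jumpProfile θ₀ D α β γ θ i) θ := by
  have hK := (contDiff_calibrationFactor hη ℓ θ₀ D α β γ i).differentiable one_ne_zero (pol r θ)
  have hJ : DifferentiableAt ℝ (fun θ => -jumpProfile θ₀ D α β γ θ i) θ :=
    ((contDiff_euclidean.1 (contDiff_jumpProfile θ₀ D α β γ) i).neg).differentiable one_ne_zero θ
  have h := fderiv_polarMap_right hK hJ hr hθ
  have e : divergence (calibration η ℓ θ₀ D α β γ i) (pol r θ) = _ := divergence_smul_perp hK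
  rw [e, perp_pol, map_smul]
  unfold calibrationFactor
  rw [h, deriv.fun_neg, smul_eq_mul]
  field_simp

/-- In polar coordinates the weighted divergence is a function of `r` times an angular derivative,
so the integral factors. At each interface the profile is the normalized jump, and the pairing
yields the squared `i`-th jump component over `D`; summed over `i` this is `D` per interface. -/
lemma IsJunctionAt.setIntegral_mul_divergence_calibration (h : IsJunctionAt u ℓ θ₀ α β γ)
    (hη : 0 < η) (hu : AEStronglyMeasurable u (volume.restrict (Metric.ball 0 ℓ))) (i : Fin 2) :
    ∫ x in Metric.ball 0 ℓ, u x i * divergence (calibration η ℓ θ₀ D α β γ i) x =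
      (∫ r in Ioo 0 ℓ, radialCutoff η ℓ r) *
        (D⁻¹ * ((α - γ) i ^ 2 + (β - α) i ^ 2 + (γ - β) i ^ 2)) := by
  have hpi := Real.pi_gt_three
  have hdiv : Continuous (divergence (calibration η ℓ θ₀ D α β γ i)) := continuous_divergence
    ((contDiff_calibrationFactor hη ℓ θ₀ D α β γ i).smul perp.contDiff)
  have hui : AEStronglyMeasurable (fun x => u x i) (volume.restrict (Metric.ball 0 ℓ)) :=
    (EuclideanSpace.proj i : Plane →L[ℝ] ℝ).continuous.comp_aestronglyMeasurable hu
  rw [integral_ball_polar (θ₀ + 2 * Real.pi / 3) ℓ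
    (f := fun x => u x i * divergence (calibration η ℓ θ₀ D α β γ i) x) (hui.mul hdiv.aestronglyMeasurable)]
  have hae : ∀ᵐ p : ℝ × ℝ, p.2 ∉ interfaceAngles θ₀ :=
    Measure.quasiMeasurePreserving_snd.ae ((interfaceAngles θ₀).countable_toSet.ae_notMem _)
  have hcongr : ∫ p in Ioo 0 ℓ ×ˢ Ioo (θ₀ + 2 * Real.pi / 3 - Real.pi)
        (θ₀ + 2 * Real.pi / 3 + Real.pi), p.1 *
        (u (pol p.1 p.2) i * divergence (calibration η ℓ θ₀ D α β γ i) (pol p.1 p.2)) =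
      ∫ p in Ioo 0 ℓ ×ˢ Ioo (θ₀ + 2 * Real.pi / 3 - Real.pi) (θ₀ + 2 * Real.pi / 3 + Real.pi),
        (-radialCutoff η ℓ p.1) * (stepMap θ₀ α β γ p.2 i *
          deriv (fun θ => jumpProfile θ₀ D α β γ θ i) p.2) := by
    apply integral_congr_ae
    filter_upwards [ae_restrict_of_ae hae,
      ae_restrict_mem (measurableSet_Ioo.prod measurableSet_Ioo)] with p hp1 hp2
    rw [h.eq_stepMap hp2.1 ⟨hp2.2.1, hp2.2.2.le⟩ hp1]
    linear_combination stepMap θ₀ α β γ p.2 i *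
      divergence_calibration (ℓ := ℓ) (D := D) (α := α) (β := β) (γ := γ) hη hp2.1.1 hp2.2 i
  have hJ : ContDiff ℝ 1 (fun θ => jumpProfile θ₀ D α β γ θ i) :=
    contDiff_euclidean.1 (contDiff_jumpProfile θ₀ D α β γ) i
  obtain ⟨j1, j2, j3⟩ := jumpProfile_interfaces θ₀ D α β γ
  rw [hcongr, Measure.volume_eq_prod, setIntegral_prod_mul (fun r => -radialCutoff η ℓ r)
      (fun θ => stepMap θ₀ α β γ θ i * deriv (fun θ => jumpProfile θ₀ D α β γ θ i) θ),
    integral_stepMap_mul_deriv (fun t => (hJ.differentiable one_ne_zero t).hasDerivAt)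
      (hJ.continuous_deriv le_rfl)
      (by rw [jumpProfile_left D (by linarith)]; rfl)
      (by rw [jumpProfile_right D (by linarith)]; rfl),
    j1, j2, j3, integral_neg]
  simp only [PiLp.smul_apply, smul_eq_mul]
  ring

lemma le_integral_radialCutoff (hη : 0 < η) (hηℓ : 6 * η ≤ ℓ) :
    ℓ - 6 * η ≤ ∫ r in Ioo 0 ℓ, radialCutoff η ℓ r := by
  have hint : IntegrableOn (radialCutoff η ℓ) (Ioo 0 ℓ) :=
    ((contDiff_radialCutoff η ℓ).continuous.integrableOn_Icc (a := 0) (b := ℓ)).mono_set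
      Ioo_subset_Icc_self
  calc ℓ - 6 * η = ∫ _ in Ioo (3 * η) (ℓ - 3 * η), (1 : ℝ) := by
        rw [setIntegral_const, measureReal_def, Real.volume_Ioo,
          ENNReal.toReal_ofReal (by linarith)]
        simp; ring
    _ = ∫ r in Ioo (3 * η) (ℓ - 3 * η), radialCutoff η ℓ r :=
        setIntegral_congr_fun measurableSet_Ioo fun r hr =>
          (radialCutoff_eq_one hη hr.1.le hr.2.le).symm
    _ ≤ _ := setIntegral_mono_set hint (ae_of_all _ fun r => radialCutoff_nonneg η ℓ r)
        (Ioo_subset_Ioo (by linarith) (by linarith)).eventuallyLE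

/-- The calibration with cutoff parameter `η` gives at least `3D(ℓ - 6η)`; then `η → 0`. -/
lemma IsJunctionAt.le_totalVariation (h : IsJunctionAt u ℓ θ₀ α β γ) (hℓ : 0 < ℓ) (hD : 0 < D)
    (h1 : ‖α - γ‖ = D) (h2 : ‖β - α‖ = D) (h3 : ‖γ - β‖ = D) :
    ENNReal.ofReal (D * (3 * ℓ)) ≤ totalVariation u (Metric.ball 0 ℓ) := by
  have key : ∀ η ∈ Ioo 0 (ℓ / 6), ENNReal.ofReal (D * (3 * (ℓ - 6 * η))) ≤
      totalVariation u (Metric.ball 0 ℓ) := by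
    intro η hη
    refine le_trans ?_ (le_iSup₂_of_le (f := fun (φ : Fin 2 → Plane → Plane)
      (_ : IsTestField (Metric.ball 0 ℓ) φ) => ENNReal.ofReal
        (∑ i, ∫ x in Metric.ball 0 ℓ, u x i * divergence (φ i) x))
      (calibration η ℓ θ₀ D α β γ) (isTestField_calibration hη.1 hD h1 h2 h3) le_rfl)
    apply ENNReal.ofReal_le_ofReal
    rw [Fin.sum_univ_two,
      h.setIntegral_mul_divergence_calibration hη.1 h.aestronglyMeasurable,
      h.setIntegral_mul_divergence_calibration hη.1 h.aestronglyMeasurable]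
    have hsum : D⁻¹ * ((α - γ) 0 ^ 2 + (β - α) 0 ^ 2 + (γ - β) 0 ^ 2) +
        D⁻¹ * ((α - γ) 1 ^ 2 + (β - α) 1 ^ 2 + (γ - β) 1 ^ 2) = 3 * D := by
      have e1 := norm_sq_eq (α - γ)
      have e2 := norm_sq_eq (β - α)
      have e3 := norm_sq_eq (γ - β)
      rw [h1] at e1
      rw [h2] at e2
      rw [h3] at e3
      field_simp
      linarith
    rw [← mul_add, hsum]
    have := le_integral_radialCutoff hη.1 (by linarith [hη.2] : 6 * η ≤ ℓ)
    nlinarith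
  have hlim : Tendsto (fun η : ℝ => ENNReal.ofReal (D * (3 * (ℓ - 6 * η)))) (𝓝[>] 0)
      (𝓝 (ENNReal.ofReal (D * (3 * (ℓ - 6 * 0))))) := by
    apply (ENNReal.continuous_ofReal.comp (by fun_prop)).continuousWithinAt
  rw [mul_zero, sub_zero] at hlim
  apply le_of_tendsto hlim
  filter_upwards [Ioo_mem_nhdsGT (by linarith : 0 < ℓ / 6)] with η hη using key η hη

end TripleJunction

/-! ### Strict convergence of the recovery maps and the upper bound. -/

namespace TripleJunction

variable {ε ℓ θ₀ D : ℝ} {α β γ : Plane} {u : Plane → Plane}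

lemma integrableOn_recovery (hε : 0 < ε) (hε' : ε ≤ 1 / 2) (ℓ θ₀ : ℝ) (α β γ : Plane) :
    IntegrableOn (recovery ε θ₀ α β γ) (Metric.ball 0 ℓ) :=
  ((contDiff_recovery hε hε' θ₀ α β γ).continuous.continuousOn.integrableOn_compact
    (isCompact_closedBall 0 ℓ)).mono_set Metric.ball_subset_closedBall

lemma IsJunctionAt.integrableOn (h : IsJunctionAt u ℓ θ₀ α β γ) (hα : ‖α‖ = 1) (hβ : ‖β‖ = 1)
    (hγ : ‖γ‖ = 1)
    (hval : ∀ x ∈ Metric.ball (0 : Plane) ℓ, u x = α ∨ u x = β ∨ u x = γ) :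
    IntegrableOn u (Metric.ball 0 ℓ) := by
  refine IntegrableOn.of_bound measure_ball_lt_top h.aestronglyMeasurable 1 ?_
  filter_upwards [ae_restrict_mem Metric.isOpen_ball.measurableSet] with x hx
  rcases hval x hx with e | e | e <;> rw [e] <;> linarith

lemma tendsto_ofReal_recoveryScale (D ℓ : ℝ) :
    Tendsto (fun k => ENNReal.ofReal (D * (3 * ℓ) + 2 * Real.pi * recoveryScale k)) atTop
      (𝓝 (ENNReal.ofReal (D * (3 * ℓ)))) := by
  have h := (ENNReal.continuous_ofReal.comp (by fun_prop : Continuous fun x : ℝ =>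
    D * (3 * ℓ) + 2 * Real.pi * x)).tendsto 0 |>.comp tendsto_recoveryScale
  simpa [Function.comp_def] using h

/-- The calibration bounds it below; lower semicontinuity along the recovery maps, whose gradient
integrals tend to this value, bounds it above. -/
lemma IsJunctionAt.totalVariation_eq (h : IsJunctionAt u ℓ θ₀ α β γ) (hℓ : 0 < ℓ) (hα : ‖α‖ = 1)
    (hβ : ‖β‖ = 1) (hγ : ‖γ‖ = 1)
    (hval : ∀ x ∈ Metric.ball (0 : Plane) ℓ, u x = α ∨ u x = β ∨ u x = γ) (hD : 0 < D)
    (h1 : ‖α - γ‖ = D) (h2 : ‖β - α‖ = D) (h3 : ‖γ - β‖ = D) :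
    totalVariation u (Metric.ball 0 ℓ) = ENNReal.ofReal (D * (3 * ℓ)) := by
  apply le_antisymm _ (h.le_totalVariation hℓ hD h1 h2 h3)
  have hs := recoveryScale_mem
  refine (totalVariation_le_of_tendsto (h.integrableOn hα hβ hγ hval)
    (fun k => integrableOn_recovery (hs k).1 (hs k).2 ℓ θ₀ α β γ)
    (h.tendsto_lintegral_recovery_sub hα hβ hγ hval hs tendsto_recoveryScale)).trans ?_
  rw [← (tendsto_ofReal_recoveryScale D ℓ).liminf_eq]
  apply liminf_le_liminf (Eventually.of_forall fun k => ?_)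
  exact (totalVariation_le_lintegral_gradNorm Metric.isOpen_ball
    (contDiff_recovery (hs k).1 (hs k).2 θ₀ α β γ).contDiffOn).trans
    (lintegral_gradNorm_recovery_le (hs k).1 (hs k).2 hℓ hα hβ hγ h1 h2 h3)

lemma IsJunctionAt.strictBVConv_recovery (h : IsJunctionAt u ℓ θ₀ α β γ) (hℓ : 0 < ℓ)
    (hα : ‖α‖ = 1) (hβ : ‖β‖ = 1) (hγ : ‖γ‖ = 1)
    (hval : ∀ x ∈ Metric.ball (0 : Plane) ℓ, u x = α ∨ u x = β ∨ u x = γ) (hD : 0 < D)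
    (h1 : ‖α - γ‖ = D) (h2 : ‖β - α‖ = D) (h3 : ‖γ - β‖ = D) :
    StrictBVConv (fun k => recovery (recoveryScale k) θ₀ α β γ) u (Metric.ball 0 ℓ) := by
  have hs := recoveryScale_mem
  have hTV := h.totalVariation_eq hℓ hα hβ hγ hval hD h1 h2 h3
  have hle : ∀ k, totalVariation (recovery (recoveryScale k) θ₀ α β γ) (Metric.ball 0 ℓ) ≤
      ENNReal.ofReal (D * (3 * ℓ) + 2 * Real.pi * recoveryScale k) := fun k =>
    (totalVariation_le_lintegral_gradNorm Metric.isOpen_ball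
      (contDiff_recovery (hs k).1 (hs k).2 θ₀ α β γ).contDiffOn).trans
      (lintegral_gradNorm_recovery_le (hs k).1 (hs k).2 hℓ hα hβ hγ h1 h2 h3)
  have hint : ∀ k, IntegrableOn (recovery (recoveryScale k) θ₀ α β γ) (Metric.ball 0 ℓ) :=
    fun k => integrableOn_recovery (hs k).1 (hs k).2 ℓ θ₀ α β γ
  have hL1 := h.tendsto_lintegral_recovery_sub hα hβ hγ hval hs tendsto_recoveryScale
  have hui := h.integrableOn hα hβ hγ hval
  refine ⟨⟨hui, hTV ▸ ENNReal.ofReal_lt_top⟩, fun k => ⟨hint k,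
    (hle k).trans_lt ENNReal.ofReal_lt_top⟩, hL1, ?_⟩
  refine tendsto_of_le_liminf_of_limsup_le ?_ ?_
  · exact totalVariation_le_of_tendsto hui hint hL1
  · rw [hTV, ← (tendsto_ofReal_recoveryScale D ℓ).limsup_eq]
    exact limsup_le_limsup (Eventually.of_forall hle)

lemma IsJunctionAt.relaxedArea_le (h : IsJunctionAt u ℓ θ₀ α β γ) (hℓ : 0 < ℓ) (hα : ‖α‖ = 1)
    (hβ : ‖β‖ = 1) (hγ : ‖γ‖ = 1)
    (hval : ∀ x ∈ Metric.ball (0 : Plane) ℓ, u x = α ∨ u x = β ∨ u x = γ) (hD : 0 < D)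
    (h1 : ‖α - γ‖ = D) (h2 : ‖β - α‖ = D) (h3 : ‖γ - β‖ = D) (hsum : α + β + γ = 0) :
    relaxedArea u (Metric.ball 0 ℓ) ≤ volume (Metric.ball (0 : Plane) ℓ) +
      ENNReal.ofReal (D * (3 * ℓ)) + ENNReal.ofReal (3 / 2 * |cross α β|) := by
  have hs := recoveryScale_mem
  refine iInf_le_of_le (fun k => recovery (recoveryScale k) θ₀ α β γ) (iInf₂_le_of_le
    (fun k => (contDiff_recovery (hs k).1 (hs k).2 θ₀ α β γ).contDiffOn)
    (h.strictBVConv_recovery hℓ hα hβ hγ hval hD h1 h2 h3) ?_)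
  have hlim := (tendsto_const_nhds (x := volume (Metric.ball (0 : Plane) ℓ))).add
    (tendsto_ofReal_recoveryScale D ℓ) |>.add
    (tendsto_const_nhds (x := ENNReal.ofReal (3 / 2 * |cross α β|)))
  rw [← hlim.liminf_eq]
  refine liminf_le_liminf (Eventually.of_forall fun k => (area_le _ _).trans ?_)
  gcongr
  · exact lintegral_gradNorm_recovery_le (hs k).1 (hs k).2 hℓ hα hβ hγ h1 h2 h3
  · exact lintegral_abs_det_recovery_le (hs k).1 (hs k).2 hℓ hsum

end TripleJunction

/-! ### Nearly straight arcs: length excess controls swept area. -/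

namespace TripleJunction

section Arcs

variable {g g' : ℝ → Plane} {a b : ℝ}

lemma norm_sub_le_arcLength (hab : a ≤ b) (hg : ∀ t, HasDerivAt g (g' t) t)
    (hc : Continuous g') : ‖g b - g a‖ ≤ ∫ t in a..b, ‖g' t‖ := by
  rw [← intervalIntegral.integral_eq_sub_of_hasDerivAt (fun t _ => hg t)
    (hc.intervalIntegrable _ _)]
  exact intervalIntegral.norm_integral_le_integral_norm hab

lemma hasDerivAt_cross {f f' : ℝ → Plane} {t : ℝ} (hf : HasDerivAt f (f' t) t)
    (hg : HasDerivAt g (g' t) t) :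
    HasDerivAt (fun s => cross (f s) (g s)) (cross (f' t) (g t) + cross (f t) (g' t)) t := by
  have hco : ∀ {h h' : ℝ → Plane}, HasDerivAt h (h' t) t → ∀ i,
      HasDerivAt (fun s => h s i) (h' t i) t := fun hh i =>
    (EuclideanSpace.proj i : Plane →L[ℝ] ℝ).hasFDerivAt.comp_hasDerivAt t hh
  have := ((hco hf 0).mul (hco hg 1)).sub ((hco hf 1).mul (hco hg 0))
  convert! this using 1
  simp only [cross]; ring

/-- For two real functions `x, y` of given total variations, bound on the area swept. -/
lemma abs_integral_mul_sub_mul_le {x y x' y' : ℝ → ℝ} (hab : a ≤ b)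
    (hx : ∀ t, HasDerivAt x (x' t) t) (hy : ∀ t, HasDerivAt y (y' t) t)
    (hcx : Continuous x') (hcy : Continuous y') (hx0 : x a = 0) (hy0 : y a = 0) :
    |∫ t in a..b, (x t * y' t - y t * x' t)| ≤
      2 * (∫ t in a..b, |x' t|) * ∫ t in a..b, |y' t| := by
  have hbd : ∀ {z z' : ℝ → ℝ}, (∀ t, HasDerivAt z (z' t) t) → Continuous z' → z a = 0 →
      ∀ t ∈ Icc a b, |z t| ≤ ∫ t in a..b, |z' t| := by
    intro z z' hz hcz hz0 t ht
    have h1 : ∫ s in a..t, z' s = z t := by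
      rw [intervalIntegral.integral_eq_sub_of_hasDerivAt (fun s _ => hz s)
        (hcz.intervalIntegrable _ _), hz0, sub_zero]
    rw [← h1]
    refine (intervalIntegral.abs_integral_le_integral_abs ht.1).trans ?_
    exact intervalIntegral.integral_mono_interval le_rfl ht.1 ht.2
      (ae_of_all _ fun s => abs_nonneg _) (hcz.abs.intervalIntegrable _ _)
  have hxc : Continuous x := continuous_iff_continuousAt.2 fun t => (hx t).continuousAt
  have hyc : Continuous y := continuous_iff_continuousAt.2 fun t => (hy t).continuousAt
  refine (intervalIntegral.abs_integral_le_integral_abs hab).trans ?_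
  calc ∫ t in a..b, |x t * y' t - y t * x' t|
      ≤ ∫ t in a..b, ((∫ s in a..b, |x' s|) * |y' t| + (∫ s in a..b, |y' s|) * |x' t|) := by
        apply intervalIntegral.integral_mono_on hab
          (Continuous.intervalIntegrable (by fun_prop) _ _)
          (Continuous.intervalIntegrable (by fun_prop) _ _)
        intro t ht
        refine (abs_sub _ _).trans ?_
        rw [abs_mul, abs_mul]
        gcongr
        · exact hbd hx hcx hx0 t ht
        · exact hbd hy hcy hy0 t ht
    _ = _ := by
        rw [intervalIntegral.integral_add (Continuous.intervalIntegrable (by fun_prop) _ _)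
          (Continuous.intervalIntegrable (by fun_prop) _ _),
          intervalIntegral.integral_const_mul, intervalIntegral.integral_const_mul]
        ring

/-- The area swept by a curve from its starting point is controlled by the excess of its length
over the length of its chord. -/
lemma abs_integral_cross_le (hab : a ≤ b) (hg : ∀ t, HasDerivAt g (g' t) t) (hc : Continuous g')
    (hne : g a ≠ g b) :
    |∫ t in a..b, cross (g t - g a) (g' t)| ≤
      2 * (∫ t in a..b, ‖g' t‖) *
        Real.sqrt ((∫ t in a..b, ‖g' t‖) ^ 2 - ‖g b - g a‖ ^ 2) := by
  set D := ‖g b - g a‖ with hD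
  have hD0 : 0 < D := norm_pos_iff.2 (sub_ne_zero.2 hne.symm)
  -- The velocity is split along the chord direction `τ` and across it; the swept area is at most
  -- twice the product of the two component variations `X` and `Y`.
  set τ : Plane := D⁻¹ • (g b - g a) with hτ
  have hτ1 : ‖τ‖ = 1 := by
    rw [hτ, norm_smul, norm_inv, Real.norm_of_nonneg hD0.le, inv_mul_cancel₀ hD0.ne']
  set ℓ := ∫ t in a..b, ‖g' t‖ with hℓ
  have hw : ∀ t, HasDerivAt (fun s => g s - g a) (g' t) t := fun t => (hg t).sub_const _
  have hx : ∀ t, HasDerivAt (fun s => inner ℝ τ (g s - g a)) (inner ℝ τ (g' t)) t := fun t => by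
    have := (innerSL ℝ τ).hasFDerivAt.comp_hasDerivAt t (hw t)
    exact this
  have hy : ∀ t, HasDerivAt (fun s => cross τ (g s - g a)) (cross τ (g' t)) t := fun t => by
    have := hasDerivAt_cross (f := fun _ => τ) (f' := fun _ => 0) (hasDerivAt_const t τ) (hw t)
    convert! this using 1
    simp [cross]
  have hcx : Continuous fun t => inner ℝ τ (g' t) := continuous_const.inner hc
  have hcy : Continuous fun t => cross τ (g' t) :=
    continuous_cross.comp (continuous_const.prodMk hc)
  have hmain := abs_integral_mul_sub_mul_le hab hx hy hcx hcy (by simp) (by simp [cross])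
  have hcross : ∀ t, cross (g t - g a) (g' t) =
      inner ℝ τ (g t - g a) * cross τ (g' t) - cross τ (g t - g a) * inner ℝ τ (g' t) := by
    intro t
    have h1 : τ 0 ^ 2 + τ 1 ^ 2 = 1 := by rw [← norm_sq_eq, hτ1, one_pow]
    rw [inner_eq, inner_eq]
    simp only [cross]
    linear_combination (-(((g t - g a) 0) * (g' t) 1 - (g t - g a) 1 * (g' t) 0)) * h1
  simp_rw [hcross]
  refine hmain.trans ?_
  set X := ∫ t in a..b, |inner ℝ τ (g' t)| with hX
  set Y := ∫ t in a..b, |cross τ (g' t)| with hY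
  have hX0 : 0 ≤ X := intervalIntegral.integral_nonneg hab fun t _ => abs_nonneg _
  have hY0 : 0 ≤ Y := intervalIntegral.integral_nonneg hab fun t _ => abs_nonneg _
  have hDX : D ≤ X := by
    have h1 : ∫ t in a..b, inner ℝ τ (g' t) = D := by
      rw [intervalIntegral.integral_eq_sub_of_hasDerivAt (fun t _ => hx t)
        (hcx.intervalIntegrable _ _), sub_self, inner_zero_right, sub_zero, hτ,
        real_inner_smul_left, real_inner_self_eq_norm_sq]
      field_simp
      rw [hD]
    rw [← h1]
    exact (le_abs_self _).trans (intervalIntegral.abs_integral_le_integral_abs hab)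
  -- Minkowski's inequality for the integral of the vector `(|τ · g'|, |τ × g'|)`, whose norm is
  -- `‖g'‖`, obtained by pairing it with `(X, Y)`. Combined with `X ≥ D` it leaves `Y ≤ √(ℓ² - D²)`.
  have hS : X ^ 2 + Y ^ 2 ≤ ℓ ^ 2 := by
    set S := Real.sqrt (X ^ 2 + Y ^ 2) with hSdef
    have hS2 : S ^ 2 = X ^ 2 + Y ^ 2 := Real.sq_sqrt (by positivity)
    have hS0 : 0 ≤ S := Real.sqrt_nonneg _
    have hle : S ^ 2 ≤ S * ℓ := by
      have e : S ^ 2 = ∫ t in a..b, (X * |inner ℝ τ (g' t)| + Y * |cross τ (g' t)|) := by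
        rw [intervalIntegral.integral_add (Continuous.intervalIntegrable (by fun_prop) _ _)
          (Continuous.intervalIntegrable (by fun_prop) _ _),
          intervalIntegral.integral_const_mul, intervalIntegral.integral_const_mul, hS2]
        ring
      rw [e, hℓ, ← intervalIntegral.integral_const_mul]
      apply intervalIntegral.integral_mono_on hab
        (Continuous.intervalIntegrable (by fun_prop) _ _)
        (Continuous.intervalIntegrable (by fun_prop) _ _)
      intro t _
      refine (abs_le_of_sq_le_sq' ?_ (by positivity)).2
      have h1 := inner_sq_add_cross_sq τ (g' t)
      rw [hτ1, one_pow, one_mul, ← sq_abs (inner ℝ τ (g' t)), ← sq_abs (cross τ (g' t))] at h1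
      rw [mul_pow, hS2, ← h1]
      nlinarith [sq_nonneg (X * |cross τ (g' t)| - Y * |inner ℝ τ (g' t)|)]
    have hSl : S ≤ ℓ := by
      by_cases h : S = 0
      · rw [h]; exact intervalIntegral.integral_nonneg hab fun t _ => norm_nonneg _
      · exact le_of_mul_le_mul_left (by rw [← sq]; exact hle) (lt_of_le_of_ne hS0 (Ne.symm h))
    rw [← hS2]
    exact pow_le_pow_left₀ hS0 hSl 2
  have hℓ0 : 0 ≤ ℓ := intervalIntegral.integral_nonneg hab fun t _ => norm_nonneg _
  have hXl : X ≤ ℓ := abs_le_of_sq_le_sq' (by nlinarith [sq_nonneg Y]) hℓ0 |>.2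
  have hYl : Y ≤ Real.sqrt (ℓ ^ 2 - D ^ 2) := Real.le_sqrt_of_sq_le (by nlinarith)
  gcongr

/-- A modulus of continuity for the area swept by nearly straight arcs. -/
noncomputable def arcError (L ε : ℝ) : ℝ :=
  2 * (L + 5 * ε) * Real.sqrt ((L + 5 * ε) ^ 2 - (L - 2 * ε) ^ 2) + 3 * ε

lemma tendsto_arcError (L : ℝ) : Tendsto (arcError L) (𝓝 0) (𝓝 0) := by
  have : Continuous (arcError L) := by unfold arcError; fun_prop
  have h := this.tendsto 0
  simpa [arcError] using h

/-- The integral is the area swept from `g a`, controlled by the length excess, plus `cross (g a) (g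
b)`. Moving the endpoints to `A` and `B` changes the latter by at most `ε(1 + ε) + ε ≤ 3ε`. -/
lemma abs_integral_cross_sub_le {A B : Plane} {L ε : ℝ} (hab : a ≤ b)
    (hg : ∀ t, HasDerivAt g (g' t) t) (hc : Continuous g') (hA : ‖A‖ = 1) (hB : ‖B‖ = 1)
    (hAB : ‖B - A‖ = L) (hε0 : 0 ≤ ε) (hε1 : ε ≤ 1) (hεL : 2 * ε < L) (ha : ‖g a - A‖ ≤ ε)
    (hb : ‖g b - B‖ ≤ ε) (hlen : ∫ t in a..b, ‖g' t‖ ≤ L + 5 * ε) :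
    |(∫ t in a..b, cross (g t) (g' t)) - cross A B| ≤ arcError L ε := by
  have hgc : Continuous g := continuous_iff_continuousAt.2 fun t => (hg t).continuousAt
  have hD : L - 2 * ε ≤ ‖g b - g a‖ := by
    have e : B - A = (g b - g a) + ((g a - A) - (g b - B)) := by abel
    have := norm_add_le (g b - g a) ((g a - A) - (g b - B))
    rw [← e, hAB] at this
    linarith [norm_sub_le (g a - A) (g b - B)]
  have hne : g a ≠ g b := by
    intro h
    rw [h, sub_self, norm_zero] at hD
    linarith
  have h1 := abs_integral_cross_le hab hg hc hne
  have hsplit : ∫ t in a..b, cross (g t) (g' t) =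
      (∫ t in a..b, cross (g t - g a) (g' t)) + cross (g a) (g b) := by
    have e : ∫ t in a..b, cross (g a) (g' t) = cross (g a) (g b) := by
      have hd : ∀ t, HasDerivAt (fun s => cross (g a) (g s)) (cross (g a) (g' t)) t := fun t => by
        have := hasDerivAt_cross (f := fun _ => g a) (f' := fun _ => 0)
          (hasDerivAt_const t (g a)) (hg t)
        convert! this using 1
        simp [cross]
      rw [intervalIntegral.integral_eq_sub_of_hasDerivAt (fun t _ => hd t)
        (Continuous.intervalIntegrable (by fun_prop) _ _), cross_self, sub_zero]
    rw [← e, ← intervalIntegral.integral_add (Continuous.intervalIntegrable (by fun_prop) _ _)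
      (Continuous.intervalIntegrable (by fun_prop) _ _)]
    refine intervalIntegral.integral_congr fun t _ => ?_
    simp only [cross_sub_left]; ring
  have h2 : |cross (g a) (g b) - cross A B| ≤ 3 * ε := by
    have e : cross (g a) (g b) - cross A B = cross (g a - A) (g b) + cross A (g b - B) := by
      rw [cross_sub_left, cross_sub_right]; ring
    have hgb : ‖g b‖ ≤ 1 + ε := by
      have := norm_add_le (g b - B) B
      rw [sub_add_cancel, hB] at this
      linarith
    rw [e]
    refine (abs_add_le _ _).trans ?_
    have b1 := (abs_cross_le (g a - A) (g b)).trans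
      (mul_le_mul ha hgb (norm_nonneg _) hε0)
    have b2 := abs_cross_le A (g b - B)
    rw [hA, one_mul] at b2
    nlinarith
  have hlen0 : 0 ≤ ∫ t in a..b, ‖g' t‖ :=
    intervalIntegral.integral_nonneg hab fun t _ => norm_nonneg _
  have h3 : 2 * (∫ t in a..b, ‖g' t‖) *
      Real.sqrt ((∫ t in a..b, ‖g' t‖) ^ 2 - ‖g b - g a‖ ^ 2) ≤
      2 * (L + 5 * ε) * Real.sqrt ((L + 5 * ε) ^ 2 - (L - 2 * ε) ^ 2) := by
    have hL : 0 ≤ L - 2 * ε := by linarith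
    apply mul_le_mul (by linarith) _ (Real.sqrt_nonneg _) (by linarith)
    gcongr
  rw [hsplit, add_sub_assoc]
  refine (abs_add_le _ _).trans ?_
  unfold arcError
  linarith

/-- A closed curve through neighbourhoods of the three vertices, whose length nearly equals the
perimeter of the triangle, encloses nearly the signed area of the triangle. -/
lemma abs_integral_loop_sub_le {α β γ : Plane} {L ε t₁ t₂ t₃ t₄ : ℝ} (h12 : t₁ ≤ t₂)
    (h23 : t₂ ≤ t₃) (h34 : t₃ ≤ t₄) (hg : ∀ t, HasDerivAt g (g' t) t) (hc : Continuous g')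
    (hα : ‖α‖ = 1) (hβ : ‖β‖ = 1) (hγ : ‖γ‖ = 1) (h1 : ‖β - α‖ = L) (h2 : ‖γ - β‖ = L)
    (h3 : ‖α - γ‖ = L) (hsum : α + β + γ = 0) (hε0 : 0 ≤ ε) (hε1 : ε ≤ 1) (hεL : 2 * ε < L)
    (hg1 : ‖g t₁ - α‖ ≤ ε) (hg2 : ‖g t₂ - β‖ ≤ ε) (hg3 : ‖g t₃ - γ‖ ≤ ε) (hg4 : g t₄ = g t₁)
    (hlen : ∫ t in t₁..t₄, ‖g' t‖ ≤ 3 * L + ε) :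
    |(∫ t in t₁..t₄, cross (g t) (g' t)) - 3 * cross α β| ≤ 3 * arcError L ε := by
  have hgc : Continuous g := continuous_iff_continuousAt.2 fun t => (hg t).continuousAt
  have hi : ∀ a b, IntervalIntegrable (fun t => ‖g' t‖) volume a b := fun a b =>
    hc.norm.intervalIntegrable _ _
  have hj : ∀ a b, IntervalIntegrable (fun t => cross (g t) (g' t)) volume a b := fun a b =>
    Continuous.intervalIntegrable (by fun_prop) _ _
  rw [← intervalIntegral.integral_add_adjacent_intervals (hi t₁ t₃) (hi t₃ t₄),
    ← intervalIntegral.integral_add_adjacent_intervals (hi t₁ t₂) (hi t₂ t₃)] at hlen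
  rw [← intervalIntegral.integral_add_adjacent_intervals (hj t₁ t₃) (hj t₃ t₄),
    ← intervalIntegral.integral_add_adjacent_intervals (hj t₁ t₂) (hj t₂ t₃)]
  have hg4' : ‖g t₄ - α‖ ≤ ε := hg4 ▸ hg1
  have chord : ∀ {A B : Plane} {s t : ℝ}, s ≤ t → ‖B - A‖ = L → ‖g s - A‖ ≤ ε → ‖g t - B‖ ≤ ε →
      L - 2 * ε ≤ ∫ t in s..t, ‖g' t‖ := by
    intro A B s t hst hAB hs ht
    refine le_trans ?_ (norm_sub_le_arcLength hst hg hc)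
    have e : B - A = (g t - g s) + ((g s - A) - (g t - B)) := by abel
    have := norm_add_le (g t - g s) ((g s - A) - (g t - B))
    rw [← e, hAB] at this
    linarith [norm_sub_le (g s - A) (g t - B)]
  have c1 := chord h12 h1 hg1 hg2
  have c2 := chord h23 h2 hg2 hg3
  have c3 := chord h34 h3 hg3 hg4'
  -- Two of the arcs use at least `L - 2ε` each of the total length `3L + ε`, which leaves at most
  -- `L + 5ε` for the third.
  have e1 := abs_integral_cross_sub_le h12 hg hc hα hβ h1 hε0 hε1 hεL hg1 hg2 (by linarith)
  have e2 := abs_integral_cross_sub_le h23 hg hc hβ hγ h2 hε0 hε1 hεL hg2 hg3 (by linarith)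
  have e3 := abs_integral_cross_sub_le h34 hg hc hγ hα h3 hε0 hε1 hεL hg3 hg4' (by linarith)
  have x1 := cross_eq_of_sum_eq_zero hsum
  have x2 : cross γ α = cross β γ := cross_eq_of_sum_eq_zero (by rw [← hsum]; abel)
  rw [x2, x1] at e3
  rw [x1] at e2
  rw [abs_le] at *
  constructor <;> linarith [e1.1, e1.2, e2.1, e2.2, e3.1, e3.2]

end Arcs

end TripleJunction

/-! ### Green's formula on disks for `C¹` maps. -/

namespace TripleJunction

section Circulation

variable {v : Plane → Plane} {ℓ r R a : ℝ}

/-- The derivative of `v` in the angular variable along circles. -/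
noncomputable def angDeriv (v : Plane → Plane) (r θ : ℝ) : Plane :=
  r • fderiv ℝ v (pol r θ) (angDir θ)

/-- The derivative of `v` in the radial variable. -/
noncomputable def radDeriv (v : Plane → Plane) (r θ : ℝ) : Plane :=
  fderiv ℝ v (pol r θ) (pol 1 θ)

/-- Twice the signed area enclosed by the image of the circle of radius `r`. -/
noncomputable def circulation (v : Plane → Plane) (a r : ℝ) : ℝ :=
  ∫ θ in a..(a + 2 * Real.pi), cross (v (pol r θ)) (angDeriv v r θ)

@[fun_prop] lemma continuous_pol : Continuous fun p : ℝ × ℝ => pol p.1 p.2 :=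
  (contDiff_pol (n := 0)).continuous

@[fun_prop] lemma continuous_angDir : Continuous angDir := by
  unfold angDir
  exact (PiLp.continuous_toLp 2 _).comp (continuous_pi fun i => by
    fin_cases i
    · exact Real.continuous_sin.neg
    · exact Real.continuous_cos)

lemma pol_mem_ball {θ : ℝ} (hr : |r| < ℓ) : pol r θ ∈ Metric.ball (0 : Plane) ℓ := by simpa using hr

lemma pol_mem_closedBall {θ : ℝ} (hr : |r| ≤ R) : pol r θ ∈ Metric.closedBall (0 : Plane) R := by
  simpa using hr

lemma differentiableAt_of_contDiffOn_ball (hv : ContDiffOn ℝ 1 v (Metric.ball 0 ℓ)) {x : Plane}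
    (hx : x ∈ Metric.ball 0 ℓ) : DifferentiableAt ℝ v x :=
  (hv.contDiffAt (Metric.isOpen_ball.mem_nhds hx)).differentiableAt one_ne_zero

lemma continuousOn_fderiv_pol (hv : ContDiffOn ℝ 1 v (Metric.ball 0 ℓ)) :
    ContinuousOn (fun p : ℝ × ℝ => fderiv ℝ v (pol p.1 p.2)) {p | |p.1| < ℓ} :=
  (hv.continuousOn_fderiv_of_isOpen Metric.isOpen_ball le_rfl).comp
    continuous_pol.continuousOn fun _ hp => pol_mem_ball hp

lemma continuousOn_angDeriv (hv : ContDiffOn ℝ 1 v (Metric.ball 0 ℓ)) :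
    ContinuousOn (fun p : ℝ × ℝ => angDeriv v p.1 p.2) {p | |p.1| < ℓ} := by
  unfold angDeriv
  exact continuousOn_fst.smul ((continuousOn_fderiv_pol hv).clm_apply
    (continuous_angDir.comp continuous_snd).continuousOn)

lemma continuousOn_radDeriv (hv : ContDiffOn ℝ 1 v (Metric.ball 0 ℓ)) :
    ContinuousOn (fun p : ℝ × ℝ => radDeriv v p.1 p.2) {p | |p.1| < ℓ} := by
  unfold radDeriv
  exact (continuousOn_fderiv_pol hv).clm_apply
    (continuous_pol.comp (continuous_const.prodMk continuous_snd)).continuousOn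

lemma continuous_angDeriv (hv : ContDiffOn ℝ 1 v (Metric.ball 0 ℓ)) (hr : |r| < ℓ) :
    Continuous (angDeriv v r) :=
  (continuousOn_angDeriv hv).comp_continuous (continuous_const.prodMk continuous_id) fun _ => hr

lemma hasDerivAt_angular (hv : ContDiffOn ℝ 1 v (Metric.ball 0 ℓ)) (hr : |r| < ℓ) (θ : ℝ) :
    HasDerivAt (fun t => v (pol r t)) (angDeriv v r θ) θ :=
  hasDerivAt_comp_pol_right (differentiableAt_of_contDiffOn_ball hv (pol_mem_ball hr))

lemma hasDerivAt_radial (hv : ContDiffOn ℝ 1 v (Metric.ball 0 ℓ)) (hr : |r| < ℓ) (θ : ℝ) :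
    HasDerivAt (fun s => v (pol s θ)) (radDeriv v r θ) r :=
  hasDerivAt_comp_pol_left (differentiableAt_of_contDiffOn_ball hv (pol_mem_ball hr))

lemma continuous_circle (hv : ContDiffOn ℝ 1 v (Metric.ball 0 ℓ)) (hr : |r| < ℓ) :
    Continuous fun θ => v (pol r θ) :=
  continuous_iff_continuousAt.2 fun θ => (hasDerivAt_angular hv hr θ).continuousAt

lemma _root_.Continuous.plane_cross {X : Type*} [TopologicalSpace X] {f g : X → Plane}
    (hf : Continuous f) (hg : Continuous g) : Continuous fun x => cross (f x) (g x) :=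
  continuous_cross.comp (hf.prodMk hg)

/-- The `θ`-derivative of `cross (v (pol r θ)) (v (pol s θ))` integrates to zero over a period;
adding it symmetrizes the difference, so that `v` at the two radii enters through its increment and
no difference of angular derivatives remains. -/
lemma circulation_sub (hv : ContDiffOn ℝ 1 v (Metric.ball 0 ℓ)) {s : ℝ} (hr : |r| < ℓ)
    (hs : |s| < ℓ) (a : ℝ) :
    circulation v a s - circulation v a r = ∫ θ in a..(a + 2 * Real.pi),
      cross (v (pol s θ) - v (pol r θ)) (angDeriv v s θ + angDeriv v r θ) := by
  have cs := continuous_circle hv hs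
  have cr := continuous_circle hv hr
  have ds := continuous_angDeriv hv hs
  have dr := continuous_angDeriv hv hr
  have hzero : ∫ θ in a..(a + 2 * Real.pi),
      (cross (angDeriv v r θ) (v (pol s θ)) + cross (v (pol r θ)) (angDeriv v s θ)) = 0 := by
    rw [intervalIntegral.integral_eq_sub_of_hasDerivAt
      (fun t _ => hasDerivAt_cross (hasDerivAt_angular hv hr t) (hasDerivAt_angular hv hs t))
      (((dr.plane_cross cs).add (cr.plane_cross ds)).intervalIntegrable _ _)]
    rw [pol_add_two_pi, pol_add_two_pi, sub_self]
  have i1 : IntervalIntegrable (fun θ => cross (v (pol s θ) - v (pol r θ))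
      (angDeriv v s θ + angDeriv v r θ)) volume a (a + 2 * Real.pi) :=
    ((cs.sub cr).plane_cross (ds.add dr)).intervalIntegrable _ _
  have i2 : IntervalIntegrable (fun θ => cross (angDeriv v r θ) (v (pol s θ)) +
      cross (v (pol r θ)) (angDeriv v s θ)) volume a (a + 2 * Real.pi) :=
    ((dr.plane_cross cs).add (cr.plane_cross ds)).intervalIntegrable _ _
  rw [circulation, circulation, ← intervalIntegral.integral_sub
    ((cs.plane_cross ds).intervalIntegrable _ _)
    ((cr.plane_cross dr).intervalIntegrable _ _), ← add_zero (∫ θ in a..(a + 2 * Real.pi),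
      cross (v (pol s θ) - v (pol r θ)) (angDeriv v s θ + angDeriv v r θ)), ← hzero,
    ← intervalIntegral.integral_add i1 i2]
  refine intervalIntegral.integral_congr fun θ _ => ?_
  simp only [cross_sub_left, cross_add_right]
  rw [cross_swap (angDeriv v r θ) (v (pol s θ))]
  ring

lemma exists_bound_fderiv (hv : ContDiffOn ℝ 1 v (Metric.ball 0 ℓ)) (hR : R < ℓ) :
    ∃ M, 0 ≤ M ∧ ∀ x ∈ Metric.closedBall (0 : Plane) R, ‖fderiv ℝ v x‖ ≤ M := by
  obtain ⟨M, hM⟩ := (isCompact_closedBall (0 : Plane) R).exists_bound_of_continuousOn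
    ((hv.continuousOn_fderiv_of_isOpen Metric.isOpen_ball le_rfl).mono
      (Metric.closedBall_subset_ball hR))
  exact ⟨max M 0, le_max_right _ _, fun x hx => (hM x hx).trans (le_max_left _ _)⟩

lemma norm_angDeriv_le {M : ℝ} (hM : ∀ x ∈ Metric.closedBall (0 : Plane) R, ‖fderiv ℝ v x‖ ≤ M)
    (hr : |r| ≤ R) (θ : ℝ) : ‖angDeriv v r θ‖ ≤ R * M := by
  rw [angDeriv, norm_smul, Real.norm_eq_abs]
  have h := (fderiv ℝ v (pol r θ)).le_opNorm (angDir θ)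
  rw [norm_angDir, mul_one] at h
  exact mul_le_mul hr (h.trans (hM _ (pol_mem_closedBall hr))) (norm_nonneg _)
    ((abs_nonneg r).trans hr)

/-- Differentiating under the integral would require the mixed second derivative of `v`. In the form
of `circulation_sub` only a radial difference quotient of `v` occurs, and dominated convergence
suffices for `C¹` maps. -/
lemma hasDerivAt_circulation (hv : ContDiffOn ℝ 1 v (Metric.ball 0 ℓ)) (hr : |r| < ℓ) (a : ℝ) :
    HasDerivAt (circulation v a)
      (∫ θ in a..(a + 2 * Real.pi), cross (radDeriv v r θ) ((2 : ℝ) • angDeriv v r θ)) r := by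
  obtain ⟨R, hrR, hRℓ⟩ := exists_between hr
  obtain ⟨M, hM0, hM⟩ := exists_bound_fderiv hv hRℓ
  rw [hasDerivAt_iff_tendsto_slope]
  have hev : ∀ᶠ s in 𝓝[≠] r, |s| < R :=
    nhdsWithin_le_nhds (continuous_abs.continuousAt.eventually (gt_mem_nhds hrR))
  have heq : (fun s => ∫ θ in a..(a + 2 * Real.pi),
      cross ((s - r)⁻¹ • (v (pol s θ) - v (pol r θ))) (angDeriv v s θ + angDeriv v r θ))
      =ᶠ[𝓝[≠] r] slope (circulation v a) r := by
    filter_upwards [hev] with s hs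
    rw [slope_def_module, circulation_sub hv hr (hs.trans hRℓ), smul_eq_mul,
      ← intervalIntegral.integral_const_mul]
    simp only [cross_smul_left]
  refine Tendsto.congr' heq ?_
  apply intervalIntegral.tendsto_integral_filter_of_dominated_convergence
    (fun _ => M * (R * M + R * M))
  · filter_upwards [hev] with s hs
    have cs := continuous_circle hv (hs.trans hRℓ)
    have cr := continuous_circle hv hr
    have ds := continuous_angDeriv hv (hs.trans hRℓ)
    have dr := continuous_angDeriv hv hr
    exact (((cs.sub cr).const_smul (s - r)⁻¹).plane_cross (ds.add dr)).aestronglyMeasurable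
  · filter_upwards [hev, self_mem_nhdsWithin] with s hs hne
    refine ae_of_all _ fun θ _ => ?_
    rw [Real.norm_eq_abs]
    refine (abs_cross_le _ _).trans ?_
    have h1 : ‖v (pol s θ) - v (pol r θ)‖ ≤ M * ‖pol s θ - pol r θ‖ :=
      (convex_closedBall (0 : Plane) R).norm_image_sub_le_of_norm_fderiv_le
        (fun x hx => differentiableAt_of_contDiffOn_ball hv
          (Metric.closedBall_subset_ball hRℓ hx)) hM
        (pol_mem_closedBall hrR.le) (pol_mem_closedBall hs.le)
    rw [← dist_eq_norm, ← dist_eq_norm, (isometry_pol θ).dist_eq, Real.dist_eq] at h1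
    have hpos : 0 < |s - r| := abs_pos.2 (sub_ne_zero.2 hne)
    have h2 : ‖(s - r)⁻¹ • (v (pol s θ) - v (pol r θ))‖ ≤ M := by
      rw [norm_smul, norm_inv, Real.norm_eq_abs, ← dist_eq_norm, inv_mul_le_iff₀ hpos]
      linarith
    have h3 : ‖angDeriv v s θ + angDeriv v r θ‖ ≤ R * M + R * M :=
      (norm_add_le _ _).trans (add_le_add (norm_angDeriv_le hM hs.le θ)
        (norm_angDeriv_le hM hrR.le θ))
    exact mul_le_mul h2 h3 (norm_nonneg _) hM0
  · exact intervalIntegrable_const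
  · refine ae_of_all _ fun θ _ => ?_
    have t1 : Tendsto (fun s => (s - r)⁻¹ • (v (pol s θ) - v (pol r θ))) (𝓝[≠] r)
        (𝓝 (radDeriv v r θ)) := by
      have := hasDerivAt_iff_tendsto_slope.1 (hasDerivAt_radial hv hr θ)
      refine this.congr fun s => ?_
      rw [slope_def_module]
    have t2 : Tendsto (fun s => angDeriv v s θ + angDeriv v r θ) (𝓝[≠] r)
        (𝓝 ((2 : ℝ) • angDeriv v r θ)) := by
      rw [two_smul]
      apply Tendsto.add_const
      have hopen : IsOpen {p : ℝ × ℝ | |p.1| < ℓ} :=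
        isOpen_lt (continuous_abs.comp continuous_fst) continuous_const
      have hc := (continuousOn_angDeriv hv).continuousAt (hopen.mem_nhds (x := (r, θ)) hr)
      have := hc.comp (f := fun s : ℝ => (s, θ)) (by fun_prop : ContinuousAt _ r)
      exact this.tendsto.mono_left nhdsWithin_le_nhds
    exact (continuous_cross.tendsto _).comp (t1.prodMk_nhds t2)

lemma circulation_zero (v : Plane → Plane) (a : ℝ) : circulation v a 0 = 0 := by
  simp [circulation, angDeriv, cross]

/-- The angular integrand of the derivative of the circulation. -/
lemma intervalIntegrable_deriv_circulation (hv : ContDiffOn ℝ 1 v (Metric.ball 0 ℓ))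
    (hr0 : 0 < r) (hr : r < ℓ) (a : ℝ) :
    IntervalIntegrable (fun s => ∫ θ in a..(a + 2 * Real.pi),
      cross (radDeriv v s θ) ((2 : ℝ) • angDeriv v s θ)) volume 0 r := by
  have hpi := Real.pi_pos
  have hcont : ContinuousOn (fun p : ℝ × ℝ =>
      cross (radDeriv v p.1 p.2) ((2 : ℝ) • angDeriv v p.1 p.2)) {p | |p.1| < ℓ} :=
    have h2 := (continuousOn_angDeriv hv).const_smul (2 : ℝ)
    continuous_cross.comp_continuousOn
      (f := fun p : ℝ × ℝ => (radDeriv v p.1 p.2, (2 : ℝ) • angDeriv v p.1 p.2))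
      ((continuousOn_radDeriv hv).prodMk h2)
  have hsub : Icc 0 r ×ˢ Icc a (a + 2 * Real.pi) ⊆ {p : ℝ × ℝ | |p.1| < ℓ} := fun p hp => by
    change |p.1| < ℓ
    rw [abs_of_nonneg hp.1.1]; exact hp.1.2.trans_lt hr
  have hint2 : IntegrableOn (fun p : ℝ × ℝ =>
      cross (radDeriv v p.1 p.2) ((2 : ℝ) • angDeriv v p.1 p.2))
      (Ioc 0 r ×ˢ Ioc a (a + 2 * Real.pi)) := ((hcont.mono hsub).integrableOn_compact
      (isCompact_Icc.prod isCompact_Icc)).mono_set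
      (prod_mono Ioc_subset_Icc_self Ioc_subset_Icc_self)
  rw [intervalIntegrable_iff_integrableOn_Ioc_of_le hr0.le]
  rw [IntegrableOn, Measure.volume_eq_prod, ← Measure.prod_restrict] at hint2
  have h := hint2.integral_prod_left
  simp_rw [intervalIntegral.integral_of_le (show a ≤ a + 2 * Real.pi by linarith)]
  exact h

/-- Green's formula: the integrand is `2 r det ∇v`, and the circulation vanishes at radius zero. -/
lemma circulation_eq_integral (hv : ContDiffOn ℝ 1 v (Metric.ball 0 ℓ)) (hr0 : 0 < r)
    (hr : r < ℓ) (a : ℝ) :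
    circulation v a r = ∫ s in 0..r, ∫ θ in a..(a + 2 * Real.pi),
      cross (radDeriv v s θ) ((2 : ℝ) • angDeriv v s θ) := by
  rw [intervalIntegral.integral_eq_sub_of_hasDerivAt (f := circulation v a) _
    (intervalIntegrable_deriv_circulation hv hr0 hr a), circulation_zero, sub_zero]
  intro s hs
  rw [uIcc_of_le hr0.le] at hs
  exact hasDerivAt_circulation hv (by rw [abs_of_nonneg hs.1]; exact hs.2.trans_lt hr) a

lemma enorm_circulation_le (hv : ContDiffOn ℝ 1 v (Metric.ball 0 ℓ)) (hr0 : 0 < r) (hr : r < ℓ)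
    (a : ℝ) :
    ‖circulation v a r‖ₑ ≤ ∫⁻ s in Ioo 0 r, ∫⁻ θ in Ioo a (a + 2 * Real.pi),
      2 * ‖cross (radDeriv v s θ) (angDeriv v s θ)‖ₑ := by
  have hpi := Real.pi_pos
  have h2 : ‖(2 : ℝ)‖ₑ = 2 := by rw [← ofReal_norm]; simp
  rw [circulation_eq_integral hv hr0 hr, intervalIntegral.integral_of_le hr0.le,
    integral_Ioc_eq_integral_Ioo]
  refine (enorm_integral_le_lintegral_enorm _).trans (lintegral_mono fun s => ?_)
  rw [intervalIntegral.integral_of_le (by linarith), integral_Ioc_eq_integral_Ioo]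
  refine (enorm_integral_le_lintegral_enorm _).trans (lintegral_mono fun θ => ?_)
  rw [cross_smul_right, enorm_mul, h2]

end Circulation

end TripleJunction

/-! ### Lower bounds on a single circle. -/

namespace TripleJunction

section Slices

variable {g g' : ℝ → Plane} {a b θ₀ L σ : ℝ} {α β γ : Plane}

/-- Some point does not exceed the average; this turns `L¹` closeness into closeness at a point. -/
lemma exists_enorm_sub_le (hab : a < b) (hg : Continuous g) (A : Plane) :
    ∃ t ∈ Ioo a b, ‖g t - A‖ₑ ≤ ENNReal.ofReal (b - a)⁻¹ * ∫⁻ s in Ioo a b, ‖g s - A‖ₑ := by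
  have hne : volume (Ioo a b) ≠ 0 := by
    rw [Real.volume_Ioo]; simpa using hab
  have hm : Measurable fun s => ‖g s - A‖ₑ := (hg.sub continuous_const).enorm.measurable
  obtain ⟨t, ht, hle⟩ := exists_le_setLAverage hne (by simp) hm.aemeasurable
  refine ⟨t, ht, hle.trans_eq ?_⟩
  rw [setLAverage_eq, Real.volume_Ioo, ENNReal.ofReal_inv_of_pos (sub_pos.2 hab), mul_comm,
    ENNReal.div_eq_inv_mul, mul_comm]

lemma enorm_sub_le_lintegral (hab : a ≤ b) (hg : ∀ t, HasDerivAt g (g' t) t)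
    (hc : Continuous g') : ‖g b - g a‖ₑ ≤ ∫⁻ t in Ioo a b, ‖g' t‖ₑ := by
  rw [← intervalIntegral.integral_eq_sub_of_hasDerivAt (fun t _ => hg t)
    (hc.intervalIntegrable _ _), intervalIntegral.integral_of_le hab,
    integral_Ioc_eq_integral_Ioo]
  exact enorm_integral_le_lintegral_enorm _

/-- Crossing one interface costs at least the size of the jump. -/
lemma ofReal_norm_le_lintegral_add {U : ℝ → Plane} {w : ℝ → ENNReal} {q : ℝ} {A B : Plane}
    (hg : ∀ t, HasDerivAt g (g' t) t) (hc : Continuous g') (hσ : 0 < σ)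
    (hA : ∀ t ∈ Ioo (q - σ) q, U t = A) (hB : ∀ t ∈ Ioo q (q + σ), U t = B)
    (hw : ∀ t, ‖g' t‖ₑ ≤ w t) :
    ENNReal.ofReal ‖B - A‖ ≤ (∫⁻ t in Ioo (q - σ) (q + σ), w t) +
      ENNReal.ofReal σ⁻¹ * ∫⁻ t in Ioo (q - σ) (q + σ), ‖g t - U t‖ₑ := by
  have hgc : Continuous g := continuous_iff_continuousAt.2 fun t => (hg t).continuousAt
  obtain ⟨s, hs, hsA⟩ := exists_enorm_sub_le (show q - σ < q by linarith) hgc A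
  obtain ⟨t, ht, htB⟩ := exists_enorm_sub_le (show q < q + σ by linarith) hgc B
  rw [sub_sub_cancel] at hsA
  rw [add_sub_cancel_left] at htB
  have e1 : ∫⁻ s in Ioo (q - σ) q, ‖g s - A‖ₑ = ∫⁻ s in Ioo (q - σ) q, ‖g s - U s‖ₑ :=
    setLIntegral_congr_fun measurableSet_Ioo fun x hx => by simp only [hA x hx]
  have e2 : ∫⁻ s in Ioo q (q + σ), ‖g s - B‖ₑ = ∫⁻ s in Ioo q (q + σ), ‖g s - U s‖ₑ :=
    setLIntegral_congr_fun measurableSet_Ioo fun x hx => by simp only [hB x hx]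
  rw [e1] at hsA
  rw [e2] at htB
  have hsum : (∫⁻ s in Ioo (q - σ) q, ‖g s - U s‖ₑ) + (∫⁻ s in Ioo q (q + σ), ‖g s - U s‖ₑ) ≤
      ∫⁻ t in Ioo (q - σ) (q + σ), ‖g t - U t‖ₑ := by
    rw [← lintegral_union measurableSet_Ioo
      (Set.disjoint_left.2 fun x hx hx' => (hx.2.trans hx'.1).false)]
    exact lintegral_mono_set (union_subset (Ioo_subset_Ioo_right (by linarith))
      (Ioo_subset_Ioo_left (by linarith)))
  have hlen : ‖g t - g s‖ₑ ≤ ∫⁻ t in Ioo (q - σ) (q + σ), w t :=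
    (enorm_sub_le_lintegral (hs.2.trans ht.1).le hg hc).trans
      ((lintegral_mono hw).trans (lintegral_mono_set (Ioo_subset_Ioo hs.1.le ht.2.le)))
  -- The curve is near `A` at `s`, left of the interface, and near `B` at `t`, right of it; in
  -- between it must travel almost `‖B - A‖`.
  have e : B - A = (g t - g s) + ((g s - A) - (g t - B)) := by abel
  calc ENNReal.ofReal ‖B - A‖ = ‖(g t - g s) + ((g s - A) - (g t - B))‖ₑ := by
        rw [ofReal_norm, ← e]
    _ ≤ ‖g t - g s‖ₑ + (‖g s - A‖ₑ + ‖g t - B‖ₑ) :=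
        (enorm_add_le _ _).trans (add_le_add le_rfl enorm_sub_le)
    _ ≤ _ := by
        refine add_le_add hlen ((add_le_add hsA htB).trans ?_)
        rw [← mul_add]
        exact mul_le_mul_right hsum _

lemma exists_stepMap_eq_near (h1 : ‖α - γ‖ = L) (h2 : ‖β - α‖ = L) (h3 : ‖γ - β‖ = L) {q : ℝ}
    (hq : q ∈ interfaceAngles θ₀) :
    ∃ A B, ‖B - A‖ = L ∧ (∀ t ∈ Ioo (q - 1) q, stepMap θ₀ α β γ t = A) ∧
      ∀ t ∈ Ioo q (q + 1), stepMap θ₀ α β γ t = B := by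
  have hpi := Real.pi_gt_three
  simp only [interfaceAngles, Finset.mem_insert, Finset.mem_singleton] at hq
  unfold stepMap
  rcases hq with rfl | rfl | rfl
  · refine ⟨γ, α, h1, fun t ht => ?_, fun t ht => ?_⟩
    · rw [if_pos ht.2]
    · rw [if_neg (by linarith [ht.1]), if_pos (by linarith [ht.2])]
  · refine ⟨α, β, h2, fun t ht => ?_, fun t ht => ?_⟩
    · rw [if_neg (by linarith [ht.1]), if_pos (by linarith [ht.2])]
    · rw [if_neg (by linarith [ht.1]), if_neg (by linarith [ht.1]), if_pos (by linarith [ht.2])]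
  · refine ⟨β, γ, h3, fun t ht => ?_, fun t ht => ?_⟩
    · rw [if_neg (by linarith [ht.1]), if_neg (by linarith [ht.1]), if_pos (by linarith [ht.2])]
    · rw [if_neg (by linarith [ht.1]), if_neg (by linarith [ht.1]), if_neg (by linarith [ht.1])]

lemma pairwiseDisjoint_windows (hσ : σ ≤ 1) :
    (interfaceAngles θ₀ : Set ℝ).PairwiseDisjoint fun q => Ioo (q - σ) (q + σ) := by
  have hpi := Real.pi_gt_three
  intro q hq p hp hne
  rw [Function.onFun, Set.disjoint_left]
  intro x hx hx'
  simp only [interfaceAngles, Finset.coe_insert, Finset.coe_singleton, mem_insert_iff,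
    mem_singleton_iff] at hq hp
  rcases hq with rfl | rfl | rfl <;> rcases hp with rfl | rfl | rfl <;>
    first
    | exact hne rfl
    | linarith [hx.1, hx.2, hx'.1, hx'.2]

lemma windows_subset (hσ : σ ≤ 1) :
    (⋃ q ∈ interfaceAngles θ₀, Ioo (q - σ) (q + σ)) ⊆
      Ioo (θ₀ + 2 * Real.pi / 3 - Real.pi) (θ₀ + 2 * Real.pi / 3 + Real.pi) := by
  have hpi := Real.pi_gt_three
  refine iUnion₂_subset fun q hq => ?_
  simp only [interfaceAngles, Finset.mem_insert, Finset.mem_singleton] at hq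
  rcases hq with rfl | rfl | rfl <;> apply Ioo_subset_Ioo <;> linarith

lemma volume_windows_le (θ₀ σ : ℝ) :
    volume (⋃ q ∈ interfaceAngles θ₀, Ioo (q - σ) (q + σ)) ≤ ENNReal.ofReal (6 * σ) := by
  refine (measure_biUnion_finset_le _ _).trans ?_
  have : ∀ q ∈ interfaceAngles θ₀, volume (Ioo (q - σ) (q + σ)) = ENNReal.ofReal (2 * σ) :=
    fun q _ => by rw [Real.volume_Ioo]; congr 1; ring
  rw [Finset.sum_congr rfl this, Finset.sum_const, card_interfaceAngles, nsmul_eq_mul,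
    ← ENNReal.ofReal_natCast, ← ENNReal.ofReal_mul (by positivity)]
  apply ENNReal.ofReal_le_ofReal
  push_cast; linarith

/-- Lower bound for the contribution of one circle to the area. -/
lemma ofReal_le_lintegral_slice (hg : ∀ t, HasDerivAt g (g' t) t) (hc : Continuous g')
    (h1 : ‖α - γ‖ = L) (h2 : ‖β - α‖ = L) (h3 : ‖γ - β‖ = L) (hσ : 0 < σ) (hσ1 : σ ≤ 1)
    {w : ℝ → ENNReal} {ρ : ℝ} (hρ : 0 ≤ ρ) (hw : ∀ t, ‖g' t‖ₑ ≤ w t)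
    (hwρ : ∀ t, ENNReal.ofReal ρ ≤ w t) :
    ENNReal.ofReal (3 * L + ρ * (2 * Real.pi - 6 * σ)) ≤
      (∫⁻ t in Ioo (θ₀ + 2 * Real.pi / 3 - Real.pi) (θ₀ + 2 * Real.pi / 3 + Real.pi), w t) +
      ENNReal.ofReal σ⁻¹ *
        ∫⁻ t in Ioo (θ₀ + 2 * Real.pi / 3 - Real.pi) (θ₀ + 2 * Real.pi / 3 + Real.pi),
          ‖g t - stepMap θ₀ α β γ t‖ₑ := by
  have hpi := Real.pi_gt_three
  set I := Ioo (θ₀ + 2 * Real.pi / 3 - Real.pi) (θ₀ + 2 * Real.pi / 3 + Real.pi) with hI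
  set W := ⋃ q ∈ interfaceAngles θ₀, Ioo (q - σ) (q + σ) with hW
  have hWm : MeasurableSet W := Finset.measurableSet_biUnion _ fun _ _ => measurableSet_Ioo
  have hWI : W ⊆ I := windows_subset hσ1
  have hL : 0 ≤ L := h1 ▸ norm_nonneg _
  have hsum : ∀ f : ℝ → ENNReal, ∫⁻ t in W, f t =
      ∑ q ∈ interfaceAngles θ₀, ∫⁻ t in Ioo (q - σ) (q + σ), f t := fun f =>
    lintegral_biUnion_finset (pairwiseDisjoint_windows hσ1) (fun _ _ => measurableSet_Ioo) f
  -- Inside the windows `w` pays for the three jumps, through `‖g'‖ₑ ≤ w`.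
  have hjump : ENNReal.ofReal (3 * L) ≤ (∫⁻ t in W, w t) +
      ENNReal.ofReal σ⁻¹ * ∫⁻ t in W, ‖g t - stepMap θ₀ α β γ t‖ₑ := by
    rw [hsum, hsum, Finset.mul_sum, ← Finset.sum_add_distrib]
    have hterm : ∀ q ∈ interfaceAngles θ₀, ENNReal.ofReal L ≤
        (∫⁻ t in Ioo (q - σ) (q + σ), w t) + ENNReal.ofReal σ⁻¹ *
          ∫⁻ t in Ioo (q - σ) (q + σ), ‖g t - stepMap θ₀ α β γ t‖ₑ := by
      intro q hq
      obtain ⟨A, B, hAB, hA, hB⟩ := exists_stepMap_eq_near h1 h2 h3 hq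
      rw [← hAB]
      exact ofReal_norm_le_lintegral_add hg hc hσ
        (fun t ht => hA t ⟨by linarith [ht.1], ht.2⟩)
        (fun t ht => hB t ⟨ht.1, by linarith [ht.2]⟩) hw
    refine le_trans (le_of_eq ?_) (Finset.sum_le_sum hterm)
    rw [Finset.sum_const, card_interfaceAngles, nsmul_eq_mul, ENNReal.ofReal_mul (by norm_num)]
    simp
  -- Outside the windows, whose total length is at most `6σ`, the constant bound `ρ ≤ w` is used
  -- instead, so the two contributions add.
  have hrest : ENNReal.ofReal (ρ * (2 * Real.pi - 6 * σ)) ≤ ∫⁻ t in I \ W, w t := by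
    refine le_trans ?_ (lintegral_mono hwρ)
    rw [setLIntegral_const, ENNReal.ofReal_mul hρ]
    gcongr
    refine le_trans ?_ le_measure_sdiff
    rw [ENNReal.ofReal_sub _ (by positivity)]
    refine tsub_le_tsub (le_of_eq ?_) (volume_windows_le θ₀ σ)
    rw [hI, Real.volume_Ioo]; congr 1; ring
  rw [ENNReal.ofReal_add (by linarith) (by nlinarith), ← lintegral_inter_add_sdiff w I hWm,
    inter_eq_self_of_subset_right hWI]
  calc _ ≤ ((∫⁻ t in W, w t) + ENNReal.ofReal σ⁻¹ * ∫⁻ t in W, ‖g t - stepMap θ₀ α β γ t‖ₑ) +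
        ∫⁻ t in I \ W, w t := add_le_add hjump hrest
    _ ≤ ((∫⁻ t in W, w t) + ENNReal.ofReal σ⁻¹ * ∫⁻ t in I, ‖g t - stepMap θ₀ α β γ t‖ₑ) +
        ∫⁻ t in I \ W, w t := by
        gcongr
    _ = _ := by ring

/-- Closeness to the step map gives, just after each interface angle, a parameter at which the curve
is within `ε` of the corresponding vertex. By periodicity the curve may be started at the first of
these, and `abs_integral_loop_sub_le` applies. -/
lemma abs_circulation_sub_le {v : Plane → Plane} {ℓ r ε : ℝ}
    (hv : ContDiffOn ℝ 1 v (Metric.ball 0 ℓ)) (hr : |r| < ℓ)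
    (hα : ‖α‖ = 1) (hβ : ‖β‖ = 1) (hγ : ‖γ‖ = 1) (h1 : ‖α - γ‖ = L) (h2 : ‖β - α‖ = L)
    (h3 : ‖γ - β‖ = L) (hsum : α + β + γ = 0) (hε0 : 0 ≤ ε) (hε1 : ε ≤ 1) (hεL : 2 * ε < L)
    (hlen : ∫⁻ t in Ioo (θ₀ + 2 * Real.pi / 3 - Real.pi) (θ₀ + 2 * Real.pi / 3 + Real.pi),
      ‖angDeriv v r t‖ₑ ≤ ENNReal.ofReal (3 * L + ε))
    (hD : ∫⁻ t in Ioo (θ₀ + 2 * Real.pi / 3 - Real.pi) (θ₀ + 2 * Real.pi / 3 + Real.pi),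
      ‖v (pol r t) - stepMap θ₀ α β γ t‖ₑ ≤ ENNReal.ofReal ε) :
    |circulation v (θ₀ + 2 * Real.pi / 3 - Real.pi) r - 3 * cross α β| ≤ 3 * arcError L ε := by
  have hpi := Real.pi_gt_three
  have hgc := continuous_circle hv hr
  have hdc := continuous_angDeriv hv hr
  -- Intervals of length one make the averaging factor `1` and stay inside one sector, since `2π/3 >
  -- 1`.
  have pick : ∀ (q : ℝ) (A : Plane), q ∈ interfaceAngles θ₀ →
      (∀ t ∈ Ioo q (q + 1), stepMap θ₀ α β γ t = A) →
      ∃ t ∈ Ioo q (q + 1), ‖v (pol r t) - A‖ ≤ ε := by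
    intro q A hq hA
    obtain ⟨t, ht, htA⟩ := exists_enorm_sub_le (show q < q + 1 by linarith) hgc A
    refine ⟨t, ht, ?_⟩
    rw [← ENNReal.ofReal_le_ofReal_iff hε0, ofReal_norm]
    refine htA.trans (le_trans ?_ hD)
    rw [add_sub_cancel_left, inv_one, ENNReal.ofReal_one, one_mul]
    rw [setLIntegral_congr_fun (g := fun t => ‖v (pol r t) - stepMap θ₀ α β γ t‖ₑ)
      measurableSet_Ioo fun x hx => by simp only [hA x hx]]
    refine lintegral_mono_set (subset_trans ?_ (windows_subset (σ := 1) le_rfl))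
    exact (Ioo_subset_Ioo_left (by linarith)).trans
      (subset_biUnion_of_mem (u := fun q => Ioo (q - 1) (q + 1)) (Finset.mem_coe.2 hq))
  obtain ⟨t₁, ht1, hg1⟩ := pick θ₀ α (by simp [interfaceAngles]) fun t ht => by
    rw [stepMap, if_neg (by linarith [ht.1]), if_pos (by linarith [ht.2])]
  obtain ⟨t₂, ht2, hg2⟩ := pick (θ₀ + 2 * Real.pi / 3) β (by simp [interfaceAngles])
    fun t ht => by
      rw [stepMap, if_neg (by linarith [ht.1]), if_neg (by linarith [ht.1]),
        if_pos (by linarith [ht.2])]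
  obtain ⟨t₃, ht3, hg3⟩ := pick (θ₀ + 4 * Real.pi / 3) γ (by simp [interfaceAngles])
    fun t ht => by
      rw [stepMap, if_neg (by linarith [ht.1]), if_neg (by linarith [ht.1]),
        if_neg (by linarith [ht.1])]
  have hper : Function.Periodic (fun t => v (pol r t)) (2 * Real.pi) := fun t => by
    simp only [pol_add_two_pi]
  have hper' : Function.Periodic (angDeriv v r) (2 * Real.pi) := fun t => by
    have : angDir (t + 2 * Real.pi) = angDir t := by apply plane_ext <;> simp
    simp only [angDeriv, pol_add_two_pi, this]
  have hlen' : ∫ t in t₁..(t₁ + 2 * Real.pi), ‖angDeriv v r t‖ ≤ 3 * L + ε := by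
    have hp : Function.Periodic (fun t => ‖angDeriv v r t‖) (2 * Real.pi) := fun t => by
      simp only [hper' t]
    rw [hp.intervalIntegral_add_eq t₁ (θ₀ + 2 * Real.pi / 3 - Real.pi),
      intervalIntegral.integral_of_le (by linarith), integral_Ioc_eq_integral_Ioo,
      integral_norm_eq_lintegral_enorm hdc.aestronglyMeasurable]
    refine ENNReal.toReal_le_of_le_ofReal (by linarith) ?_
    rwa [show θ₀ + 2 * Real.pi / 3 - Real.pi + 2 * Real.pi = θ₀ + 2 * Real.pi / 3 + Real.pi by ring]
  have key := abs_integral_loop_sub_le (t₄ := t₁ + 2 * Real.pi) (by linarith [ht1.2, ht2.1])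
    (by linarith [ht2.2, ht3.1]) (by linarith [ht1.1, ht3.2]) (hasDerivAt_angular hv hr) hdc
    hα hβ hγ h2 h3 h1 hsum hε0 hε1 hεL hg1 hg2 hg3 (hper t₁) hlen'
  have hp : Function.Periodic (fun t => cross (v (pol r t)) (angDeriv v r t)) (2 * Real.pi) :=
    fun t => by simp only [hper' t, pol_add_two_pi]
  rw [circulation, hp.intervalIntegral_add_eq _ t₁]
  exact key

end Slices

end TripleJunction

/-! ### Slicing area, total variation and `L¹` distance by circles. -/

namespace TripleJunction

section Circles

variable {v u : Plane → Plane} {ℓ θ₀ L : ℝ} {α β γ : Plane}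

/-- The contribution of the circle of radius `r` to the area functional. -/
noncomputable def circleArea (v : Plane → Plane) (c r : ℝ) : ENNReal :=
  ∫⁻ θ in Ioo (c - Real.pi) (c + Real.pi), ENNReal.ofReal r * ENNReal.ofReal
    (Real.sqrt (1 + (∑ i, ∑ j, (grad v (pol r θ) i j) ^ 2) + (grad v (pol r θ)).det ^ 2))

/-- The length of the image of the circle of radius `r`. -/
noncomputable def circleLength (v : Plane → Plane) (c r : ℝ) : ENNReal :=
  ∫⁻ θ in Ioo (c - Real.pi) (c + Real.pi), ‖angDeriv v r θ‖ₑ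

/-- The distance of a map from the step map on the circle of radius `r`. -/
noncomputable def circleDist (v : Plane → Plane) (θ₀ : ℝ) (α β γ : Plane) (r : ℝ) : ENNReal :=
  ∫⁻ θ in Ioo (θ₀ + 2 * Real.pi / 3 - Real.pi) (θ₀ + 2 * Real.pi / 3 + Real.pi),
    ‖v (pol r θ) - stepMap θ₀ α β γ θ‖ₑ

lemma measurable_areaDensity_polar (v : Plane → Plane) : Measurable fun p : ℝ × ℝ =>
    ENNReal.ofReal p.1 * ENNReal.ofReal (Real.sqrt (1 + (∑ i, ∑ j,
      (grad v (pol p.1 p.2) i j) ^ 2) + (grad v (pol p.1 p.2)).det ^ 2)) := by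
  have h1 : Measurable fun x => Real.sqrt (1 + (∑ i, ∑ j, (grad v x i j) ^ 2) +
      (grad v x).det ^ 2) :=
    ((measurable_const.add (Finset.measurable_fun_sum _ fun i _ =>
      Finset.measurable_fun_sum _ fun j _ => (measurable_grad v i j).pow_const 2)).add
      ((measurable_det_grad v).pow_const 2)).sqrt
  exact measurable_fst.ennreal_ofReal.mul (h1.comp measurable_pol).ennreal_ofReal

lemma measurable_angDeriv (v : Plane → Plane) :
    Measurable fun p : ℝ × ℝ => angDeriv v p.1 p.2 := by
  have e : ∀ p : ℝ × ℝ, angDeriv v p.1 p.2 = p.1 •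
      ((-Real.sin p.2) • fderiv ℝ v (pol p.1 p.2) (EuclideanSpace.single 0 1) +
        Real.cos p.2 • fderiv ℝ v (pol p.1 p.2) (EuclideanSpace.single 1 1)) := by
    intro p
    have e2 : angDir p.2 = (-Real.sin p.2) • EuclideanSpace.single 0 (1 : ℝ) +
        Real.cos p.2 • EuclideanSpace.single 1 (1 : ℝ) := by
      apply plane_ext <;> simp
    rw [angDeriv, e2, map_add, map_smul, map_smul]
  simp_rw [e]
  have hd : ∀ w : Plane, Measurable fun p : ℝ × ℝ => fderiv ℝ v (pol p.1 p.2) w := fun w =>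
    (measurable_fderiv_apply_const ℝ v w).comp measurable_pol
  exact measurable_fst.smul (((Real.measurable_sin.comp measurable_snd).neg.smul (hd _)).add
    ((Real.measurable_cos.comp measurable_snd).smul (hd _)))

lemma measurable_circleArea (v : Plane → Plane) (c : ℝ) : Measurable (circleArea v c) :=
  (measurable_areaDensity_polar v).lintegral_prod_right'

lemma measurable_circleLength (v : Plane → Plane) (c : ℝ) : Measurable (circleLength v c) :=
  (measurable_angDeriv v).enorm.lintegral_prod_right'

lemma area_ball_eq (v : Plane → Plane) (c ℓ : ℝ) :
    area v (Metric.ball 0 ℓ) = ∫⁻ r in Ioo 0 ℓ, circleArea v c r := by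
  rw [area, lintegral_ball_polar c, Measure.volume_eq_prod, ← Measure.prod_restrict,
    lintegral_prod _ (measurable_areaDensity_polar v).aemeasurable]
  rfl

/-- The density dominates `1`, the angular derivative and the determinant separately; these three
bounds serve the bulk, the interfaces and the core respectively. -/
lemma ofReal_le_areaDensity (v : Plane → Plane) (r θ : ℝ) :
    ENNReal.ofReal r ≤ ENNReal.ofReal r * ENNReal.ofReal
      (Real.sqrt (1 + (∑ i, ∑ j, (grad v (pol r θ) i j) ^ 2) + (grad v (pol r θ)).det ^ 2)) := by
  conv_lhs => rw [← mul_one (ENNReal.ofReal r), ← ENNReal.ofReal_one]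
  gcongr
  apply Real.le_sqrt_of_sq_le
  rw [← gradNorm_sq]
  nlinarith [sq_nonneg (gradNorm v (pol r θ)), sq_nonneg (grad v (pol r θ)).det]

lemma enorm_angDeriv_le {r : ℝ} (hr : 0 ≤ r) (θ : ℝ) :
    ‖angDeriv v r θ‖ₑ ≤ ENNReal.ofReal r * ENNReal.ofReal (gradNorm v (pol r θ)) := by
  rw [← ofReal_norm, ← ENNReal.ofReal_mul hr, angDeriv, norm_smul, Real.norm_of_nonneg hr]
  exact ENNReal.ofReal_le_ofReal
    (mul_le_mul_of_nonneg_left (norm_fderiv_angDir_le v _ θ) hr)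

lemma enorm_angDeriv_le_areaDensity {r : ℝ} (hr : 0 ≤ r) (θ : ℝ) :
    ‖angDeriv v r θ‖ₑ ≤ ENNReal.ofReal r * ENNReal.ofReal
      (Real.sqrt (1 + (∑ i, ∑ j, (grad v (pol r θ) i j) ^ 2) + (grad v (pol r θ)).det ^ 2)) := by
  refine (enorm_angDeriv_le hr θ).trans ?_
  gcongr
  apply Real.le_sqrt_of_sq_le
  rw [← gradNorm_sq]
  nlinarith [sq_nonneg (grad v (pol r θ)).det]

lemma enorm_cross_le_areaDensity {r : ℝ} (hr : 0 ≤ r) (θ : ℝ) :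
    ‖cross (radDeriv v r θ) (angDeriv v r θ)‖ₑ ≤ ENNReal.ofReal r * ENNReal.ofReal
      (Real.sqrt (1 + (∑ i, ∑ j, (grad v (pol r θ) i j) ^ 2) + (grad v (pol r θ)).det ^ 2)) := by
  rw [radDeriv, angDeriv, cross_smul_right, ← det_grad_eq, ← ofReal_norm, norm_mul,
    Real.norm_of_nonneg hr, ← ENNReal.ofReal_mul hr]
  apply ENNReal.ofReal_le_ofReal
  apply mul_le_mul_of_nonneg_left _ hr
  apply Real.le_sqrt_of_sq_le
  rw [← gradNorm_sq, Real.norm_eq_abs, sq_abs]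
  nlinarith [sq_nonneg (gradNorm v (pol r θ))]

/-- The angular derivative is one part of the gradient. Closeness of total variations enters the
lower bound only through this inequality. -/
lemma lintegral_circleLength_le (hv : ContDiffOn ℝ 1 v (Metric.ball 0 ℓ)) (c : ℝ) :
    ∫⁻ r in Ioo 0 ℓ, circleLength v c r ≤ totalVariation v (Metric.ball 0 ℓ) := by
  refine le_trans ?_ (lintegral_gradNorm_ball_le_totalVariation hv)
  have hm : Measurable fun p : ℝ × ℝ =>
      ENNReal.ofReal p.1 * ENNReal.ofReal (gradNorm v (pol p.1 p.2)) :=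
    measurable_fst.ennreal_ofReal.mul ((measurable_gradNorm v).comp measurable_pol).ennreal_ofReal
  rw [lintegral_ball_polar c, Measure.volume_eq_prod, ← Measure.prod_restrict,
    lintegral_prod _ hm.aemeasurable]
  refine setLIntegral_mono' measurableSet_Ioo fun r hr => ?_
  exact lintegral_mono fun θ => enorm_angDeriv_le hr.1.le θ

lemma measurable_stepMap (θ₀ : ℝ) (α β γ : Plane) : Measurable (stepMap θ₀ α β γ) :=
  Measurable.ite measurableSet_Iio measurable_const
    (Measurable.ite measurableSet_Iio measurable_const
      (Measurable.ite measurableSet_Iio measurable_const measurable_const))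

/-- On radii above `a` the polar weight `r` is at least `a`, which costs the factor `a⁻¹`. -/
lemma IsJunctionAt.lintegral_circleDist_le (h : IsJunctionAt u ℓ θ₀ α β γ)
    (hv : ContDiffOn ℝ 1 v (Metric.ball 0 ℓ)) {a : ℝ} (ha : 0 < a) :
    ∫⁻ r in Ioo a ℓ, circleDist v θ₀ α β γ r ≤
      ENNReal.ofReal a⁻¹ * ∫⁻ x in Metric.ball 0 ℓ, ‖v x - u x‖ₑ := by
  set c := θ₀ + 2 * Real.pi / 3 with hc
  set I := Ioo (c - Real.pi) (c + Real.pi) with hI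
  have hcont : ContinuousOn (fun p : ℝ × ℝ => v (pol p.1 p.2)) (Ioo 0 ℓ ×ˢ I) :=
    hv.continuousOn.comp continuous_pol.continuousOn fun p hp =>
      pol_mem_ball (by rw [abs_of_pos hp.1.1]; exact hp.1.2)
  have hm : AEMeasurable (fun p : ℝ × ℝ =>
      ENNReal.ofReal p.1 * ‖v (pol p.1 p.2) - stepMap θ₀ α β γ p.2‖ₑ)
      ((volume.restrict (Ioo 0 ℓ)).prod (volume.restrict I)) := by
    rw [Measure.prod_restrict]
    exact measurable_fst.ennreal_ofReal.aemeasurable.mul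
      (((hcont.aemeasurable (measurableSet_Ioo.prod measurableSet_Ioo)).sub
        ((measurable_stepMap θ₀ α β γ).comp measurable_snd).aemeasurable).enorm)
  have hnull : ∀ᵐ p ∂(volume : Measure (ℝ × ℝ)), p.2 ∉ (interfaceAngles θ₀ : Set ℝ) := by
    rw [Measure.volume_eq_prod]
    have h0 : ∀ᵐ θ : ℝ, θ ∉ (interfaceAngles θ₀ : Set ℝ) :=
      measure_eq_zero_iff_ae_notMem.1 ((interfaceAngles θ₀).finite_toSet.measure_zero _)
    exact Measure.quasiMeasurePreserving_snd.ae h0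
  have heq : ∫⁻ x in Metric.ball 0 ℓ, ‖v x - u x‖ₑ =
      ∫⁻ p in Ioo 0 ℓ ×ˢ I, ENNReal.ofReal p.1 * ‖v (pol p.1 p.2) - stepMap θ₀ α β γ p.2‖ₑ := by
    rw [lintegral_ball_polar c]
    refine lintegral_congr_ae ?_
    filter_upwards [ae_restrict_of_ae hnull,
      ae_restrict_mem (measurableSet_Ioo.prod measurableSet_Ioo)] with p hp hmem
    rw [h.eq_stepMap hmem.1 ⟨hmem.2.1, hmem.2.2.le⟩ (by simpa using hp)]
  rw [heq, Measure.volume_eq_prod, ← Measure.prod_restrict, lintegral_prod _ hm]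
  calc ∫⁻ r in Ioo a ℓ, circleDist v θ₀ α β γ r
      ≤ ∫⁻ r in Ioo a ℓ, ENNReal.ofReal a⁻¹ * ∫⁻ θ in I,
          ENNReal.ofReal r * ‖v (pol r θ) - stepMap θ₀ α β γ θ‖ₑ := by
        refine setLIntegral_mono' measurableSet_Ioo fun r hr => ?_
        rw [lintegral_const_mul' _ _ ENNReal.ofReal_ne_top, ← mul_assoc,
          ← ENNReal.ofReal_mul (by positivity)]
        refine le_mul_of_one_le_left (zero_le) ?_
        rw [ENNReal.one_le_ofReal, inv_mul_eq_div, one_le_div ha]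
        exact hr.1.le
    _ = ENNReal.ofReal a⁻¹ * ∫⁻ r in Ioo a ℓ, ∫⁻ θ in I,
          ENNReal.ofReal r * ‖v (pol r θ) - stepMap θ₀ α β γ θ‖ₑ :=
        lintegral_const_mul' _ _ ENNReal.ofReal_ne_top
    _ ≤ _ := by
        gcongr

/-- The slice bound with `σ = 1` and `ρ = 0`, so that only the jumps count. -/
lemma ofReal_le_circleLength_add (hv : ContDiffOn ℝ 1 v (Metric.ball 0 ℓ)) {r : ℝ}
    (hr : r ∈ Ioo 0 ℓ) (h1 : ‖α - γ‖ = L) (h2 : ‖β - α‖ = L) (h3 : ‖γ - β‖ = L) :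
    ENNReal.ofReal (3 * L) ≤ circleLength v (θ₀ + 2 * Real.pi / 3) r +
      circleDist v θ₀ α β γ r := by
  have hr' : |r| < ℓ := by rw [abs_of_pos hr.1]; exact hr.2
  have := ofReal_le_lintegral_slice (θ₀ := θ₀) (hasDerivAt_angular hv hr')
    (continuous_angDeriv hv hr') h1 h2 h3 one_pos le_rfl le_rfl (fun _ => le_rfl)
    (fun t => by simp)
  simpa [circleLength, circleDist] using this

lemma ofReal_le_circleArea_add (hv : ContDiffOn ℝ 1 v (Metric.ball 0 ℓ)) {r σ : ℝ}
    (hr : r ∈ Ioo 0 ℓ) (h1 : ‖α - γ‖ = L) (h2 : ‖β - α‖ = L) (h3 : ‖γ - β‖ = L) (hσ : 0 < σ)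
    (hσ1 : σ ≤ 1) :
    ENNReal.ofReal (3 * L + r * (2 * Real.pi - 6 * σ)) ≤
      circleArea v (θ₀ + 2 * Real.pi / 3) r +
      ENNReal.ofReal σ⁻¹ * circleDist v θ₀ α β γ r := by
  have hr' : |r| < ℓ := by rw [abs_of_pos hr.1]; exact hr.2
  exact ofReal_le_lintegral_slice (hasDerivAt_angular hv hr')
    (continuous_angDeriv hv hr') h1 h2 h3 hσ hσ1 hr.1.le
    (fun t => enorm_angDeriv_le_areaDensity hr.1.le t) (fun t => ofReal_le_areaDensity v r t)

lemma enorm_circulation_le_circleArea (hv : ContDiffOn ℝ 1 v (Metric.ball 0 ℓ)) {r : ℝ}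
    (hr : r ∈ Ioo 0 ℓ) (c : ℝ) :
    ‖circulation v (c - Real.pi) r‖ₑ ≤ 2 * ∫⁻ s in Ioo 0 r, circleArea v c s := by
  refine (enorm_circulation_le hv hr.1 hr.2 _).trans ?_
  rw [← lintegral_const_mul' _ _ ENNReal.ofNat_ne_top,
    show c - Real.pi + 2 * Real.pi = c + Real.pi by ring]
  refine setLIntegral_mono' measurableSet_Ioo fun s hs => ?_
  rw [lintegral_const_mul' _ _ ENNReal.ofNat_ne_top]
  gcongr
  exact lintegral_mono fun θ => enorm_cross_le_areaDensity hs.1.le θ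

/-- If `F` exceeded `A + ε` on all of `(δ, 2δ)`, an interval of length `δ`, its integral would carry
the extra amount `εδ`. -/
lemma exists_le_of_lintegral_lt {F : ℝ → ENNReal} {A ε δ δ' : ℝ} (hA : 0 ≤ A) (hε : 0 ≤ ε)
    (hδ : 0 < δ) (hδ' : δ' ≤ δ) (hδℓ : 2 * δ ≤ ℓ)
    (hF : ∀ r ∈ Ioo δ' ℓ, ENNReal.ofReal A ≤ F r)
    (hint : ∫⁻ r in Ioo δ' ℓ, F r < ENNReal.ofReal (A * (ℓ - δ') + ε * δ)) :
    ∃ r ∈ Ioo δ (2 * δ), F r ≤ ENNReal.ofReal (A + ε) := by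
  by_contra! hcon
  refine hint.not_ge ?_
  calc ENNReal.ofReal (A * (ℓ - δ') + ε * δ)
      = ∫⁻ r in Ioo δ' ℓ, (ENNReal.ofReal A +
          (Ioo δ (2 * δ)).indicator (fun _ => ENNReal.ofReal ε) r) := by
        rw [lintegral_add_left measurable_const, setLIntegral_const,
          lintegral_indicator measurableSet_Ioo, setLIntegral_const,
          Measure.restrict_apply measurableSet_Ioo,
          inter_eq_self_of_subset_left (Ioo_subset_Ioo hδ' hδℓ), Real.volume_Ioo,
          Real.volume_Ioo, ← ENNReal.ofReal_mul hA, ← ENNReal.ofReal_mul hε,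
          ← ENNReal.ofReal_add (by nlinarith) (by nlinarith)]
        congr 1; ring
    _ ≤ _ := by
        refine setLIntegral_mono' measurableSet_Ioo fun r hr => ?_
        by_cases hm : r ∈ Ioo δ (2 * δ)
        · rw [indicator_of_mem hm, ← ENNReal.ofReal_add hA hε]
          exact (hcon r hm).le
        · rw [indicator_of_notMem hm, add_zero]
          exact hF r hr

lemma lintegral_ofReal_affine {a b A B : ℝ} (hab : a ≤ b) (ha : 0 ≤ a) (hA : 0 ≤ A)
    (hB : 0 ≤ B) : ∫⁻ r in Ioo a b, ENNReal.ofReal (A + r * B) =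
      ENNReal.ofReal (A * (b - a) + B * (b ^ 2 - a ^ 2) / 2) := by
  have hi : IntervalIntegrable (fun r => A + r * B) volume a b :=
    Continuous.intervalIntegrable (by fun_prop) _ _
  rw [← ofReal_integral_eq_lintegral_ofReal
    (((intervalIntegrable_iff_integrableOn_Ioc_of_le hab).1 hi).mono_set Ioo_subset_Ioc_self)
    ((ae_restrict_mem measurableSet_Ioo).mono fun r hr => by
      have : 0 ≤ r := ha.trans hr.1.le
      positivity), ← integral_Ioc_eq_integral_Ioo,
    ← intervalIntegral.integral_of_le hab, intervalIntegral.integral_add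
      (Continuous.intervalIntegrable (by fun_prop) _ _)
      (Continuous.intervalIntegrable (by fun_prop) _ _), intervalIntegral.integral_const,
    intervalIntegral.integral_mul_const, integral_id]
  congr 1
  rw [smul_eq_mul]; ring

end Circles

end TripleJunction

/-! ### Choice of a good circle and the lower bound. -/

namespace TripleJunction

section LowerBound

variable {v u : Plane → Plane} {ℓ θ₀ L : ℝ} {α β γ : Plane}

/-- A map close to the triple junction in the strict sense has a small circle on which its length
nearly equals the perimeter of the triangle and on which it is close to the step map. -/
lemma IsJunctionAt.exists_good_circle (h : IsJunctionAt u ℓ θ₀ α β γ)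
    (hv : ContDiffOn ℝ 1 v (Metric.ball 0 ℓ)) (h1 : ‖α - γ‖ = L) (h2 : ‖β - α‖ = L)
    (h3 : ‖γ - β‖ = L) {ε δ δ' M κ : ℝ} (hε : 0 < ε) (hδ' : 0 < δ') (hδδ' : δ' ≤ δ)
    (hδℓ : 2 * δ ≤ ℓ) (hM1 : 1 ≤ M) (hM : 3 * L + ε ≤ M * ε) (hκ : 0 ≤ κ)
    (hsmall : 3 * L * δ' + κ + M * (δ'⁻¹ * κ) < ε * δ)
    (hdist : ∫⁻ x in Metric.ball 0 ℓ, ‖v x - u x‖ₑ ≤ ENNReal.ofReal κ)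
    (hTV : totalVariation v (Metric.ball 0 ℓ) ≤ ENNReal.ofReal (3 * L * ℓ + κ)) :
    ∃ r ∈ Ioo δ (2 * δ),
      circleLength v (θ₀ + 2 * Real.pi / 3) r ≤ ENNReal.ofReal (3 * L + ε) ∧
      circleDist v θ₀ α β γ r ≤ ENNReal.ofReal ε := by
  have hL : 0 ≤ L := h1 ▸ norm_nonneg _
  have hM0 : 0 < M := by linarith
  have hδ : 0 < δ := hδ'.trans_le hδδ'
  set c := θ₀ + 2 * Real.pi / 3 with hc
  -- Length and distance are combined with a large weight `M` on the distance, so that one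
  -- inequality, sum at most `3L + ε`, bounds both: the distance is then at most `(3L + ε)/M ≤ ε`.
  have hF : ∀ r ∈ Ioo δ' ℓ, ENNReal.ofReal (3 * L) ≤
      circleLength v c r + ENNReal.ofReal M * circleDist v θ₀ α β γ r := fun r hr => by
    refine (ofReal_le_circleLength_add (θ₀ := θ₀) hv ⟨hδ'.trans hr.1, hr.2⟩ h1 h2 h3).trans ?_
    gcongr
    exact le_mul_of_one_le_left zero_le (ENNReal.one_le_ofReal.2 hM1)
  have hint : ∫⁻ r in Ioo δ' ℓ, (circleLength v c r +
      ENNReal.ofReal M * circleDist v θ₀ α β γ r) <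
      ENNReal.ofReal (3 * L * (ℓ - δ') + ε * δ) := by
    rw [lintegral_add_left (measurable_circleLength v c),
      lintegral_const_mul' _ _ ENNReal.ofReal_ne_top]
    calc _ ≤ ENNReal.ofReal (3 * L * ℓ + κ) +
          ENNReal.ofReal M * (ENNReal.ofReal δ'⁻¹ * ENNReal.ofReal κ) := by
          refine add_le_add ?_ ?_
          · exact (lintegral_mono_set (Ioo_subset_Ioo_left hδ'.le)).trans
              ((lintegral_circleLength_le hv c).trans hTV)
          · gcongr
            refine (h.lintegral_circleDist_le hv hδ').trans ?_
            gcongr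
      _ = ENNReal.ofReal (3 * L * ℓ + κ + M * (δ'⁻¹ * κ)) := by
          rw [← ENNReal.ofReal_mul (by positivity), ← ENNReal.ofReal_mul hM0.le,
            ← ENNReal.ofReal_add (by nlinarith) (by positivity)]
      _ < _ := by
          rw [ENNReal.ofReal_lt_ofReal_iff (by nlinarith)]
          linarith
  obtain ⟨r, hr, hle⟩ := exists_le_of_lintegral_lt (by positivity) hε.le hδ hδδ' hδℓ hF hint
  refine ⟨r, hr, le_self_add.trans hle, ?_⟩
  have h4 : ENNReal.ofReal M * circleDist v θ₀ α β γ r ≤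
      ENNReal.ofReal M * ENNReal.ofReal ε := by
    rw [← ENNReal.ofReal_mul hM0.le]
    exact (le_add_self.trans hle).trans (ENNReal.ofReal_le_ofReal hM)
  exact (ENNReal.mul_le_mul_iff_right (ENNReal.ofReal_pos.2 hM0).ne' ENNReal.ofReal_ne_top).1 h4

/-- The area is at least the area spanned by one image circle plus the contribution of the
exterior of that circle. -/
lemma IsJunctionAt.ofReal_le_area (h : IsJunctionAt u ℓ θ₀ α β γ)
    (hv : ContDiffOn ℝ 1 v (Metric.ball 0 ℓ)) (h1 : ‖α - γ‖ = L) (h2 : ‖β - α‖ = L)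
    (h3 : ‖γ - β‖ = L) {σ δ r κ : ℝ} (hσ : 0 < σ) (hσ1 : σ ≤ 1) (hδℓ : 2 * δ ≤ ℓ) (hδ : 0 < δ)
    (hr : r ∈ Ioo δ (2 * δ)) (hκ : 0 ≤ κ)
    (hdist : ∫⁻ x in Metric.ball 0 ℓ, ‖v x - u x‖ₑ ≤ ENNReal.ofReal κ) :
    ENNReal.ofReal (|circulation v (θ₀ + 2 * Real.pi / 3 - Real.pi) r| / 2 +
      (3 * L * (ℓ - 2 * δ) + (2 * Real.pi - 6 * σ) * (ℓ ^ 2 - (2 * δ) ^ 2) / 2) -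
      σ⁻¹ * ((2 * δ)⁻¹ * κ)) ≤ area v (Metric.ball 0 ℓ) := by
  have hpi := Real.pi_gt_three
  have hL : 0 ≤ L := h1 ▸ norm_nonneg _
  set c := θ₀ + 2 * Real.pi / 3 with hc
  -- Inside the circle the determinant bound and Green's formula are used; outside radius `2δ` the
  -- slice bound. The annulus between `r` and `2δ` is dropped.
  have hinner : ENNReal.ofReal (|circulation v (c - Real.pi) r| / 2) ≤
      ∫⁻ s in Ioo 0 r, circleArea v c s := by
    have h4 := enorm_circulation_le_circleArea hv ⟨hδ.trans hr.1, hr.2.trans_le hδℓ⟩ c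
    rw [ENNReal.ofReal_div_of_pos two_pos, ← Real.norm_eq_abs, ofReal_norm, ENNReal.ofReal_ofNat]
    exact ENNReal.div_le_of_le_mul' h4
  have houter : ENNReal.ofReal (3 * L * (ℓ - 2 * δ) +
      (2 * Real.pi - 6 * σ) * (ℓ ^ 2 - (2 * δ) ^ 2) / 2) ≤
      (∫⁻ s in Ioo (2 * δ) ℓ, circleArea v c s) + ENNReal.ofReal (σ⁻¹ * ((2 * δ)⁻¹ * κ)) := by
    rw [← lintegral_ofReal_affine hδℓ (by positivity) (by positivity) (by linarith)]
    calc _ ≤ ∫⁻ s in Ioo (2 * δ) ℓ, (circleArea v c s +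
          ENNReal.ofReal σ⁻¹ * circleDist v θ₀ α β γ s) :=
          setLIntegral_mono' measurableSet_Ioo fun s hs => ofReal_le_circleArea_add hv
            ⟨(by positivity : 0 < 2 * δ).trans hs.1, hs.2⟩ h1 h2 h3 hσ hσ1
      _ = (∫⁻ s in Ioo (2 * δ) ℓ, circleArea v c s) +
          ENNReal.ofReal σ⁻¹ * ∫⁻ s in Ioo (2 * δ) ℓ, circleDist v θ₀ α β γ s := by
          rw [lintegral_add_left (measurable_circleArea v c),
            lintegral_const_mul' _ _ ENNReal.ofReal_ne_top]
      _ ≤ _ := by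
          rw [ENNReal.ofReal_mul (by positivity), ENNReal.ofReal_mul (by positivity)]
          gcongr
          refine (h.lintegral_circleDist_le hv (by positivity)).trans ?_
          gcongr
  rw [ENNReal.ofReal_sub _ (by positivity)]
  refine tsub_le_iff_right.2 ?_
  rw [ENNReal.ofReal_add (by positivity) (by
    have : 0 ≤ ℓ ^ 2 - (2 * δ) ^ 2 := by nlinarith
    have : 0 ≤ 2 * Real.pi - 6 * σ := by linarith
    have : 0 ≤ ℓ - 2 * δ := by linarith
    positivity), area_ball_eq v c]
  refine (add_le_add hinner houter).trans ?_
  rw [← add_assoc, ← lintegral_union measurableSet_Ioo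
    (Set.disjoint_left.2 fun x hx hx' => (hx.2.trans (hr.2.trans hx'.1)).false)]
  gcongr
  exact union_subset (Ioo_subset_Ioo_right (by linarith [hr.2]))
    (Ioo_subset_Ioo_left (by positivity))

/-- The removed disk of radius `2δ` costs `4πδ² ≤ 8δℓ`, by `π ≤ 4` and `2δ ≤ ℓ`, and the lost piece
of the interfaces costs `6Lδ`. -/
lemma exterior_area_bound {σ δ : ℝ} (hσ : 0 ≤ σ) (hδ : 0 ≤ δ) (hδℓ : 2 * δ ≤ ℓ) (L : ℝ) :
    Real.pi * ℓ ^ 2 + 3 * L * ℓ - 3 * σ * ℓ ^ 2 - δ * (6 * L + 8 * ℓ) ≤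
      3 * L * (ℓ - 2 * δ) + (2 * Real.pi - 6 * σ) * (ℓ ^ 2 - (2 * δ) ^ 2) / 2 := by
  have h1 : Real.pi * δ ^ 2 ≤ 4 * δ ^ 2 :=
    mul_le_mul_of_nonneg_right Real.pi_le_four (sq_nonneg δ)
  have h2 : δ * (2 * δ) ≤ δ * ℓ := mul_le_mul_of_nonneg_left hδℓ hδ
  have h3 : 0 ≤ σ * δ ^ 2 := mul_nonneg hσ (sq_nonneg δ)
  linarith

/-- The error `ξ` is shared equally among four losses: the arc error, the windows `σ`, the core `δ`,
and the `L¹` distance `κ`. The threshold `κ` is fixed last, so it may depend on all other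
parameters. -/
lemma IsJunctionAt.exists_forall_ofReal_le_area (h : IsJunctionAt u ℓ θ₀ α β γ) (hℓ : 0 < ℓ)
    (hα : ‖α‖ = 1) (hβ : ‖β‖ = 1) (hγ : ‖γ‖ = 1) (hL : 0 < L) (h1 : ‖α - γ‖ = L)
    (h2 : ‖β - α‖ = L) (h3 : ‖γ - β‖ = L) (hsum : α + β + γ = 0) {ξ : ℝ} (hξ : 0 < ξ) :
    ∃ κ > 0, ∀ v : Plane → Plane, ContDiffOn ℝ 1 v (Metric.ball 0 ℓ) →
      ∫⁻ x in Metric.ball 0 ℓ, ‖v x - u x‖ₑ ≤ ENNReal.ofReal κ →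
      totalVariation v (Metric.ball 0 ℓ) ≤ ENNReal.ofReal (3 * L * ℓ + κ) →
      ENNReal.ofReal (Real.pi * ℓ ^ 2 + 3 * L * ℓ + 3 / 2 * |cross α β| - ξ) ≤
        area v (Metric.ball 0 ℓ) := by
  have hpi := Real.pi_gt_three
  obtain ⟨ε, ⟨hε, hε1, hεL⟩, hεarc⟩ : ∃ ε : ℝ, (0 < ε ∧ ε ≤ 1 ∧ 2 * ε < L) ∧
      -- The three arcs lose `3 · ξ/6`, halved when the circulation becomes an area: `ξ/4`.
      arcError L ε < ξ / 6 := by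
    have e1 : ∀ᶠ ε in 𝓝[>] (0 : ℝ), arcError L ε < ξ / 6 :=
      nhdsWithin_le_nhds ((tendsto_arcError L).eventually (gt_mem_nhds (by positivity)))
    have e2 : ∀ᶠ ε in 𝓝[>] (0 : ℝ), ε ∈ Ioo 0 (min 1 (L / 2)) :=
      Ioo_mem_nhdsGT (by positivity)
    obtain ⟨ε, ha, hb⟩ := (e1.and e2).exists
    refine ⟨ε, ⟨hb.1, (hb.2.trans_le (min_le_left _ _)).le, ?_⟩, ha⟩
    linarith [hb.2.trans_le (min_le_right _ _)]
  obtain ⟨σ, hσ, hσ1, hσξ⟩ : ∃ σ : ℝ, 0 < σ ∧ σ ≤ 1 ∧ 3 * σ * ℓ ^ 2 ≤ ξ / 4 := by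
    refine ⟨min 1 (ξ / (12 * ℓ ^ 2)), by positivity, min_le_left _ _, ?_⟩
    have := min_le_right 1 (ξ / (12 * ℓ ^ 2))
    rw [le_div_iff₀ (by positivity)] at this
    linarith
  obtain ⟨δ, hδ, hδℓ, hδξ⟩ : ∃ δ : ℝ, 0 < δ ∧ 2 * δ ≤ ℓ ∧ δ * (6 * L + 8 * ℓ) ≤ ξ / 4 := by
    refine ⟨min (ℓ / 2) (ξ / 4 / (6 * L + 8 * ℓ)), by positivity, ?_, ?_⟩
    · linarith [min_le_left (ℓ / 2) (ξ / 4 / (6 * L + 8 * ℓ))]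
    · rw [← le_div_iff₀ (by positivity)]
      exact min_le_right _ _
  -- Then `3Lδ' < εδ/4`; with the two bounds `εδ/4` imposed on `κ` below, the sum required in
  -- `hsmall` stays under `εδ`. The `ε` in the denominator ensures `δ' ≤ δ`.
  set δ' := ε * δ / (12 * L + ε) with hδ'def
  have hδ' : 0 < δ' := by positivity
  have hδ'e : δ' * (12 * L + ε) = ε * δ := div_mul_cancel₀ _ (by positivity)
  have hδδ' : δ' ≤ δ := by
    rw [hδ'def, div_le_iff₀ (by positivity)]
    nlinarith
  set M := (3 * L + 1) / ε with hMdef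
  have hMe : M * ε = 3 * L + 1 := div_mul_cancel₀ _ hε.ne'
  have hM0 : 0 < M := by positivity
  have hM1 : 1 ≤ M := by
    rw [hMdef, le_div_iff₀ hε]; linarith
  obtain ⟨κ, hκ, hκ1, hκ2, hκ3⟩ : ∃ κ : ℝ, 0 < κ ∧ κ ≤ ε * δ / 4 ∧
      κ * (M * δ'⁻¹) ≤ ε * δ / 4 ∧ κ * (σ⁻¹ * (2 * δ)⁻¹) ≤ ξ / 4 := by
    refine ⟨min (ε * δ / 4) (min (ε * δ / 4 / (M * δ'⁻¹)) (ξ / 4 / (σ⁻¹ * (2 * δ)⁻¹))),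
      by positivity, min_le_left _ _, ?_, ?_⟩
    · rw [← le_div_iff₀ (by positivity)]
      exact (min_le_right _ _).trans (min_le_left _ _)
    · rw [← le_div_iff₀ (by positivity)]
      exact (min_le_right _ _).trans (min_le_right _ _)
  have hsmall : 3 * L * δ' + κ + M * (δ'⁻¹ * κ) < ε * δ := by
    have := mul_pos hδ' hε
    have := mul_pos hε hδ
    linarith
  clear_value δ' M
  refine ⟨κ, hκ, fun v hv hdist hTV => ?_⟩
  obtain ⟨r, hr, hlen, hD⟩ := h.exists_good_circle hv h1 h2 h3 hε hδ' hδδ' hδℓ hM1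
    (by linarith) hκ.le hsmall hdist hTV
  have hrℓ : |r| < ℓ := by
    rw [abs_of_pos (hδ.trans hr.1)]; exact hr.2.trans_le hδℓ
  have hcirc := abs_circulation_sub_le hv hrℓ hα hβ hγ h1 h2 h3 hsum hε.le hε1 hεL hlen hD
  refine le_trans (ENNReal.ofReal_le_ofReal ?_)
    (h.ofReal_le_area hv h1 h2 h3 hσ hσ1 hδℓ hδ hr hκ.le hdist)
  have h5 : 3 * |cross α β| - ξ / 2 ≤
      |circulation v (θ₀ + 2 * Real.pi / 3 - Real.pi) r| := by
    have h6 := abs_sub_abs_le_abs_sub (3 * cross α β)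
      (circulation v (θ₀ + 2 * Real.pi / 3 - Real.pi) r)
    rw [abs_sub_comm, abs_mul, abs_of_pos (by norm_num : (0 : ℝ) < 3)] at h6
    linarith
  have h7 : σ⁻¹ * ((2 * δ)⁻¹ * κ) ≤ ξ / 4 := by linarith
  have h8 := exterior_area_bound hσ.le hδ.le hδℓ L
  linarith

lemma IsJunctionAt.le_relaxedArea (h : IsJunctionAt u ℓ θ₀ α β γ) (hℓ : 0 < ℓ)
    (hα : ‖α‖ = 1) (hβ : ‖β‖ = 1) (hγ : ‖γ‖ = 1)
    (hval : ∀ x ∈ Metric.ball (0 : Plane) ℓ, u x = α ∨ u x = β ∨ u x = γ) (hL : 0 < L)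
    (h1 : ‖α - γ‖ = L) (h2 : ‖β - α‖ = L) (h3 : ‖γ - β‖ = L) (hsum : α + β + γ = 0) :
    ENNReal.ofReal (Real.pi * ℓ ^ 2 + 3 * L * ℓ + 3 / 2 * |cross α β|) ≤
      relaxedArea u (Metric.ball 0 ℓ) := by
  refine le_iInf fun v => le_iInf fun hv => le_iInf fun hconv => ?_
  refine ENNReal.le_of_forall_pos_le_add fun ξ hξ _ => ?_
  obtain ⟨κ, hκ, hbound⟩ := h.exists_forall_ofReal_le_area hℓ hα hβ hγ hL h1 h2 h3 hsum
    (NNReal.coe_pos.2 hξ)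
  have hTV := h.totalVariation_eq hℓ hα hβ hγ hval hL h1 h2 h3
  have e1 : ∀ᶠ k in atTop, ∫⁻ x in Metric.ball 0 ℓ, ‖v k x - u x‖ₑ ≤ ENNReal.ofReal κ :=
    (hconv.2.2.1.eventually (gt_mem_nhds (ENNReal.ofReal_pos.2 hκ))).mono fun _ hk => hk.le
  have e2 : ∀ᶠ k in atTop, totalVariation (v k) (Metric.ball 0 ℓ) ≤
      ENNReal.ofReal (3 * L * ℓ + κ) := by
    have hlt : totalVariation u (Metric.ball 0 ℓ) < ENNReal.ofReal (3 * L * ℓ + κ) := by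
      rw [hTV, ENNReal.ofReal_lt_ofReal_iff (by positivity)]
      linarith
    exact (hconv.2.2.2.eventually (gt_mem_nhds hlt)).mono fun _ hk => hk.le
  rw [← tsub_le_iff_right, ← ENNReal.ofReal_coe_nnreal, ← ENNReal.ofReal_sub _ ξ.coe_nonneg]
  refine le_liminf_of_le (by isBoundedDefault) ?_
  filter_upwards [e1, e2] with k hk1 hk2
  exact hbound (v k) (hv k) hk1 hk2

end LowerBound

end TripleJunction

/-! ### Conclusion. -/

theorem theorem1p3 (ℓ : ℝ) (hℓ : 0 < ℓ)
    (α β γ : TripleJunction.Plane) (u : TripleJunction.Plane → TripleJunction.Plane)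
    (hu : TripleJunction.IsSymmetricTripleJunction u ℓ α β γ) :
    TripleJunction.relaxedArea u (Metric.ball 0 ℓ) =
      volume (Metric.ball (0 : TripleJunction.Plane) ℓ)
        + ENNReal.ofReal ‖β - α‖ *
            Measure.hausdorffMeasure 1 (TripleJunction.jumpSet u (Metric.ball 0 ℓ))
        + volume (convexHull ℝ {α, β, γ}) := by
  obtain ⟨heq, hval, θ₀, hj⟩ := hu
  have hJ : TripleJunction.IsJunctionAt u ℓ θ₀ α β γ := hj
  have hsum := heq.sum_eq_zero
  obtain ⟨hα, hβ, hγ, hne, hd1, hd2⟩ := heq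
  have h2 : ‖β - α‖ = ‖β - α‖ := rfl
  have h3 : ‖γ - β‖ = ‖β - α‖ := by
    rw [← dist_eq_norm, ← dist_eq_norm, dist_comm γ β, dist_comm β α, hd1]
  have h1 : ‖α - γ‖ = ‖β - α‖ := by
    rw [← dist_eq_norm, ← dist_eq_norm, dist_comm α γ, dist_comm β α, hd1, hd2]
  have hL : 0 < ‖β - α‖ := norm_pos_iff.2 (sub_ne_zero.2 hne.symm)
  have hβγ : β ≠ γ := fun h => by rw [h, sub_self, norm_zero, ← h] at h3; exact hL.ne h3
  have hγα : γ ≠ α := fun h => by rw [h, sub_self, norm_zero] at h1; exact hL.ne h1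
  rw [hJ.hausdorffMeasure_jumpSet hne hβγ hγα,
    TripleJunction.volume_triangle_of_sum_eq_zero hsum, ← ENNReal.ofReal_mul hL.le]
  refine le_antisymm (hJ.relaxedArea_le hℓ hα hβ hγ hval hL h1 h2 h3 hsum) ?_
  have hvol : volume (Metric.ball (0 : TripleJunction.Plane) ℓ) =
      ENNReal.ofReal (Real.pi * ℓ ^ 2) := by
    rw [EuclideanSpace.volume_ball_fin_two, ENNReal.ofReal_mul Real.pi_pos.le,
      ENNReal.ofReal_pow hℓ.le, mul_comm, ← NNReal.coe_real_pi, ENNReal.ofReal_coe_nnreal]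
  rw [hvol, ← ENNReal.ofReal_add (by positivity) (by positivity),
    ← ENNReal.ofReal_add (by positivity) (by positivity)]
  refine le_trans (ENNReal.ofReal_le_ofReal (le_of_eq ?_))
    (hJ.le_relaxedArea hℓ hα hβ hγ hval hL h1 h2 h3 hsum)
  ring
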